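/- **Theorem (Unique ergodicity).** Let $n\ge 1$, $\mathbf d=(d_1,\dots,d_n)\in\mathbb{Z}_{\ge 0}^n$, and let $p\in\mathbb{C}[z_1,\dots,z_n]$ be a Lee–Yang polynomial of multidegree $\mathbf d$: $p$ has degree $d_j$ in each variable $z_j$, and $p(\mathbf z)\neq 0$ whenever $|z_j|<1$ for all $j$ or $|z_j|>1$ for all $j$. Let $p^{\mathrm{red}}$ be the product of the distinct irreducible factors of $p$ (up to constants, each taken once), and let $\mathbf d^{\mathrm{red}}$ be its multidegree. Write $\exp(i\mathbf x)=(e^{ix_1},\dots,e^{ix_n})$, $$\Sigma_p=\{\mathbf x\in\mathbb{R}^n/2\pi\mathbb{Z}^n : p(\exp(i\mathbf x))=0\},$$ and let $\mathrm{mult}(\mathbf x)$ be the multiplicity of $\exp(i\mathbf x)$ as a zero of $p$. Let $\ell\in\mathbb{R}^n$ have strictly positive, $\mathbb{Q}$-linearly independent entries. For $\mathbf x\in\Sigma_p$ let $$\tau_\ell(\mathbf x)=\min\{t>0:\mathbf x+t\ell\in\Sigma_p\},\qquad T_\ell(\mathbf x)=\mathbf x+\tau_\ell(\mathbf x)\ell$$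 be the first-return time and the first-return map, and let $\mathbf m_\ell$ be the Borel measure on $\Sigma_p$ given for Borel $A\subset\Sigma_p$ by $$\mathbf m_\ell(A)=\lim_{\epsilon\to 0^+}\frac{\mathrm{vol}_n(\{\mathbf x+t\ell:\mathbf x\in A,\ |t|<\epsilon\})}{2\epsilon},$$ where $\mathrm{vol}_n$ is Lebesgue measure on $\mathbb{R}^n/2\pi\mathbb{Z}^n$, of total mass $(2\pi)^n$. For $\mathbf x_0\in\Sigma_p$ let $(x_j)_{j\in\mathbb{Z}}$ be the real zeros of $x\mapsto p(\exp(i(\mathbf x_0+x\ell)))$, in increasing order and repeated according to multiplicity (numbered from an arbitrary starting point). These objects are well defined: the limits exist for all Borel $A\subset\Sigma_p$ and define a measure, the minimum defining $\tau_\ell(\mathbf x)$ is attained for every $\mathbf x\in\Sigma_p$, and the zeros can be listed as stated for every $\mathbf x_0\in\Sigma_p$. Moreover $$\mathbf m_\ell(\Sigma_p)=(2\pi)^{n-1}\langle\mathbf d^{\mathrm{red}},\ell\rangle,\qquad \int_{\Sigma_p}\mathrm{mult}\,d\mathbf m_\ell=(2\pi)^{n-1}\langle\mathbf d,\ell\rangle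 .$$ Finally, let $h:\Sigma_p\to\mathbb{C}$ be bounded and Riemann integrable, meaning that the closure of its set of discontinuities has zero $(n-1)$-dimensional volume. Then $h$ and $\mathrm{mult}\cdot h$ are $\mathbf m_\ell$-integrable, and for every $\mathbf x_0\in\Sigma_p$ $$\lim_{N\to\infty}\frac1N\sum_{j=1}^{N}h(T_\ell^j(\mathbf x_0))=\frac{1}{(2\pi)^{n-1}\langle\mathbf d^{\mathrm{red}},\ell\rangle}\int_{\Sigma_p}h\,d\mathbf m_\ell,$$ $$\lim_{N\to\infty}\frac1N\sum_{j=1}^{N}h(\mathbf x_0+x_j\ell)=\frac{1}{(2\pi)^{n-1}\langle\mathbf d,\ell\rangle}\int_{\Sigma_p}\mathrm{mult}(\mathbf x)\,h(\mathbf x)\,d\mathbf m_\ell(\mathbf x).$$ In particular both limits are independent of $\mathbf x_0$. -/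

import Mathlib

open MeasureTheory Filter Topology
open scoped Real BigOperators

noncomputable section

namespace LeeYangTorus

/-- `LY_d(n)`: polynomials of degree `d j` in each variable `z j`, with no zeros in the product of
the open unit discs and no zeros in the product of the exteriors of the closed unit disc. -/
def LY {n : ℕ} (d : Fin n → ℕ) : Set (MvPolynomial (Fin n) ℂ) :=
  {p | (∀ j, p.degreeOf j = d j) ∧
    (∀ z : Fin n → ℂ, (∀ j, ‖z j‖ < 1) → MvPolynomial.eval z p ≠ 0) ∧
    (∀ z : Fin n → ℂ, (∀ j, 1 < ‖z j‖) → MvPolynomial.eval z p ≠ 0)}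

/-- The pairing `⟨d, ℓ⟩`. -/
def pairing {n : ℕ} (d : Fin n → ℕ) (ℓ : Fin n → ℝ) : ℝ := ∑ j, (d j : ℝ) * ℓ j

open Classical in
/-- The reduced polynomial: the product of the distinct (pairwise non-associated) irreducible
factors of `p`. It is well defined up to a nonzero constant, which does not affect its degrees. -/
def reduced {n : ℕ} (p : MvPolynomial (Fin n) ℂ) : MvPolynomial (Fin n) ℂ :=
  letI : StrongNormalizationMonoid (MvPolynomial (Fin n) ℂ) :=
    UniqueFactorizationMonoid.strongNormalizationMonoid
  UniqueFactorizationMonoid.radical p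

/-- The multidegree `d^red` of the reduced polynomial. -/
def redDegree {n : ℕ} (p : MvPolynomial (Fin n) ℂ) : Fin n → ℕ :=
  fun j => (reduced p).degreeOf j

instance twoPiPos : Fact (0 < 2 * π) := ⟨Real.two_pi_pos⟩

/-- The torus `ℝⁿ / 2πℤⁿ`. Its `volume` is Lebesgue measure, of total mass `(2π)ⁿ`. Its Mathlib
metric is the supremum of the arc-length metrics of the factors, which is bi-Lipschitz equivalent
to the flat Riemannian metric. -/
abbrev Torus (n : ℕ) : Type := Fin n → AddCircle (2 * π)

/-- The map `x ↦ exp(ix)`, coordinatewise, from the torus to `ℂⁿ`. -/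
def expI {n : ℕ} (x : Torus n) : Fin n → ℂ := fun j => ((x j).toCircle : ℂ)

/-- The torus zero set `Σ_p`. -/
def zeroSet {n : ℕ} (p : MvPolynomial (Fin n) ℂ) : Set (Torus n) :=
  {x | MvPolynomial.eval (expI x) p = 0}

theorem measurableSet_zeroSet {n : ℕ} (p : MvPolynomial (Fin n) ℂ) :
    MeasurableSet (zeroSet p) := by
  have hc : Continuous (expI (n := n)) :=
    continuous_pi fun j =>
      continuous_subtype_val.comp (AddCircle.continuous_toCircle.comp (continuous_apply j))
  exact (isClosed_eq (p.continuous_eval.comp hc) continuous_const).measurableSet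

/-- The linear flow `x ↦ x + tℓ` on the torus. -/
def flow {n : ℕ} (ℓ : Fin n → ℝ) (t : ℝ) (x : Torus n) : Torus n :=
  fun j => x j + ((t * ℓ j : ℝ) : AddCircle (2 * π))

/-- The first return time `τ_ℓ` of a point to `Σ_p`. -/
def returnTime {n : ℕ} (p : MvPolynomial (Fin n) ℂ) (ℓ : Fin n → ℝ) (x : Torus n) : ℝ :=
  sInf {t : ℝ | 0 < t ∧ flow ℓ t x ∈ zeroSet p}

/-- The first return map `T_ℓ`. -/
def returnMap {n : ℕ} (p : MvPolynomial (Fin n) ℂ) (ℓ : Fin n → ℝ) (x : Torus n) : Torus n :=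
  flow ℓ (returnTime p ℓ x) x

/-- `A_{εℓ}`, the set of all `x + tℓ` with `x ∈ A` and `|t| < ε`. -/
def thicken {n : ℕ} (ℓ : Fin n → ℝ) (ε : ℝ) (A : Set (Torus n)) : Set (Torus n) :=
  {y | ∃ x ∈ A, ∃ t : ℝ, |t| < ε ∧ y = flow ℓ t x}

/-- `m` is a Borel measure carried by `Σ_p` with `m(A) = lim_{ε → 0+} vol(A_{εℓ}) / (2ε)` for
every Borel subset `A` of `Σ_p`. There is at most one such measure. -/
def IsFlowMeasure {n : ℕ} (p : MvPolynomial (Fin n) ℂ) (ℓ : Fin n → ℝ)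
    (m : Measure (Torus n)) : Prop :=
  m (zeroSet p)ᶜ = 0 ∧
    ∀ A : Set (Torus n), MeasurableSet A → A ⊆ zeroSet p →
      Tendsto (fun ε : ℝ => volume (thicken ℓ ε A) / ENNReal.ofReal (2 * ε)) (𝓝[>] 0) (𝓝 (m A))

open Classical in
/-- The measure `m_ℓ` on `Σ_p`, regarded as a measure on the torus that is carried by `Σ_p`
(and zero, should the limits above fail to define a measure). -/
def flowMeasure {n : ℕ} (p : MvPolynomial (Fin n) ℂ) (ℓ : Fin n → ℝ) : Measure (Torus n) :=
  if h : ∃ m, IsFlowMeasure p ℓ m then h.choose else 0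

/-- The limits determine the measure. -/
theorem IsFlowMeasure.unique {n : ℕ} {p : MvPolynomial (Fin n) ℂ} {ℓ : Fin n → ℝ}
    {m m' : Measure (Torus n)} (h : IsFlowMeasure p ℓ m)
    (h' : IsFlowMeasure p ℓ m') : m = m' := by
  have hS := measurableSet_zeroSet p
  ext A hA
  have key : ∀ μ : Measure (Torus n), μ (zeroSet p)ᶜ = 0 → μ A = μ (A ∩ zeroSet p) := by
    intro μ hμ
    have h1 := measure_inter_add_sdiff (μ := μ) A hS
    have h2 : μ (A \ zeroSet p) = 0 := measure_mono_null (fun x hx => hx.2) hμ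
    rw [h2, add_zero] at h1
    exact h1.symm
  rw [key m h.1, key m' h'.1]
  exact tendsto_nhds_unique (h.2 _ (hA.inter hS) Set.inter_subset_right)
    (h'.2 _ (hA.inter hS) Set.inter_subset_right)

/-- `mult(x)`: the multiplicity of `exp(ix)` as a zero of `p`, that is, the least total degree of
a monomial in the Taylor expansion of `p` at `exp(ix)`. -/
def mult {n : ℕ} (p : MvPolynomial (Fin n) ℂ) (x : Torus n) : ℕ :=
  sInf {k : ℕ | ∃ α ∈ (MvPolynomial.bind₁
    (fun j => MvPolynomial.X j + MvPolynomial.C (expI x j)) p).support, Finsupp.degree α = k}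

/-- The exponential polynomial `t ↦ p(exp(i(x₀ + tℓ)))`. -/
def lineFun {n : ℕ} (p : MvPolynomial (Fin n) ℂ) (ℓ : Fin n → ℝ) (x₀ : Torus n) (t : ℝ) : ℂ :=
  MvPolynomial.eval (expI (flow ℓ t x₀)) p

/-- `(x_j)_{j ∈ ℤ}` lists the real zeros of `t ↦ p(exp(i(x₀ + tℓ)))` in increasing order, each
zero as often as its multiplicity. -/
def IsZeroSequence {n : ℕ} (p : MvPolynomial (Fin n) ℂ) (ℓ : Fin n → ℝ) (x₀ : Torus n)
    (x : ℤ → ℝ) : Prop :=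
  Monotone x ∧ ∀ t : ℝ, {j : ℤ | x j = t}.encard = analyticOrderAt (lineFun p ℓ x₀) t

/-- `h` is bounded on `Σ_p`. -/
def BoundedOnZeroSet {n : ℕ} (p : MvPolynomial (Fin n) ℂ) (h : Torus n → ℂ) : Prop :=
  ∃ C : ℝ, ∀ x ∈ zeroSet p, ‖h x‖ ≤ C

/-- The restriction of `h` to `Σ_p` is Riemann integrable: the closure of the set of its
discontinuities has zero `(n-1)`-dimensional volume (Hausdorff measure). -/
def RiemannIntegrableOnZeroSet {n : ℕ} (p : MvPolynomial (Fin n) ℂ) (h : Torus n → ℂ) : Prop :=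
  Measure.hausdorffMeasure ((n : ℝ) - 1)
    (closure {x | x ∈ zeroSet p ∧ ¬ ContinuousWithinAt h (zeroSet p) x}) = 0

end LeeYangTorus

end

/-!
The zero set `Σ_p` of a nonconstant `p` is a cross-section of the linear flow `x ↦ x + tℓ`: it is
closed, it meets every orbit, and an orbit meets it a bounded number of times per unit time. This is
where the Lee–Yang property enters: `w ↦ p(exp(i(x + wℓ)))` has only real zeros, because all
coordinates move into the polydisc, or all out of it, as soon as `w` leaves the real line. By
Hurwitz's theorem, real zeros then persist as real zeros under perturbation of `x`
(`eventually_exists_hit`), and Jensen's formula bounds their number (`exists_hits_bound`).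

The measure of a set `A ⊆ Σ_p` is the number of visits to `A` in a unit time window, integrated over
the starting point. This defines `crossMeasure`, for which Campbell's formula
(`lintegral_hitSum_eq`) holds: the volume of the torus, with every point counted once for each
visit, is the product of the measure of the cross-section and Lebesgue measure on the line. The
limits of `vol(A_{εℓ}) / 2ε` follow (`isFlowMeasure_crossMeasure`).

For the averages, let `g` be bounded on `Σ_p` and continuous off a closed null set that contains all
tangencies of the flow with `Σ_p`. The sum of `g` over the visits in a unit time window is then a
bounded function on the torus, continuous off a closed null set, so its time averages converge along
every orbit to its mean by Weyl's equidistribution theorem. This is `tendsto_visitSum_div`. Dividing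
the statement for `h` by the one for `1` gives the average over the returns
(`tendsto_average_iterate`); dividing the statement for `mult · h` by the one for `mult` gives the
average over the zeros counted with multiplicity (`IsVisitListing.tendsto_average`). The order of
the zero along the line is the multiplicity of `exp(ix)` as a zero of `p`, since the lowest
homogeneous part of `p` at that point cannot vanish in the direction of the flow, again by Hurwitz's
theorem (`analyticOrderAt_lineC_zero`).

The mass `∫ mult` comes from Jensen's formula for `w ↦ p(exp(i(x + wℓ)))` on the circle of radius
`R` and centre `R + i`, integrated over `x`. By Campbell's formula the zeros contribute `∫ mult`
times the integral of a kernel, which is `2R + o(R)`. The logarithmic means over the torus are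
explicit on either side of the real line and grow only below it, with slope `⟨d, ℓ⟩`; comparing the
terms linear in `R` gives `lintegral_mult`. The mass of `Σ_p` itself is the same formula for the
reduced polynomial, whose multiplicity is one off the tangencies.

It remains to see that the tangencies, and sets of zero `(n-1)`-dimensional volume, are null. A set
with small `(n-1)`-dimensional Hausdorff measure is covered by small balls, and a ball of radius `r`
has measure `O(r^(n-1))`, whence `crossMeasure_eq_zero_of_hausdorffMeasure`. The tangencies lie on
the common zeros of the reduced polynomial and its derivative along `ℓ`. An irreducible factor does
not divide its own derivative along `ℓ`, as `ℓ` is positive and the factor has no zero at the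
origin, so one variable can be eliminated: the remaining variables lie in a null set. At each
tangency some iterated derivative of the reduced polynomial along `ℓ` has a simple zero along the
flow, so that its zeros near that point lie on a Lipschitz graph over the remaining variables, and
`hausdorffMeasure_tangency_eq_zero` follows.
-/

noncomputable section

namespace LeeYangTorus

section

/-! ### The linear flow -/

variable {n : ℕ} {ℓ : Fin n → ℝ}

@[simp] theorem flow_zero (x : Torus n) : flow ℓ 0 x = x := by
  funext j; simp [flow]

theorem flow_flow (s t : ℝ) (x : Torus n) : flow ℓ s (flow ℓ t x) = flow ℓ (t + s) x := by
  funext j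
  simp only [flow, add_mul, AddCircle.coe_add]
  abel

@[simp] theorem flow_neg_flow (t : ℝ) (x : Torus n) : flow ℓ (-t) (flow ℓ t x) = x := by
  rw [flow_flow]; simp

theorem flow_neg_direction (t : ℝ) (x : Torus n) : flow (-ℓ) t x = flow ℓ (-t) x := by
  funext j; simp [flow]

theorem continuous_flow : Continuous fun z : ℝ × Torus n => flow ℓ z.1 z.2 := by
  refine continuous_pi fun j => ?_
  refine ((continuous_apply j).comp continuous_snd).add ?_
  exact (AddCircle.continuous_mk' _).comp (continuous_fst.mul continuous_const)

theorem continuous_flow_left (x : Torus n) : Continuous fun t => flow ℓ t x :=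
  continuous_flow.comp (continuous_id.prodMk continuous_const)

theorem continuous_flow_right (t : ℝ) : Continuous (flow ℓ t : Torus n → Torus n) :=
  continuous_flow.comp (continuous_const.prodMk continuous_id)

theorem measurePreserving_flow (t : ℝ) :
    MeasurePreserving (flow ℓ t : Torus n → Torus n) volume volume :=
  measurePreserving_add_right volume (fun j => ((t * ℓ j : ℝ) : AddCircle (2 * π)))

theorem lintegral_flow (t : ℝ) {f : Torus n → ENNReal} (hf : Measurable f) :
    ∫⁻ y, f (flow ℓ t y) = ∫⁻ y, f y :=
  (measurePreserving_flow t).lintegral_comp hf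

theorem integral_flow (t : ℝ) (f : Torus n → ℂ) : ∫ y, f (flow ℓ t y) = ∫ y, f y := by
  have := integral_add_right_eq_self (μ := (volume : Measure (Torus n))) f
    (fun j => ((t * ℓ j : ℝ) : AddCircle (2 * π)))
  exact this

theorem volume_univ_torus : volume (Set.univ : Set (Torus n)) = ENNReal.ofReal ((2 * π) ^ n) := by
  rw [← Set.pi_univ Set.univ, volume_pi_pi]
  simp only [AddCircle.measure_univ, Finset.prod_const, Finset.card_univ, Fintype.card_fin]
  rw [ENNReal.ofReal_pow Real.two_pi_pos.le]

theorem volume_real_univ_torus : (volume : Measure (Torus n)).real Set.univ = (2 * π) ^ n := by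
  rw [measureReal_def, volume_univ_torus, ENNReal.toReal_ofReal (by positivity)]

/-! ### Equidistribution of the orbits -/

/-- The character `x ↦ exp(i⟨k, x⟩)` of the torus. -/
def character (k : Fin n → ℤ) : C(Torus n, ℂ) where
  toFun x := ∏ j, fourier (k j) (x j)
  continuous_toFun := by fun_prop

theorem character_flow (k : Fin n → ℤ) (t : ℝ) (x : Torus n) :
    character k (flow ℓ t x) =
      Complex.exp (((∑ j, (k j : ℝ) * ℓ j : ℝ) : ℂ) * Complex.I * t) * character k x := by
  simp only [character, ContinuousMap.coe_mk, flow, fourier_apply, smul_add, AddCircle.toCircle_add,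
    Circle.coe_mul, Finset.prod_mul_distrib]
  rw [mul_comm]
  congr 1
  push_cast
  rw [Finset.sum_mul, Finset.sum_mul, Complex.exp_sum]
  refine Finset.prod_congr rfl fun j _ => ?_
  rw [← AddCircle.coe_zsmul, AddCircle.toCircle_apply_mk, Circle.coe_exp]
  congr 1
  have : (π : ℂ) ≠ 0 := by exact_mod_cast Real.pi_ne_zero
  simp
  field_simp

/-- The trigonometric polynomials are dense in the continuous functions on the torus. -/
theorem span_character_closure_eq_top :
    (Submodule.span ℂ (Set.range (character (n := n)))).topologicalClosure = ⊤ := by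
  have hmul : ∀ a ∈ Submodule.span ℂ (Set.range (character (n := n))),
      ∀ b ∈ Submodule.span ℂ (Set.range (character (n := n))),
        a * b ∈ Submodule.span ℂ (Set.range (character (n := n))) := by
    intro a ha b hb
    refine Submodule.span_induction₂ (p := fun a b _ _ => a * b ∈ Submodule.span ℂ
      (Set.range (character (n := n)))) ?_ ?_ ?_ ?_ ?_ ?_ ?_ ha hb
    · rintro _ _ ⟨k, rfl⟩ ⟨m, rfl⟩
      refine Submodule.subset_span ⟨k + m, ?_⟩
      ext x
      simp [character, Finset.prod_mul_distrib]
    · simp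
    · simp
    · intro a b c _ _ _ h1 h2; rw [add_mul]; exact Submodule.add_mem _ h1 h2
    · intro a b c _ _ _ h1 h2; rw [mul_add]; exact Submodule.add_mem _ h1 h2
    · intro r a b _ _ h; rw [smul_mul_assoc]; exact Submodule.smul_mem _ _ h
    · intro r a b _ _ h; rw [mul_smul_comm]; exact Submodule.smul_mem _ _ h
  -- the span is a star subalgebra that separates points, so Stone–Weierstrass applies
  let A : StarSubalgebra ℂ C(Torus n, ℂ) :=
    { carrier := {f | f ∈ Submodule.span ℂ (Set.range (character (n := n)))}
      add_mem' := fun ha hb =>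
        (Submodule.span ℂ (Set.range (character (n := n)))).add_mem ha hb
      mul_mem' := by
        intro a b ha hb
        exact hmul a ha b hb
      algebraMap_mem' := by
        intro r
        have : algebraMap ℂ C(Torus n, ℂ) r = r • character 0 := by
          ext x; simp [character, Algebra.algebraMap_eq_smul_one]
        rw [this]
        exact (Submodule.span ℂ (Set.range (character (n := n)))).smul_mem _
          (Submodule.subset_span ⟨0, rfl⟩)
      star_mem' := by
        intro a ha
        refine Submodule.span_induction (p := fun a _ => star a ∈ Submodule.span ℂ
          (Set.range (character (n := n)))) ?_ ?_ ?_ ?_ ha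
        · rintro _ ⟨k, rfl⟩
          refine Submodule.subset_span ⟨-k, ?_⟩
          ext x
          simp [character]
        · simp
        · intro a b _ _ h1 h2; rw [star_add]; exact Submodule.add_mem _ h1 h2
        · intro r a _ h; rw [star_smul]; exact Submodule.smul_mem _ _ h }
  have hA : A.SeparatesPoints := by
    intro x y hxy
    obtain ⟨j, hj⟩ := Function.ne_iff.1 hxy
    have hmem : character (Pi.single j 1) ∈ Submodule.span ℂ (Set.range (character (n := n))) :=
      Submodule.subset_span ⟨_, rfl⟩
    have hmemA : character (Pi.single j 1) ∈ A := hmem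
    refine ⟨character (Pi.single j 1), Set.mem_image_of_mem _ hmemA, ?_⟩
    have h : ∀ z : Torus n, character (Pi.single j 1) z = fourier 1 (z j) := by
      intro z
      simp only [character, ContinuousMap.coe_mk]
      rw [Finset.prod_eq_single j]
      · simp
      · intro b _ hb; simp [hb]
      · simp
    rw [h, h, fourier_one, fourier_one]
    intro heq
    exact hj (AddCircle.injective_toCircle (Real.two_pi_pos.ne') (Subtype.ext heq))
  have h := ContinuousMap.starSubalgebra_topologicalClosure_eq_top_of_separatesPoints A hA
  have h2 : ((Submodule.span ℂ (Set.range (character (n := n)))).topologicalClosure :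
      Set C(Torus n, ℂ))
      = (A.topologicalClosure : Set C(Torus n, ℂ)) := rfl
  rw [h] at h2
  exact SetLike.coe_injective (by rw [h2]; simp)

theorem continuous_comp_flow {f : Torus n → ℂ} (hf : Continuous f) (x : Torus n) :
    Continuous fun t => f (flow ℓ t x) := hf.comp (continuous_flow_left x)

/-- A character with nonzero frequency has mean zero, by invariance of the integral under the flow
for half a period. -/
theorem integral_character_eq_zero (k : Fin n → ℤ) (hk : ∑ j, (k j : ℝ) * ℓ j ≠ 0) :
    ∫ x, character k x = 0 := by
  set c : ℝ := ∑ j, (k j : ℝ) * ℓ j with hc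
  have h : ∀ t : ℝ, Complex.exp ((c : ℂ) * Complex.I * t) * ∫ x, character k x
      = ∫ x, character k x := by
    intro t
    rw [← integral_const_mul]
    conv_rhs => rw [← integral_flow (ℓ := ℓ) t]
    refine integral_congr_ae (Eventually.of_forall fun x => ?_)
    simp only [character_flow, hc]
  have h1 := h (π / c)
  have h2 : (c : ℂ) * Complex.I * ((π / c : ℝ) : ℂ) = π * Complex.I := by
    have : (c : ℂ) ≠ 0 := by exact_mod_cast hk
    push_cast
    field_simp
  rw [h2, Complex.exp_pi_mul_I] at h1
  have : (2 : ℂ) * ∫ x, character k x = 0 := by linear_combination -h1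
  simpa using this

theorem frequency_ne_zero (hind : LinearIndependent ℚ ℓ) {k : Fin n → ℤ} (hk : k ≠ 0) :
    ∑ j, (k j : ℝ) * ℓ j ≠ 0 := by
  intro h
  apply hk
  have := Fintype.linearIndependent_iff.1 hind (fun j => (k j : ℚ)) (by
    rw [← h]
    refine Finset.sum_congr rfl fun j _ => ?_
    simp [Rat.smul_def])
  funext j
  exact_mod_cast this j

/-- The time average of `f` along the orbit of `x` over `[0, T]`. -/
def timeAverage (ℓ : Fin n → ℝ) (f : Torus n → ℂ) (x : Torus n) (T : ℝ) : ℂ :=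
  (1 / (T : ℂ)) * ∫ t in (0 : ℝ)..T, f (flow ℓ t x)

/-- The space average of `f` over the torus. -/
def spaceAverage (f : Torus n → ℂ) : ℂ := (1 / ((2 * π) ^ n : ℂ)) * ∫ x, f x

theorem norm_timeAverage_sub_le {f g : Torus n → ℂ} (hf : Continuous f) (hg : Continuous g) {C : ℝ}
    (h : ∀ y, ‖f y - g y‖ ≤ C) (x : Torus n) {T : ℝ} (hT : 0 < T) :
    ‖timeAverage ℓ f x T - timeAverage ℓ g x T‖ ≤ C := by
  unfold timeAverage
  rw [← mul_sub, ← intervalIntegral.integral_sub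
    ((continuous_comp_flow hf x).intervalIntegrable _ _)
    ((continuous_comp_flow hg x).intervalIntegrable _ _), norm_mul]
  have := intervalIntegral.norm_integral_le_of_norm_le_const (a := 0) (b := T) (C := C)
    (f := fun t => f (flow ℓ t x) - g (flow ℓ t x)) (fun t _ => h _)
  rw [sub_zero, abs_of_pos hT] at this
  have h2 : ‖(1 / (T : ℂ))‖ = 1 / T := by simp [abs_of_pos hT]
  rw [h2]
  calc _ ≤ 1 / T * (C * T) := by gcongr
    _ = C := by field_simp

theorem norm_spaceAverage_sub_le {f g : Torus n → ℂ} (hf : Integrable f) (hg : Integrable g)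
    {C : ℝ} (h : ∀ y, ‖f y - g y‖ ≤ C) :
    ‖spaceAverage f - spaceAverage g‖ ≤ C := by
  unfold spaceAverage
  rw [← mul_sub, ← integral_sub hf hg, norm_mul]
  have := norm_integral_le_of_norm_le_const (μ := (volume : Measure (Torus n))) (C := C)
    (f := fun t => f t - g t) (Eventually.of_forall h)
  rw [volume_real_univ_torus] at this
  have h2 : ‖(1 / ((2 * π) ^ n : ℂ))‖ = 1 / (2 * π) ^ n := by
    simp [abs_of_pos Real.pi_pos]
  rw [h2]
  calc _ ≤ 1 / (2 * π) ^ n * (C * (2 * π) ^ n) := by gcongr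
    _ = C := by field_simp

theorem integrable_of_continuous_torus {f : Torus n → ℂ} (hf : Continuous f) : Integrable f :=
  hf.integrable_of_hasCompactSupport (HasCompactSupport.of_compactSpace f)

theorem tendsto_timeAverage_character (hind : LinearIndependent ℚ ℓ) (k : Fin n → ℤ)
    (x : Torus n) :
    Tendsto (timeAverage ℓ (character k) x) atTop (𝓝 (spaceAverage (character k))) := by
  by_cases hk : k = 0
  · subst hk
    have h1 : spaceAverage (character (0 : Fin n → ℤ)) = 1 := by
      simp only [spaceAverage, character, ContinuousMap.coe_mk]
      simp only [Pi.zero_apply, fourier_zero, Finset.prod_const_one, integral_const,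
        volume_real_univ_torus]
      have : (π : ℂ) ≠ 0 := by exact_mod_cast Real.pi_ne_zero
      simp [this]
    rw [h1]
    refine tendsto_const_nhds.congr' ?_
    filter_upwards [eventually_gt_atTop 0] with T hT
    have : (T : ℂ) ≠ 0 := by exact_mod_cast hT.ne'
    simp [timeAverage, character, this]
  · have hc := frequency_ne_zero hind hk
    rw [spaceAverage, integral_character_eq_zero k hc, mul_zero]
    set c : ℝ := ∑ j, (k j : ℝ) * ℓ j with hcdef
    have hcI : (c : ℂ) * Complex.I ≠ 0 := mul_ne_zero (by exact_mod_cast hc) Complex.I_ne_zero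
    -- the integral over `[0, T]` of a nonconstant character is bounded
    refine squeeze_zero_norm' (a := fun T : ℝ => (1 / T) * (2 / |c| * ‖character k x‖)) ?_ ?_
    · filter_upwards [eventually_gt_atTop 0] with T hT
      unfold timeAverage
      simp only [character_flow]
      rw [intervalIntegral.integral_mul_const, ← hcdef, integral_exp_mul_complex hcI]
      rw [norm_mul, norm_mul, norm_div (Complex.exp _ - _)]
      have h2 : ‖(1 / (T : ℂ))‖ = 1 / T := by simp [abs_of_pos hT]
      rw [h2]
      have h3 : ‖(c : ℂ) * Complex.I‖ = |c| := by simp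
      rw [h3]
      have h4 : ‖Complex.exp ((c : ℂ) * Complex.I * T)
          - Complex.exp ((c : ℂ) * Complex.I * (0 : ℝ))‖ ≤ 2 := by
        refine (norm_sub_le _ _).trans ?_
        have e1 : (c : ℂ) * Complex.I * T = ((c * T : ℝ) : ℂ) * Complex.I := by push_cast; ring
        rw [e1, Complex.norm_exp_ofReal_mul_I]
        simp; norm_num
      gcongr
    · simpa using (tendsto_const_nhds (x := (1 : ℝ)).div_atTop tendsto_id).mul_const
        (2 / |c| * ‖character k x‖)

/-- **Weyl's equidistribution theorem** for the linear flow: along every orbit the time averages of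
a continuous function converge to its space average. -/
theorem tendsto_timeAverage (hind : LinearIndependent ℚ ℓ) {f : Torus n → ℂ} (hf : Continuous f)
    (x : Torus n) :
    Tendsto (timeAverage ℓ f x) atTop (𝓝 (spaceAverage f)) := by
  have hspan : ∀ g ∈ Submodule.span ℂ (Set.range (character (n := n))),
      Tendsto (timeAverage ℓ g x) atTop (𝓝 (spaceAverage g)) := by
    intro g hg
    induction hg using Submodule.span_induction with
    | mem g hg => obtain ⟨k, rfl⟩ := hg; exact tendsto_timeAverage_character hind k x
    | zero =>
      have : timeAverage ℓ (0 : C(Torus n, ℂ)) x = fun _ => 0 := by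
        funext T; simp [timeAverage]
      rw [this]
      simp [spaceAverage]
    | add a b _ _ ha hb =>
      have e1 : timeAverage ℓ (a + b : C(Torus n, ℂ)) x
          = fun T => timeAverage ℓ a x T + timeAverage ℓ b x T := by
        funext T
        simp only [timeAverage, ContinuousMap.coe_add, Pi.add_apply]
        rw [intervalIntegral.integral_add
          ((continuous_comp_flow a.continuous x).intervalIntegrable _ _)
          ((continuous_comp_flow b.continuous x).intervalIntegrable _ _), mul_add]
      have e2 : spaceAverage (a + b : C(Torus n, ℂ)) = spaceAverage a + spaceAverage b := by
        simp only [spaceAverage, ContinuousMap.coe_add, Pi.add_apply]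
        rw [integral_add (integrable_of_continuous_torus a.continuous)
          (integrable_of_continuous_torus b.continuous), mul_add]
      rw [e1, e2]
      exact ha.add hb
    | smul r a _ ha =>
      have e1 : timeAverage ℓ (r • a : C(Torus n, ℂ)) x = fun T => r * timeAverage ℓ a x T := by
        funext T
        simp only [timeAverage, ContinuousMap.coe_smul, Pi.smul_apply, smul_eq_mul]
        rw [intervalIntegral.integral_const_mul]; ring
      have e2 : spaceAverage (r • a : C(Torus n, ℂ)) = r * spaceAverage a := by
        simp only [spaceAverage, ContinuousMap.coe_smul, Pi.smul_apply, smul_eq_mul]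
        rw [integral_const_mul]; ring
      rw [e1, e2]
      exact ha.const_mul r
  rw [Metric.tendsto_atTop]
  intro ε hε
  let F : C(Torus n, ℂ) := ⟨f, hf⟩
  have hF : F ∈ (Submodule.span ℂ (Set.range (character (n := n)))).topologicalClosure := by
    rw [span_character_closure_eq_top]; trivial
  -- uniform approximation by a trigonometric polynomial `g`
  obtain ⟨g, hg, hgF⟩ := Metric.mem_closure_iff.1 hF (ε / 4) (by positivity)
  have hb : ∀ y, ‖f y - g y‖ ≤ ε / 4 := by
    intro y
    rw [← dist_eq_norm]
    exact (ContinuousMap.dist_apply_le_dist (f := F) (g := g) y).trans hgF.le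
  obtain ⟨N, hN⟩ := Metric.tendsto_atTop.1 (hspan g hg) (ε / 4) (by positivity)
  refine ⟨max N 1, fun T hT => ?_⟩
  have h1 := norm_timeAverage_sub_le (ℓ := ℓ) hf g.continuous hb x
    (lt_of_lt_of_le one_pos ((le_max_right N 1).trans hT))
  have h2 := norm_spaceAverage_sub_le (integrable_of_continuous_torus hf)
    (integrable_of_continuous_torus g.continuous) hb
  have h3 := hN T ((le_max_left _ _).trans hT)
  rw [← dist_eq_norm] at h1 h2
  have := dist_triangle4 (timeAverage ℓ f x T) (timeAverage ℓ g x T) (spaceAverage g)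
    (spaceAverage f)
  rw [dist_comm (spaceAverage g)] at this
  linarith

/-- Every forward orbit visits every nonempty open set at arbitrarily late times. -/
theorem exists_flow_mem (hind : LinearIndependent ℚ ℓ) {U : Set (Torus n)} (hU : IsOpen U)
    (hne : U.Nonempty) (x : Torus n) (T₀ : ℝ) : ∃ t > T₀, flow ℓ t x ∈ U := by
  by_contra hcon
  push Not at hcon
  obtain ⟨u, hu⟩ := hne
  set T₁ := max T₀ 0
  -- `φ` is supported in `U` and has positive mean, but its time averages would tend to zero
  let φ : Torus n → ℝ := fun y => Metric.infDist y Uᶜ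
  have hφc : Continuous φ := Metric.continuous_infDist_pt _
  have hφ : ∀ t > T₁, φ (flow ℓ t x) = 0 := fun t ht =>
    Metric.infDist_zero_of_mem (hcon t ((le_max_left _ _).trans_lt ht))
  have hUc : (Uᶜ).Nonempty := ⟨_, hcon (T₀ + 1) (by simp)⟩
  have hpos : 0 < ∫ y, φ y := by
    rw [integral_pos_iff_support_of_nonneg (fun y => Metric.infDist_nonneg)]
    · refine lt_of_lt_of_le (hU.measure_pos volume ⟨u, hu⟩) (measure_mono fun y hy => ?_)
      exact ((hU.isClosed_compl.notMem_iff_infDist_pos hUc).1 (by simpa using hy)).ne'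
    · exact hφc.integrable_of_hasCompactSupport (HasCompactSupport.of_compactSpace φ)
  have hcφ : Continuous fun y => (φ y : ℂ) := Complex.continuous_ofReal.comp hφc
  have hlim := tendsto_timeAverage hind hcφ (flow ℓ T₁ x)
  have hz : Tendsto (timeAverage ℓ (fun y => (φ y : ℂ)) (flow ℓ T₁ x)) atTop (𝓝 0) := by
    refine tendsto_const_nhds.congr' ?_
    filter_upwards [eventually_gt_atTop 0] with T hT
    unfold timeAverage
    rw [intervalIntegral.integral_congr_ae (g := fun _ => 0)]
    · simp
    · refine Eventually.of_forall fun t ht => ?_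
      rw [Set.uIoc_of_le hT.le] at ht
      have := hφ (T₁ + t) (by linarith [ht.1])
      simp only [flow_flow, this, Complex.ofReal_zero]
  have h0 := tendsto_nhds_unique hlim hz
  rw [spaceAverage, integral_complex_ofReal] at h0
  have : (π : ℂ) ≠ 0 := by exact_mod_cast Real.pi_ne_zero
  simp [this, hpos.ne'] at h0

theorem exists_flow_mem_neg (hind : LinearIndependent ℚ ℓ) {U : Set (Torus n)} (hU : IsOpen U)
    (hne : U.Nonempty) (x : Torus n) (T₀ : ℝ) : ∃ t < T₀, flow ℓ t x ∈ U := by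
  obtain ⟨t, ht, htU⟩ := exists_flow_mem (ℓ := -ℓ) hind.neg hU hne x (-T₀)
  exact ⟨-t, by linarith, by rwa [flow_neg_direction] at htU⟩

end

section

/-! ### Cross-sections of the flow -/

variable {n : ℕ} {ℓ : Fin n → ℝ} {S : Set (Torus n)}

/-- A closed set which every orbit meets at arbitrarily late and arbitrarily early times, and at a
bounded number of times in each time interval of length one. -/
structure IsCrossSection (ℓ : Fin n → ℝ) (S : Set (Torus n)) : Prop where
  isClosed : IsClosed S
  exists_gt : ∀ (x : Torus n) (a : ℝ), ∃ t > a, flow ℓ t x ∈ S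
  exists_lt : ∀ (x : Torus n) (a : ℝ), ∃ t < a, flow ℓ t x ∈ S
  bound : ∃ K : ℕ, ∀ x : Torus n, {t | t ∈ Set.Ioc (0 : ℝ) 1 ∧ flow ℓ t x ∈ S}.encard ≤ K

/-- The first return time to a general set `S`; it is `returnTime` when `S` is a zero set. -/
def firstReturn (ℓ : Fin n → ℝ) (S : Set (Torus n)) (x : Torus n) : ℝ :=
  sInf {t : ℝ | 0 < t ∧ flow ℓ t x ∈ S}

/-- The first return map to a general set `S`; it is `returnMap` when `S` is a zero set. -/
def firstReturnMap (ℓ : Fin n → ℝ) (S : Set (Torus n)) (x : Torus n) : Torus n :=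
  flow ℓ (firstReturn ℓ S x) x

/-- The time of the `k`-th positive visit to `S`, with the value `0` for `k = 0`. -/
def hitTime (ℓ : Fin n → ℝ) (S : Set (Torus n)) : ℕ → Torus n → ℝ
  | 0, _ => 0
  | k + 1, x => hitTime ℓ S k x + firstReturn ℓ S (flow ℓ (hitTime ℓ S k x) x)

theorem iterate_firstReturnMap (k : ℕ) (x : Torus n) :
    (firstReturnMap ℓ S)^[k] x = flow ℓ (hitTime ℓ S k x) x := by
  induction k with
  | zero => simp [hitTime]
  | succ k ih =>
    rw [Function.iterate_succ_apply', ih, firstReturnMap, flow_flow, hitTime]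

theorem isClosed_exists_Icc (hS : IsClosed S) (a b : ℝ) :
    IsClosed {x | ∃ t ∈ Set.Icc a b, flow ℓ t x ∈ S} := by
  have h : {x | ∃ t ∈ Set.Icc a b, flow ℓ t x ∈ S} =
      Prod.snd '' ((Set.Icc a b ×ˢ Set.univ) ∩ (fun z : ℝ × Torus n => flow ℓ z.1 z.2) ⁻¹' S) := by
    ext x
    constructor
    · rintro ⟨t, ht, hx⟩; exact ⟨(t, x), ⟨⟨ht, trivial⟩, hx⟩, rfl⟩
    · rintro ⟨⟨t, y⟩, ⟨⟨ht, -⟩, hx⟩, rfl⟩; exact ⟨t, ht, hx⟩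
  rw [h]
  exact (((isCompact_Icc.prod isCompact_univ).inter_right
    (hS.preimage continuous_flow)).image continuous_snd).isClosed

theorem measurable_firstReturn (hS : IsCrossSection ℓ S) : Measurable (firstReturn ℓ S) := by
  refine measurable_of_Iio fun a => ?_
  have h : firstReturn ℓ S ⁻¹' Set.Iio a = ⋃ m : ℕ, {x | ∃ t ∈ Set.Icc (1 / ((m : ℝ) + 1))
      (a - 1 / ((m : ℝ) + 1)), flow ℓ t x ∈ S} := by
    ext x
    obtain ⟨t₀, ht₀⟩ := hS.exists_gt x 0
    simp only [Set.mem_preimage, Set.mem_Iio, firstReturn, Set.mem_iUnion, Set.mem_ofPred_eq]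
    rw [csInf_lt_iff ⟨0, fun t ht => ht.1.le⟩ ⟨t₀, ht₀⟩]
    constructor
    · rintro ⟨t, ⟨h0, hx⟩, hta⟩
      obtain ⟨m, hm⟩ := exists_nat_one_div_lt (lt_min h0 (sub_pos.2 hta))
      refine ⟨m, t, ⟨(hm.trans_le (min_le_left _ _)).le, ?_⟩, hx⟩
      have := hm.trans_le (min_le_right _ _)
      linarith
    · rintro ⟨m, t, ⟨h1, h2⟩, hx⟩
      have : 0 < 1 / ((m : ℝ) + 1) := by positivity
      exact ⟨t, ⟨by linarith, hx⟩, by linarith⟩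
  rw [h]
  exact MeasurableSet.iUnion fun m => (isClosed_exists_Icc hS.isClosed _ _).measurableSet

theorem measurable_flow_comp {α : Type*} [MeasurableSpace α] {f : α → ℝ} {g : α → Torus n}
    (hf : Measurable f) (hg : Measurable g) : Measurable fun x => flow ℓ (f x) (g x) :=
  continuous_flow.measurable.comp (hf.prodMk hg)

theorem measurable_hitTime (hS : IsCrossSection ℓ S) (k : ℕ) : Measurable (hitTime ℓ S k) := by
  induction k with
  | zero => exact measurable_const
  | succ k ih =>
    exact ih.add ((measurable_firstReturn hS).comp (measurable_flow_comp ih measurable_id))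

theorem measurable_iterate_firstReturnMap (hS : IsCrossSection ℓ S) (k : ℕ) :
    Measurable (firstReturnMap ℓ S)^[k] :=
  (measurable_flow_comp (measurable_firstReturn hS) measurable_id).iterate k

namespace IsCrossSection

variable (hS : IsCrossSection ℓ S)
include hS

theorem finite_hits (x : Torus n) (a b : ℝ) :
    {t | t ∈ Set.Ioc a b ∧ flow ℓ t x ∈ S}.Finite := by
  obtain ⟨K, hK⟩ := hS.bound
  have h1 : ∀ c : ℝ, {t | t ∈ Set.Ioc c (c + 1) ∧ flow ℓ t x ∈ S}.Finite := by
    intro c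
    have hfin : {t | t ∈ Set.Ioc (0 : ℝ) 1 ∧ flow ℓ t (flow ℓ c x) ∈ S}.Finite :=
      Set.finite_of_encard_le_coe (hK _)
    refine (hfin.image (fun t => c + t)).subset ?_
    rintro t ⟨⟨h1, h2⟩, ht⟩
    refine ⟨t - c, ⟨⟨by linarith, by linarith⟩, ?_⟩, by ring⟩
    rw [flow_flow]; simpa using ht
  -- a bounded interval is covered by finitely many of length one
  have h2 : ∀ N : ℕ, {t | t ∈ Set.Ioc a (a + N) ∧ flow ℓ t x ∈ S}.Finite := by
    intro N
    induction N with
    | zero => simp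
    | succ N ih =>
      refine (ih.union (h1 (a + N))).subset ?_
      rintro t ⟨⟨h3, h4⟩, ht⟩
      rcases le_or_gt t (a + N) with h | h
      · exact Or.inl ⟨⟨h3, h⟩, ht⟩
      · exact Or.inr ⟨⟨h, by push_cast at h4; linarith⟩, ht⟩
  obtain ⟨N, hN⟩ := exists_nat_ge (b - a)
  refine (h2 N).subset ?_
  rintro t ⟨⟨h3, h4⟩, ht⟩
  exact ⟨⟨h3, by linarith⟩, ht⟩

theorem isLeast_firstReturn (x : Torus n) :
    IsLeast {t : ℝ | 0 < t ∧ flow ℓ t x ∈ S} (firstReturn ℓ S x) := by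
  obtain ⟨t₀, ht₀, hx₀⟩ := hS.exists_gt x 0
  obtain ⟨t₁, ⟨⟨h1, h2⟩, h3⟩, hmin⟩ := (hS.finite_hits x 0 t₀).exists_minimal
    ⟨t₀, ⟨ht₀, le_rfl⟩, hx₀⟩
  have hl : IsLeast {t : ℝ | 0 < t ∧ flow ℓ t x ∈ S} t₁ := by
    refine ⟨⟨h1, h3⟩, fun t ht => ?_⟩
    by_contra! hlt
    exact absurd (hmin ⟨⟨ht.1, hlt.le.trans h2⟩, ht.2⟩ hlt.le) (not_le.2 hlt)
  rw [firstReturn, hl.csInf_eq]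
  exact hl

theorem hitTime_lt_succ (k : ℕ) (x : Torus n) : hitTime ℓ S k x < hitTime ℓ S (k + 1) x := by
  have := (hS.isLeast_firstReturn (flow ℓ (hitTime ℓ S k x) x)).1.1
  simp only [hitTime]; linarith

theorem strictMono_hitTime (x : Torus n) : StrictMono fun k => hitTime ℓ S k x :=
  strictMono_nat_of_lt_succ fun k => hS.hitTime_lt_succ k x

theorem hitTime_succ_pos (k : ℕ) (x : Torus n) : 0 < hitTime ℓ S (k + 1) x :=
  hS.strictMono_hitTime x (Nat.succ_pos k)

theorem flow_hitTime_mem (k : ℕ) (x : Torus n) : flow ℓ (hitTime ℓ S (k + 1) x) x ∈ S := by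
  have := (hS.isLeast_firstReturn (flow ℓ (hitTime ℓ S k x) x)).1.2
  rwa [flow_flow] at this

theorem tendsto_hitTime (x : Torus n) : Tendsto (fun k => hitTime ℓ S k x) atTop atTop := by
  refine tendsto_atTop_atTop_of_monotone (hS.strictMono_hitTime x).monotone fun b => ?_
  by_contra! hcon
  have hinj : Function.Injective fun k => hitTime ℓ S (k + 1) x :=
    (hS.strictMono_hitTime x).injective.comp (add_left_injective 1)
  refine Set.infinite_range_of_injective hinj ((hS.finite_hits x 0 b).subset ?_)
  rintro _ ⟨k, rfl⟩
  exact ⟨⟨hS.hitTime_succ_pos k x, (hcon _).le⟩, hS.flow_hitTime_mem k x⟩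

theorem exists_eq_hitTime {x : Torus n} {t : ℝ} (h0 : 0 < t) (ht : flow ℓ t x ∈ S) :
    ∃ k, hitTime ℓ S (k + 1) x = t := by
  classical
  have hex : ∃ k, t ≤ hitTime ℓ S (k + 1) x := by
    obtain ⟨k, hk⟩ := ((hS.tendsto_hitTime x).eventually_ge_atTop t).exists
    exact ⟨k, hk.trans (hS.hitTime_lt_succ k x).le⟩
  refine ⟨Nat.find hex, le_antisymm ?_ (Nat.find_spec hex)⟩
  have hlt : hitTime ℓ S (Nat.find hex) x < t := by
    rcases hk : Nat.find hex with _ | k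
    · simpa [hitTime] using h0
    · exact not_le.1 (Nat.find_min hex (by omega : k < Nat.find hex))
  have hmem : t - hitTime ℓ S (Nat.find hex) x ∈
      {u : ℝ | 0 < u ∧ flow ℓ u (flow ℓ (hitTime ℓ S (Nat.find hex) x) x) ∈ S} :=
    ⟨by linarith, by rw [flow_flow]; simpa using ht⟩
  have := (hS.isLeast_firstReturn (flow ℓ (hitTime ℓ S (Nat.find hex) x) x)).2 hmem
  change hitTime ℓ S (Nat.find hex) x +
    firstReturn ℓ S (flow ℓ (hitTime ℓ S (Nat.find hex) x) x) ≤ t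
  linarith

end IsCrossSection

/-! ### Sums over the visits -/

/-- The sum of `g (y + tℓ, t)` over all times `t ∈ ℝ` at which `y + tℓ` lies in `S`. -/
def hitSum (ℓ : Fin n → ℝ) (S : Set (Torus n)) (g : Torus n × ℝ → ENNReal) (y : Torus n) :
    ENNReal :=
  ∑' t : ℝ, {t | flow ℓ t y ∈ S}.indicator (fun t => g (flow ℓ t y, t)) t

theorem hitSum_flow (g : Torus n × ℝ → ENNReal) (s : ℝ) (y : Torus n) :
    hitSum ℓ S g (flow ℓ s y) = hitSum ℓ S (fun z => g (z.1, z.2 - s)) y := by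
  unfold hitSum
  rw [← (Equiv.addLeft s).tsum_eq (fun t => {t | flow ℓ t y ∈ S}.indicator
    (fun t => g (flow ℓ t y, t - s)) t)]
  refine tsum_congr fun t => ?_
  have h : flow ℓ t (flow ℓ s y) = flow ℓ (s + t) y := flow_flow _ _ _
  by_cases ht : flow ℓ (s + t) y ∈ S <;> simp [Set.indicator, h, ht]

theorem hitSum_add (g h : Torus n × ℝ → ENNReal) (y : Torus n) :
    hitSum ℓ S (g + h) y = hitSum ℓ S g y + hitSum ℓ S h y := by
  unfold hitSum
  rw [← ENNReal.tsum_add]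
  refine tsum_congr fun t => ?_
  by_cases ht : flow ℓ t y ∈ S <;> simp [Set.indicator, ht]

theorem hitSum_mono {g h : Torus n × ℝ → ENNReal} {y : Torus n}
    (hgh : ∀ t, flow ℓ t y ∈ S → g (flow ℓ t y, t) ≤ h (flow ℓ t y, t)) :
    hitSum ℓ S g y ≤ hitSum ℓ S h y := by
  refine ENNReal.tsum_le_tsum fun t => ?_
  by_cases ht : flow ℓ t y ∈ S
  · simpa [Set.indicator, ht] using hgh t ht
  · simp [Set.indicator, ht]

theorem hitSum_eq_tsum (hS : IsCrossSection ℓ S) {g : Torus n × ℝ → ENNReal}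
    (hg : ∀ z, z.2 ≤ 0 → g z = 0) (y : Torus n) :
    hitSum ℓ S g y = ∑' k : ℕ, g ((firstReturnMap ℓ S)^[k + 1] y, hitTime ℓ S (k + 1) y) := by
  have hinj : Function.Injective fun k => hitTime ℓ S (k + 1) y :=
    (hS.strictMono_hitTime y).injective.comp (add_left_injective 1)
  unfold hitSum
  rw [← hinj.tsum_eq]
  · refine tsum_congr fun k => ?_
    simp only [iterate_firstReturnMap]
    rw [Set.indicator_of_mem (s := {t | flow ℓ t y ∈ S}) (hS.flow_hitTime_mem k y)]
  · intro t ht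
    rw [Function.mem_support, Set.indicator_apply_ne_zero] at ht
    have h0 : 0 < t := by
      by_contra! h
      exact ht.2 (hg _ h)
    exact hS.exists_eq_hitTime h0 ht.1

theorem measurable_hitSum (hS : IsCrossSection ℓ S) {g : Torus n × ℝ → ENNReal} (hg : Measurable g)
    {c : ℝ} (hc : ∀ z, z.2 ≤ c → g z = 0) : Measurable (hitSum ℓ S g) := by
  have h1 : Measurable (hitSum ℓ S (fun z => g (z.1, z.2 + c))) := by
    have : hitSum ℓ S (fun z => g (z.1, z.2 + c)) = fun y => ∑' k : ℕ,
        g ((firstReturnMap ℓ S)^[k + 1] y, hitTime ℓ S (k + 1) y + c) := by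
      funext y
      rw [hitSum_eq_tsum hS]
      intro z hz
      exact hc _ (by simpa using hz)
    rw [this]
    refine Measurable.tsum fun k => hg.comp ?_
    exact (measurable_iterate_firstReturnMap hS _).prodMk
      ((measurable_hitTime hS _).add measurable_const)
  have h2 : hitSum ℓ S g = fun y => hitSum ℓ S (fun z => g (z.1, z.2 + c)) (flow ℓ c y) := by
    funext y
    rw [hitSum_flow]
    simp
  rw [h2]
  exact h1.comp (continuous_flow_right c).measurable

/-- The integral over `y` of a sum over visits is invariant under time shifts. -/
theorem lintegral_hitSum_shift (hS : IsCrossSection ℓ S) {g : Torus n × ℝ → ENNReal}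
    (hg : Measurable g) {c : ℝ} (hc : ∀ z, z.2 ≤ c → g z = 0) (s : ℝ) :
    ∫⁻ y, hitSum ℓ S (fun z => g (z.1, z.2 - s)) y = ∫⁻ y, hitSum ℓ S g y := by
  rw [← lintegral_flow (ℓ := ℓ) s (f := hitSum ℓ S g) (measurable_hitSum hS hg hc)]
  exact lintegral_congr fun y => (hitSum_flow g s y).symm

/-- The measure on a cross-section `S` that counts the visits during unit time:
`A ↦ ∫ #{t ∈ (0, 1] : y + tℓ ∈ A ∩ S} dy`. -/
def crossMeasure (ℓ : Fin n → ℝ) (S : Set (Torus n)) : Measure (Torus n) :=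
  Measure.sum fun k : ℕ =>
    (volume.restrict {y | hitTime ℓ S (k + 1) y ≤ 1}).map (firstReturnMap ℓ S)^[k + 1]

theorem lintegral_crossMeasure (hS : IsCrossSection ℓ S) {g : Torus n → ENNReal}
    (hg : Measurable g) :
    ∫⁻ x, g x ∂(crossMeasure ℓ S) =
      ∫⁻ y, hitSum ℓ S (fun z => (Set.Ioc (0 : ℝ) 1).indicator (fun _ => g z.1) z.2) y := by
  have h1 : ∀ y, hitSum ℓ S (fun z => (Set.Ioc (0 : ℝ) 1).indicator (fun _ => g z.1) z.2) y =
      ∑' k : ℕ, {y | hitTime ℓ S (k + 1) y ≤ 1}.indicator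
        (fun y => g ((firstReturnMap ℓ S)^[k + 1] y)) y := by
    intro y
    rw [hitSum_eq_tsum hS]
    · refine tsum_congr fun k => ?_
      simp [Set.indicator, hS.hitTime_succ_pos k y]
    · rintro ⟨x, t⟩ ht
      exact Set.indicator_of_notMem (fun h => absurd h.1 (not_lt.2 ht)) _
  simp only [h1]
  have hm : ∀ k, MeasurableSet {y | hitTime ℓ S (k + 1) y ≤ 1} := fun k =>
    measurable_hitTime hS _ measurableSet_Iic
  rw [lintegral_tsum (f := fun k y => {y | hitTime ℓ S (k + 1) y ≤ 1}.indicator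
    (fun y => g ((firstReturnMap ℓ S)^[k + 1] y)) y) fun k =>
      ((hg.comp (measurable_iterate_firstReturnMap hS _)).indicator (hm k)).aemeasurable,
      crossMeasure, lintegral_sum_measure]
  refine tsum_congr fun k => ?_
  rw [lintegral_map hg (measurable_iterate_firstReturnMap hS _), lintegral_indicator (hm k)]

/-- The indicator of a product set, the summand that counts visits to `A` during `I`. -/
def boxIndicator (A : Set (Torus n)) (I : Set ℝ) : Torus n × ℝ → ENNReal :=
  (A ×ˢ I).indicator 1

theorem measurable_boxIndicator {A : Set (Torus n)} {I : Set ℝ} (hA : MeasurableSet A)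
    (hI : MeasurableSet I) : Measurable (boxIndicator A I) :=
  measurable_one.indicator (hA.prod hI)

theorem boxIndicator_Ioc_of_le {A : Set (Torus n)} {a b : ℝ} (z : Torus n × ℝ) (hz : z.2 ≤ a) :
    boxIndicator A (Set.Ioc a b) z = 0 :=
  Set.indicator_of_notMem (fun h => absurd h.2.1 (not_lt.2 hz)) _

theorem crossMeasure_apply (hS : IsCrossSection ℓ S) {A : Set (Torus n)} (hA : MeasurableSet A) :
    crossMeasure ℓ S A = ∫⁻ y, hitSum ℓ S (boxIndicator A (Set.Ioc 0 1)) y := by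
  rw [← lintegral_indicator_one hA, lintegral_crossMeasure hS (measurable_one.indicator hA)]
  congr! 3 with y
  funext z
  by_cases h1 : z.1 ∈ A <;> by_cases h2 : z.2 ∈ Set.Ioc (0 : ℝ) 1 <;>
    simp [boxIndicator, Set.indicator, h1, h2, Set.mem_prod]

theorem tsum_indicator_one_eq_encard (Z : Set ℝ) :
    ∑' t : ℝ, Z.indicator (1 : ℝ → ENNReal) t = (Z.encard : ENNReal) := by
  rw [← tsum_subtype Z (1 : ℝ → ENNReal)]
  exact ENNReal.tsum_set_one Z

theorem exists_hitSum_le (hS : IsCrossSection ℓ S) : ∃ K : ℕ, ∀ (A : Set (Torus n)) (y : Torus n),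
    hitSum ℓ S (boxIndicator A (Set.Ioc 0 1)) y ≤ K := by
  obtain ⟨K, hK⟩ := hS.bound
  refine ⟨K, fun A y => ?_⟩
  calc hitSum ℓ S (boxIndicator A (Set.Ioc 0 1)) y
      ≤ ∑' t : ℝ, {t | t ∈ Set.Ioc (0 : ℝ) 1 ∧ flow ℓ t y ∈ S}.indicator (1 : ℝ → ENNReal) t := by
        refine ENNReal.tsum_le_tsum fun t => ?_
        by_cases h1 : flow ℓ t y ∈ S <;> by_cases h2 : 0 < t <;> by_cases h3 : t ≤ 1 <;>
        by_cases h4 : flow ℓ t y ∈ A <;> simp [boxIndicator, Set.indicator, h1, h2, h3, h4]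
    _ = _ := tsum_indicator_one_eq_encard _
    _ ≤ K := by exact_mod_cast hK y

theorem isFiniteMeasure_crossMeasure (hS : IsCrossSection ℓ S) :
    IsFiniteMeasure (crossMeasure ℓ S) := by
  obtain ⟨K, hK⟩ := exists_hitSum_le hS
  refine ⟨?_⟩
  rw [crossMeasure_apply hS MeasurableSet.univ]
  calc _ ≤ ∫⁻ _ : Torus n, (K : ENNReal) := lintegral_mono fun y => hK _ y
    _ < ⊤ := by
      rw [lintegral_const]
      exact ENNReal.mul_lt_top (by simp) (measure_lt_top _ _)

/-- An additive function on the nonnegative reals with nonnegative values is linear. -/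
theorem eq_ofReal_mul_of_additive {f : ℝ → ENNReal} (h1 : f 1 ≠ ⊤)
    (hadd : ∀ r s, 0 ≤ r → 0 ≤ s → f (r + s) = f r + f s) {r : ℝ} (hr : 0 ≤ r) :
    f r = ENNReal.ofReal r * f 1 := by
  have hmono : ∀ a b, 0 ≤ a → a ≤ b → f a ≤ f b := by
    intro a b ha hab
    have := hadd a (b - a) ha (by linarith)
    rw [add_sub_cancel] at this
    rw [this]; exact le_self_add
  have h0 : f 0 = 0 := by
    have h := hadd 0 1 le_rfl zero_le_one
    rw [zero_add] at h
    have := ENNReal.add_right_inj (b := f 0) (c := 0) h1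
    rw [add_comm, ← h, add_zero] at this
    exact this.1 rfl
  have hmul : ∀ (N : ℕ) (s : ℝ), 0 ≤ s → f (N * s) = N * f s := by
    intro N s hs
    induction N with
    | zero => simp [h0]
    | succ N ih =>
      push_cast
      rw [add_mul, add_mul, hadd _ _ (by positivity) (by linarith), ih, one_mul, one_mul]
  have hnat : ∀ k : ℕ, f k = k * f 1 := fun k => by simpa using hmul k 1 zero_le_one
  have hfin : ∀ s, 0 ≤ s → f s ≠ ⊤ := by
    intro s hs
    obtain ⟨k, hk⟩ := exists_nat_ge s
    refine ne_top_of_le_ne_top ?_ (hmono s k hs hk)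
    rw [hnat]
    exact ENNReal.mul_ne_top (by simp) h1
  rw [← ENNReal.toReal_eq_toReal_iff' (hfin r hr) (ENNReal.mul_ne_top (by simp) h1),
    ENNReal.toReal_mul, ENNReal.toReal_ofReal hr]
  -- comparing `f (N r) = N f r` with `f` at the integers next to `N r`
  have key : ∀ N : ℕ, |(N : ℝ) * ((f r).toReal - r * (f 1).toReal)| ≤ (f 1).toReal := by
    intro N
    have e1 := hmul N r hr
    have hk1 : (⌊(N : ℝ) * r⌋₊ : ℝ) ≤ N * r := Nat.floor_le (by positivity)
    have hk2 : (N : ℝ) * r < ⌊(N : ℝ) * r⌋₊ + 1 := Nat.lt_floor_add_one _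
    set k := ⌊(N : ℝ) * r⌋₊
    have e2 := hmono _ _ (by positivity) hk1
    have e3 := hmono ((N : ℝ) * r) ((k + 1 : ℕ) : ℝ) (by positivity) (by push_cast; exact hk2.le)
    rw [hnat, e1] at e2
    rw [hnat, e1] at e3
    have e2' := ENNReal.toReal_mono (ENNReal.mul_ne_top (by simp) (hfin r hr)) e2
    have e3' := ENNReal.toReal_mono (ENNReal.mul_ne_top (by simp) h1) e3
    simp only [ENNReal.toReal_mul, ENNReal.toReal_natCast] at e2' e3'
    push_cast at e3'
    have hp : 0 ≤ (f 1).toReal := ENNReal.toReal_nonneg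
    rw [abs_le]
    constructor <;> nlinarith
  by_contra hne
  have hpos : 0 < |(f r).toReal - r * (f 1).toReal| := abs_pos.2 (sub_ne_zero.2 hne)
  obtain ⟨N, hN⟩ := exists_nat_gt ((f 1).toReal / |(f r).toReal - r * (f 1).toReal|)
  have := key N
  rw [abs_mul, Nat.abs_cast] at this
  rw [div_lt_iff₀ hpos] at hN
  linarith

/-- Visits to `A` during a time interval have mean number `(b - a) m(A)`. -/
theorem lintegral_hitSum_Ioc (hS : IsCrossSection ℓ S) {A : Set (Torus n)} (hA : MeasurableSet A)
    {a b : ℝ} (hab : a ≤ b) :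
    ∫⁻ y, hitSum ℓ S (boxIndicator A (Set.Ioc a b)) y =
      ENNReal.ofReal (b - a) * crossMeasure ℓ S A := by
  have hshift : ∀ r s : ℝ, ∫⁻ y, hitSum ℓ S (boxIndicator A (Set.Ioc s (s + r))) y =
      ∫⁻ y, hitSum ℓ S (boxIndicator A (Set.Ioc 0 r)) y := by
    intro r s
    rw [← lintegral_hitSum_shift hS (g := boxIndicator A (Set.Ioc 0 r))
        (measurable_boxIndicator hA measurableSet_Ioc)
      boxIndicator_Ioc_of_le s]
    congr! 3 with y
    funext z
    have : z.2 ∈ Set.Ioc s (s + r) ↔ z.2 - s ∈ Set.Ioc 0 r := by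
      simp only [Set.mem_Ioc, sub_pos, sub_le_iff_le_add']
    have hz : z ∈ A ×ˢ Set.Ioc s (s + r) ↔ (z.1, z.2 - s) ∈ A ×ˢ Set.Ioc 0 r :=
      and_congr Iff.rfl this
    unfold boxIndicator
    by_cases h : z ∈ A ×ˢ Set.Ioc s (s + r)
    · rw [Set.indicator_of_mem h, Set.indicator_of_mem (hz.1 h)]; rfl
    · rw [Set.indicator_of_notMem h, Set.indicator_of_notMem (mt hz.2 h)]
  have hfin := isFiniteMeasure_crossMeasure hS
  have := eq_ofReal_mul_of_additive
    (f := fun r => ∫⁻ y, hitSum ℓ S (boxIndicator A (Set.Ioc 0 r)) y) ?_ ?_ (sub_nonneg.2 hab)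
  · rw [← crossMeasure_apply hS hA] at this
    rw [← this, ← hshift (b - a) a, add_sub_cancel]
  · rw [← crossMeasure_apply hS hA]; exact measure_ne_top _ _
  · intro r s hr hs
    rw [← hshift s r, ← lintegral_add_left (measurable_hitSum hS
      (measurable_boxIndicator hA measurableSet_Ioc) boxIndicator_Ioc_of_le)]
    refine lintegral_congr fun y => ?_
    rw [← hitSum_add]
    congr 1
    have hdisj : Disjoint (A ×ˢ Set.Ioc 0 r) (A ×ˢ Set.Ioc r (r + s)) :=
      Set.disjoint_prod.2 (Or.inr (Set.Ioc_disjoint_Ioc_of_le le_rfl))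
    have h := Set.indicator_union_of_disjoint hdisj (1 : Torus n × ℝ → ENNReal)
    rw [← Set.prod_union, Set.Ioc_union_Ioc_eq_Ioc hr (by linarith)] at h
    exact h

/-- **Campbell's formula** for the visits to a cross-section at positive times. -/
theorem lintegral_hitSum_eq (hS : IsCrossSection ℓ S) {g : Torus n × ℝ → ENNReal}
    (hg : Measurable g) (hg0 : ∀ z, z.2 ≤ 0 → g z = 0) :
    ∫⁻ y, hitSum ℓ S g y = ∫⁻ x, ∫⁻ t, g (x, t) ∂(volume : Measure ℝ) ∂(crossMeasure ℓ S) := by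
  have hfin := isFiniteMeasure_crossMeasure hS
  -- the distribution `lam` of all pairs (place, time) of positive visits is a product measure
  set e : ℕ → Torus n → Torus n × ℝ := fun k y =>
    ((firstReturnMap ℓ S)^[k + 1] y, hitTime ℓ S (k + 1) y) with he
  have hem : ∀ k, Measurable (e k) := fun k =>
    (measurable_iterate_firstReturnMap hS _).prodMk (measurable_hitTime hS _)
  set lam : Measure (Torus n × ℝ) := Measure.sum fun k : ℕ => volume.map (e k) with hlam
  have hint : ∀ f : Torus n × ℝ → ENNReal, Measurable f → (∀ z, z.2 ≤ 0 → f z = 0) →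
      ∫⁻ y, hitSum ℓ S f y = ∫⁻ z, f z ∂lam := by
    intro f hf hf0
    rw [hlam, lintegral_sum_measure]
    simp only [hitSum_eq_tsum hS hf0]
    rw [lintegral_tsum (f := fun k y => f (e k y)) fun k => (hf.comp (hem k)).aemeasurable]
    refine tsum_congr fun k => ?_
    rw [lintegral_map hf (hem k)]
  have hpos : ∀ A : Set (Torus n), MeasurableSet A → lam (A ×ˢ Set.Iic 0) = 0 := by
    intro A hA
    rw [hlam, Measure.sum_apply _ (hA.prod measurableSet_Iic), ENNReal.tsum_eq_zero]
    intro k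
    rw [Measure.map_apply (hem k) (hA.prod measurableSet_Iic)]
    have : e k ⁻¹' A ×ˢ Set.Iic 0 = ∅ := by
      ext y
      simp [he, hS.hitTime_succ_pos k y]
    rw [this, measure_empty]
  have hprod : (crossMeasure ℓ S).prod (volume.restrict (Set.Ioi (0 : ℝ))) = lam := by
    refine Measure.prod_eq fun A I hA hI => ?_
    -- for fixed `A`, both sides agree on intervals, by the mean number of visits
    have hAI : (lam.restrict (A ×ˢ Set.univ)).map Prod.snd
        = crossMeasure ℓ S A • volume.restrict (Set.Ioi (0 : ℝ)) := by
      have hval : ∀ a b : ℝ, a < b → ((lam.restrict (A ×ˢ Set.univ)).map Prod.snd) (Set.Ioc a b)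
          = crossMeasure ℓ S A * volume.restrict (Set.Ioi (0 : ℝ)) (Set.Ioc a b) := by
        intro a b hab
        rw [Measure.map_apply measurable_snd measurableSet_Ioc,
          Measure.restrict_apply (measurable_snd measurableSet_Ioc),
          Measure.restrict_apply measurableSet_Ioc, Set.Ioc_inter_Ioi, Real.volume_Ioc]
        have e1 : Prod.snd ⁻¹' Set.Ioc a b ∩ A ×ˢ Set.univ = A ×ˢ Set.Ioc a b := by
          ext z; simp [and_comm]
        have e2 : lam (A ×ˢ Set.Ioc a b) = lam (A ×ˢ Set.Ioc (max a 0) b) := by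
          refine le_antisymm ?_ (measure_mono (Set.prod_mono le_rfl
            (Set.Ioc_subset_Ioc_left (le_max_left _ _))))
          have : A ×ˢ Set.Ioc a b ⊆ A ×ˢ Set.Ioc (max a 0) b ∪ A ×ˢ Set.Iic 0 := by
            rintro ⟨x, t⟩ ⟨hx, h1, h2⟩
            rcases le_or_gt t 0 with h | h
            · exact Or.inr ⟨hx, h⟩
            · exact Or.inl ⟨hx, max_lt h1 h, h2⟩
          refine (measure_mono this).trans ((measure_union_le _ _).trans ?_)
          rw [hpos A hA, add_zero]
        rw [e1, e2]
        rcases le_or_gt (max a 0) b with hle | hlt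
        · rw [mul_comm (crossMeasure ℓ S A), ← lintegral_hitSum_Ioc hS hA hle, hint _
            (measurable_boxIndicator hA measurableSet_Ioc)
            (fun z hz => boxIndicator_Ioc_of_le z (hz.trans (le_max_right _ _))), boxIndicator,
            lintegral_indicator_one (hA.prod measurableSet_Ioc)]
        · rw [Set.Ioc_eq_empty (not_lt.2 hlt.le), Set.prod_empty, measure_empty,
            ENNReal.ofReal_of_nonpos (by linarith), mul_zero]
      refine Measure.ext_of_Ioc' _ _ ?_ ?_
      · intro a b hab
        rw [hval a b hab, Measure.restrict_apply measurableSet_Ioc, Set.Ioc_inter_Ioi,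
          Real.volume_Ioc]
        exact ENNReal.mul_ne_top (measure_ne_top _ _) (by simp)
      · intro a b hab
        rw [hval a b hab, Measure.smul_apply, smul_eq_mul]
    have h2 := congrArg (fun μ : Measure ℝ => μ I) hAI
    simp only [Measure.smul_apply, smul_eq_mul] at h2
    rw [← h2, Measure.map_apply measurable_snd hI, Measure.restrict_apply (measurable_snd hI)]
    congr 1
    ext z; simp [and_comm]
  rw [hint g hg hg0, ← hprod, lintegral_prod _ hg.aemeasurable]
  refine lintegral_congr fun x => ?_
  rw [← lintegral_indicator measurableSet_Ioi]
  refine lintegral_congr fun t => ?_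
  by_cases ht : 0 < t
  · simp [ht]
  · simp [ht, hg0 (x, t) (not_lt.1 ht)]

end

section

/-! ### The cross-section measure as a limit of volumes -/

variable {n : ℕ} {ℓ : Fin n → ℝ} {S : Set (Torus n)}

theorem volume_crossSection_eq_zero (hS : IsCrossSection ℓ S) : volume S = 0 := by
  have hm : MeasurableSet S := hS.isClosed.measurableSet
  have h1 : ∫⁻ t in Set.Ioc (0 : ℝ) 1, ∫⁻ y : Torus n,
      S.indicator (1 : Torus n → ENNReal) (flow ℓ t y)
      = volume S := by
    have : ∀ t : ℝ, ∫⁻ y : Torus n, S.indicator (1 : Torus n → ENNReal) (flow ℓ t y) =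
        volume S := by
      intro t
      rw [lintegral_flow t (measurable_one.indicator hm), lintegral_indicator_one hm]
    simp [this]
  rw [← h1, lintegral_lintegral_swap]
  · rw [lintegral_eq_zero_of_ae_eq_zero]
    refine Eventually.of_forall fun y => ?_
    have hfin := hS.finite_hits y 0 1
    refine lintegral_eq_zero_of_ae_eq_zero ?_
    rw [EventuallyEq, ae_restrict_iff' measurableSet_Ioc]
    have h0 : volume {t | t ∈ Set.Ioc (0 : ℝ) 1 ∧ flow ℓ t y ∈ S} = 0 := hfin.measure_zero _
    filter_upwards [measure_eq_zero_iff_ae_notMem.1 h0] with t ht htI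
    exact Set.indicator_of_notMem (fun h => ht ⟨htI, h⟩) _
  · exact ((measurable_one.indicator hm).comp continuous_flow.measurable).aemeasurable

theorem crossMeasure_compl (hS : IsCrossSection ℓ S) : crossMeasure ℓ S Sᶜ = 0 := by
  rw [crossMeasure_apply hS hS.isClosed.measurableSet.compl]
  refine lintegral_eq_zero_of_ae_eq_zero (Eventually.of_forall fun y => ?_)
  simp only [hitSum, Pi.zero_apply, ENNReal.tsum_eq_zero]
  intro t
  by_cases ht : flow ℓ t y ∈ S <;> simp [boxIndicator, ht]

/-- Almost no orbit segment meets a closed null set of the cross-section. -/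
theorem volume_exists_flow_mem_eq_zero (hS : IsCrossSection ℓ S) {A : Set (Torus n)}
    (hAc : IsClosed A) (hAS : A ⊆ S) (h : crossMeasure ℓ S A = 0) :
    volume {y | ∃ t ∈ Set.Icc (0 : ℝ) 1, flow ℓ t y ∈ A} = 0 := by
  have hA := hAc.measurableSet
  rw [crossMeasure_apply hS hA, lintegral_eq_zero_iff (measurable_hitSum hS
    (measurable_boxIndicator hA measurableSet_Ioc) boxIndicator_Ioc_of_le)] at h
  have h2 := measure_mono_null hAS (volume_crossSection_eq_zero hS)
  rw [measure_eq_zero_iff_ae_notMem] at h2 ⊢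
  filter_upwards [h, h2] with y hy hy2
  rintro ⟨t, ht, htA⟩
  rcases ht.1.eq_or_lt with h0 | h0
  · rw [← h0, flow_zero] at htA; exact hy2 htA
  · simp only [hitSum, Pi.zero_apply, ENNReal.tsum_eq_zero] at hy
    have := hy t
    rw [Set.indicator_of_mem (s := {t | flow ℓ t y ∈ S}) (hAS htA)] at this
    have hz : (flow ℓ t y, t) ∈ A ×ˢ Set.Ioc (0 : ℝ) 1 := ⟨htA, h0, ht.2⟩
    simp [boxIndicator, Set.indicator_of_mem hz] at this

/-- Visits in a window of length `2ε` are counted correctly by the thickened set, except for those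
followed by another visit within time `2ε`. -/
theorem hitSum_le_thicken (hS : IsCrossSection ℓ S) {A : Set (Torus n)} (ε : ℝ) (y : Torus n) :
    hitSum ℓ S (boxIndicator A (Set.Ioc (-ε) ε)) y ≤
      ((thicken ℓ ε A).indicator 1 y + (flow ℓ ε ⁻¹' S).indicator 1 y) +
        hitSum ℓ S (boxIndicator {x | firstReturn ℓ S x ≤ 2 * ε} (Set.Ioc (-ε) ε)) y := by
  classical
  set Z : Set ℝ := {t | t ∈ Set.Ioc (-ε) ε ∧ flow ℓ t y ∈ A ∩ S} with hZ
  have hZfin : Z.Finite := (hS.finite_hits y (-ε) ε).subset fun t ht => ⟨ht.1, ht.2.2⟩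
  have hL : hitSum ℓ S (boxIndicator A (Set.Ioc (-ε) ε)) y = ∑' t : ℝ, Z.indicator 1 t := by
    refine tsum_congr fun t => ?_
    by_cases h1 : flow ℓ t y ∈ S <;> by_cases h2 : -ε < t <;> by_cases h2' : t ≤ ε <;>
      by_cases h3 : flow ℓ t y ∈ A <;> simp [boxIndicator, Set.indicator, hZ, h1, h2, h2', h3]
  rw [hL]
  rcases Z.eq_empty_or_nonempty with he | hne
  · simp [he]
  -- the last visit is counted by the thickened set, unless it takes place at the end point `ε`;
  -- every earlier visit is followed by another one within time `2ε`
  obtain ⟨u, huZ, humax⟩ := hZfin.exists_maximal hne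
  have h1 : (1 : ENNReal) ≤ (thicken ℓ ε A).indicator 1 y + (flow ℓ ε ⁻¹' S).indicator 1 y := by
    rcases huZ.1.2.eq_or_lt with h | h
    · have : y ∈ flow ℓ ε ⁻¹' S := by rw [← h]; exact huZ.2.2
      rw [Set.indicator_of_mem this]; exact le_add_self
    · have : y ∈ thicken ℓ ε A :=
        ⟨flow ℓ u y, huZ.2.1, -u, by rw [abs_neg, abs_lt]; exact ⟨huZ.1.1, h⟩, by simp⟩
      rw [Set.indicator_of_mem this]; exact le_self_add
  calc ∑' t : ℝ, Z.indicator (1 : ℝ → ENNReal) t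
      ≤ ∑' t : ℝ, (({u} : Set ℝ).indicator (1 : ℝ → ENNReal) t + {t | flow ℓ t y ∈ S}.indicator
          (fun t => boxIndicator {x | firstReturn ℓ S x ≤ 2 * ε} (Set.Ioc (-ε) ε)
            (flow ℓ t y, t)) t) := by
        refine ENNReal.tsum_le_tsum fun t => ?_
        by_cases htZ : t ∈ Z
        · rw [Set.indicator_of_mem htZ]
          by_cases htu : t = u
          · rw [htu, Set.indicator_of_mem (Set.mem_singleton u)]; exact le_self_add
          · have hlt : t < u := lt_of_le_of_ne (by
              by_contra! h; exact absurd (humax htZ h.le) (not_le.2 h)) htu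
            have hr : firstReturn ℓ S (flow ℓ t y) ≤ 2 * ε := by
              have hmem : u - t ∈ {s : ℝ | 0 < s ∧ flow ℓ s (flow ℓ t y) ∈ S} :=
                ⟨by linarith, by rw [flow_flow]; simpa using huZ.2.2⟩
              have := (hS.isLeast_firstReturn (flow ℓ t y)).2 hmem
              linarith [huZ.1.2, htZ.1.1]
            rw [Set.indicator_of_mem (s := {t | flow ℓ t y ∈ S}) htZ.2.2]
            have hz : (flow ℓ t y, t) ∈ {x | firstReturn ℓ S x ≤ 2 * ε} ×ˢ Set.Ioc (-ε) ε :=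
              ⟨hr, htZ.1⟩
            rw [boxIndicator, Set.indicator_of_mem hz]
            exact le_add_self
        · rw [Set.indicator_of_notMem htZ]; exact zero_le
    _ = 1 + hitSum ℓ S (boxIndicator {x | firstReturn ℓ S x ≤ 2 * ε} (Set.Ioc (-ε) ε)) y := by
        rw [ENNReal.tsum_add, tsum_indicator_one_eq_encard]
        simp [hitSum]
    _ ≤ _ := by gcongr

/-- The measure of a Borel subset of a cross-section is the limit that defines the flow measure. -/
theorem tendsto_volume_thicken (hS : IsCrossSection ℓ S) {A : Set (Torus n)} (hA : MeasurableSet A)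
    (hAS : A ⊆ S) :
    Tendsto (fun ε : ℝ => volume (thicken ℓ ε A) / ENNReal.ofReal (2 * ε)) (𝓝[>] 0)
      (𝓝 (crossMeasure ℓ S A)) := by
  have hfin := isFiniteMeasure_crossMeasure hS
  -- points with a quick return; they are negligible as `ε` tends to `0`
  set B : ℝ → Set (Torus n) := fun ε => {x | firstReturn ℓ S x ≤ 2 * ε} with hB
  have hBm : ∀ ε, MeasurableSet (B ε) := fun ε => measurable_firstReturn hS measurableSet_Iic
  -- Markov: a point of the thickened set has a visit during `(-ε, ε]`
  have hup : ∀ ε, 0 < ε → volume (thicken ℓ ε A) ≤ ENNReal.ofReal (2 * ε) * crossMeasure ℓ S A := by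
    intro ε hε
    have h2 : (2 * ε) = ε - (-ε) := by ring
    rw [h2, ← lintegral_hitSum_Ioc hS hA (by linarith)]
    have hm := measurable_hitSum hS
      (measurable_boxIndicator hA (measurableSet_Ioc (a := -ε) (b := ε)))
      boxIndicator_Ioc_of_le
    refine le_trans (measure_mono (t := {y | 1 ≤ hitSum ℓ S
      (boxIndicator A (Set.Ioc (-ε) ε)) y}) ?_) ?_
    · rintro _ ⟨x, hx, t, ht, rfl⟩
      have hx' : flow ℓ (-t) (flow ℓ t x) ∈ S := by simpa using hAS hx
      refine le_trans ?_ (ENNReal.le_tsum (-t))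
      rw [Set.indicator_of_mem (s := {u | flow ℓ u (flow ℓ t x) ∈ S}) hx']
      have ht' := abs_lt.1 ht
      have hz : (flow ℓ (-t) (flow ℓ t x), -t) ∈ A ×ˢ Set.Ioc (-ε) ε :=
        ⟨by simpa using hx, by constructor <;> simp <;> linarith⟩
      rw [boxIndicator, Set.indicator_of_mem hz]
      simp
    · simpa using mul_meas_ge_le_lintegral hm 1
  have hlow : ∀ ε, 0 < ε → ENNReal.ofReal (2 * ε) * crossMeasure ℓ S A ≤
      volume (thicken ℓ ε A) + ENNReal.ofReal (2 * ε) * crossMeasure ℓ S (B ε) := by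
    intro ε hε
    have h2 : (2 * ε) = ε - (-ε) := by ring
    conv_lhs => rw [h2, ← lintegral_hitSum_Ioc hS hA (by linarith)]
    conv_rhs => rw [h2, ← lintegral_hitSum_Ioc hS (hBm ε) (by linarith)]
    refine (lintegral_mono (hitSum_le_thicken hS ε)).trans ?_
    rw [lintegral_add_right _ (measurable_hitSum hS (measurable_boxIndicator (hBm ε)
      measurableSet_Ioc) boxIndicator_Ioc_of_le)]
    gcongr
    have hpre : MeasurableSet (flow ℓ ε ⁻¹' S) :=
      (hS.isClosed.preimage (continuous_flow_right ε)).measurableSet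
    rw [lintegral_add_right _ (measurable_one.indicator hpre), lintegral_indicator_one hpre,
      (measurePreserving_flow ε).measure_preimage hS.isClosed.measurableSet.nullMeasurableSet,
      volume_crossSection_eq_zero hS, add_zero]
    exact lintegral_indicator_one_le _
  have hBlim : Tendsto (fun ε => crossMeasure ℓ S (B ε)) (𝓝[>] 0) (𝓝 0) := by
    have h := tendsto_measure_biInter_gt (μ := crossMeasure ℓ S) (s := B) (a := (0 : ℝ))
      (fun r _ => (hBm r).nullMeasurableSet)
      (fun i j _ hij x hx => le_trans (show firstReturn ℓ S x ≤ 2 * i from hx) (by linarith))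
      ⟨1, one_pos, measure_ne_top _ _⟩
    have he : (⋂ r > (0 : ℝ), B r) = ∅ := by
      ext x
      simp only [Set.mem_iInter, Set.mem_empty_iff_false, iff_false, not_forall]
      have hpos := (hS.isLeast_firstReturn x).1.1
      refine ⟨firstReturn ℓ S x / 4, by positivity, ?_⟩
      simp only [hB, Set.mem_ofPred_eq, not_le]
      linarith
    rwa [he, measure_empty] at h
  have hlim : Tendsto (fun ε => crossMeasure ℓ S A - crossMeasure ℓ S (B ε)) (𝓝[>] 0)
      (𝓝 (crossMeasure ℓ S A)) := by
    have := ENNReal.Tendsto.sub (tendsto_const_nhds (x := crossMeasure ℓ S A)) hBlim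
      (Or.inl (measure_ne_top _ _))
    simpa using this
  refine tendsto_of_tendsto_of_tendsto_of_le_of_le' hlim tendsto_const_nhds ?_ ?_
  · filter_upwards [self_mem_nhdsWithin] with ε hε
    have hε' : (0 : ℝ) < ε := hε
    have h0 : ENNReal.ofReal (2 * ε) ≠ 0 := by simp [hε']
    rw [tsub_le_iff_right, ENNReal.div_eq_inv_mul]
    have := mul_le_mul_right (hlow ε hε') (ENNReal.ofReal (2 * ε))⁻¹
    rwa [mul_add, ← mul_assoc, ← mul_assoc, ENNReal.inv_mul_cancel h0 ENNReal.ofReal_ne_top,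
      one_mul, one_mul] at this
  · filter_upwards [self_mem_nhdsWithin] with ε hε
    have hε' : (0 : ℝ) < ε := hε
    refine ENNReal.div_le_of_le_mul ?_
    rw [mul_comm (crossMeasure ℓ S A)]
    exact hup ε hε'

theorem isFlowMeasure_crossMeasure {p : MvPolynomial (Fin n) ℂ}
    (hS : IsCrossSection ℓ (zeroSet p)) : IsFlowMeasure p ℓ (crossMeasure ℓ (zeroSet p)) :=
  ⟨crossMeasure_compl hS, fun _ hA hAS => tendsto_volume_thicken hS hA hAS⟩

theorem flowMeasure_eq_of_isFlowMeasure {p : MvPolynomial (Fin n) ℂ} {m : Measure (Torus n)}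
    (h : IsFlowMeasure p ℓ m) : flowMeasure p ℓ = m := by
  have hex : ∃ m, IsFlowMeasure p ℓ m := ⟨m, h⟩
  rw [flowMeasure, dif_pos hex]
  exact hex.choose_spec.unique h

end

section

/-! ### Equidistribution of the visits -/

variable {n : ℕ} {ℓ : Fin n → ℝ} {S : Set (Torus n)}

theorem intervalIntegrable_flow {H : Torus n → ℂ} (hm : Measurable H) {C : ℝ}
    (hb : ∀ y, ‖H y‖ ≤ C) (x : Torus n) (a b : ℝ) :
    IntervalIntegrable (fun t => H (flow ℓ t x)) volume a b := by
  have h1 : AEStronglyMeasurable (fun t => H (flow ℓ t x)) (volume.restrict (Set.uIoc a b)) :=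
    (hm.comp (continuous_flow_left x).measurable).aestronglyMeasurable
  exact (intervalIntegrable_const (c := C)).mono_fun' h1 (Eventually.of_forall fun t => hb _)

theorem norm_timeAverage_le {F : Torus n → ℂ} {φ : Torus n → ℝ} (hφ : Continuous φ)
    (h : ∀ y, ‖F y‖ ≤ φ y) (x : Torus n) {T : ℝ} (hT : 0 < T) :
    ‖timeAverage ℓ F x T‖ ≤ ‖timeAverage ℓ (fun y => (φ y : ℂ)) x T‖ := by
  unfold timeAverage
  rw [norm_mul, norm_mul]
  gcongr
  rw [intervalIntegral.integral_ofReal, Complex.norm_real, Real.norm_eq_abs]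
  refine (intervalIntegral.norm_integral_le_of_norm_le hT.le
    (Eventually.of_forall fun t _ => h (flow ℓ t x))
    ((hφ.comp (continuous_flow_left x)).intervalIntegrable _ _)).trans (le_abs_self _)

theorem norm_spaceAverage_le {F : Torus n → ℂ} {φ : Torus n → ℝ} (hφ : Continuous φ)
    (h : ∀ y, ‖F y‖ ≤ φ y) : ‖spaceAverage F‖ ≤ ‖spaceAverage (fun y => (φ y : ℂ))‖ := by
  unfold spaceAverage
  rw [norm_mul, norm_mul]
  gcongr
  rw [integral_complex_ofReal, Complex.norm_real, Real.norm_eq_abs]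
  refine (norm_integral_le_of_norm_le (hφ.integrable_of_hasCompactSupport
    (HasCompactSupport.of_compactSpace φ)) (Eventually.of_forall h)).trans (le_abs_self _)

/-- Weyl's theorem extends to bounded functions that are continuous off a closed null set. -/
theorem tendsto_timeAverage_of_continuousAt (hind : LinearIndependent ℚ ℓ) {H : Torus n → ℂ}
    (hm : Measurable H) {C : ℝ} (hb : ∀ y, ‖H y‖ ≤ C) {G : Set (Torus n)} (hG : IsClosed G)
    (hG0 : volume G = 0) (hc : ∀ y ∉ G, ContinuousAt H y) (x : Torus n) :
    Tendsto (timeAverage ℓ H x) atTop (𝓝 (spaceAverage H)) := by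
  rcases G.eq_empty_or_nonempty with he | hne
  · exact tendsto_timeAverage hind
      (continuous_iff_continuousAt.2 fun y => hc y (by simp [he])) x
  have hC : 0 ≤ C := (norm_nonneg _).trans (hb x)
  have hHint : Integrable H :=
    (integrable_const C).mono' hm.aestronglyMeasurable (Eventually.of_forall hb)
  -- cutoff functions that vanish on `G` and increase to one off `G`
  set χ : ℕ → Torus n → ℝ := fun k y => min 1 (k * Metric.infDist y G) with hχ
  have hχc : ∀ k, Continuous (χ k) := fun k =>
    continuous_const.min (continuous_const.mul (Metric.continuous_infDist_pt _))
  have hχ0 : ∀ k y, 0 ≤ χ k y := fun k y =>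
    le_min zero_le_one (mul_nonneg (by positivity) Metric.infDist_nonneg)
  have hχ1 : ∀ k y, χ k y ≤ 1 := fun k y => min_le_left _ _
  -- multiplying by the cutoff removes the discontinuities
  have hHχ : ∀ k, Continuous fun y => H y * (χ k y : ℂ) := by
    intro k
    refine continuous_iff_continuousAt.2 fun y => ?_
    by_cases hy : y ∈ G
    · have h0 : χ k y = 0 := by simp [hχ, Metric.infDist_zero_of_mem hy]
      rw [ContinuousAt, h0]
      simp only [Complex.ofReal_zero, mul_zero]
      refine squeeze_zero_norm (a := fun z => C * χ k z) (fun z => ?_) ?_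
      · rw [norm_mul, Complex.norm_real, Real.norm_eq_abs, abs_of_nonneg (hχ0 k z)]
        exact mul_le_mul_of_nonneg_right (hb z) (hχ0 k z)
      · have := ((hχc k).const_mul C).tendsto y
        simpa [h0] using this
    · exact (hc y hy).mul (Complex.continuous_ofReal.comp (hχc k)).continuousAt
  -- continuous bound for the error made by the cutoff
  set ψ : ℕ → Torus n → ℝ := fun k y => C * (1 - χ k y) with hψ
  have hψc : ∀ k, Continuous (ψ k) := fun k => continuous_const.mul (continuous_const.sub (hχc k))
  have hdiff : ∀ k y, ‖H y - H y * (χ k y : ℂ)‖ ≤ ψ k y := by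
    intro k y
    have : H y - H y * (χ k y : ℂ) = H y * ((1 - χ k y : ℝ) : ℂ) := by push_cast; ring
    rw [this, norm_mul, Complex.norm_real, Real.norm_eq_abs, abs_of_nonneg (by linarith [hχ1 k y])]
    exact mul_le_mul_of_nonneg_right (hb y) (by linarith [hχ1 k y])
  have hψlim : Tendsto (fun k => spaceAverage (fun y => (ψ k y : ℂ))) atTop (𝓝 0) := by
    have h := tendsto_integral_of_dominated_convergence (μ := (volume : Measure (Torus n)))
      (F := ψ) (f := fun _ => 0) (fun _ => C) (fun k => (hψc k).aestronglyMeasurable)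
      (integrable_const C) (fun k => Eventually.of_forall fun y => by
        rw [Real.norm_eq_abs, abs_of_nonneg (mul_nonneg hC (by linarith [hχ1 k y]))]
        nlinarith [hχ0 k y]) ?_
    · simp only [integral_zero] at h
      have h2 := ((Complex.continuous_ofReal.tendsto 0).comp h).const_mul
        (1 / ((2 * π) ^ n : ℂ))
      simpa [spaceAverage, Function.comp_def, integral_complex_ofReal] using h2
    · filter_upwards [measure_eq_zero_iff_ae_notMem.1 hG0] with y hy
      have hpos := (hG.notMem_iff_infDist_pos hne).1 hy
      refine tendsto_const_nhds.congr' ?_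
      obtain ⟨k₀, hk₀⟩ := exists_nat_gt (1 / Metric.infDist y G)
      filter_upwards [eventually_ge_atTop k₀] with k hk
      have : 1 ≤ (k : ℝ) * Metric.infDist y G := by
        rw [div_lt_iff₀ hpos] at hk₀
        have : (k₀ : ℝ) ≤ k := by exact_mod_cast hk
        nlinarith
      simp [hψ, hχ, this]
  rw [Metric.tendsto_atTop]
  intro ε hε
  obtain ⟨k, hk⟩ := ((Metric.tendsto_nhds.1 hψlim (ε / 4) (by positivity))).exists
  rw [dist_zero_right] at hk
  have hcψ : Continuous fun y => (ψ k y : ℂ) := Complex.continuous_ofReal.comp (hψc k)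
  obtain ⟨T₁, hT₁⟩ := Metric.tendsto_atTop.1 (tendsto_timeAverage hind (hHχ k) x) (ε / 4)
    (by positivity)
  obtain ⟨T₂, hT₂⟩ := Metric.tendsto_atTop.1 (tendsto_timeAverage hind hcψ x).norm
    (ε / 4) (by positivity)
  refine ⟨max (max T₁ T₂) 1, fun T hT => ?_⟩
  have hTpos : 0 < T := one_pos.trans_le ((le_max_right _ _).trans hT)
  have h1 := hT₁ T (((le_max_left _ _).trans (le_max_left _ _)).trans hT)
  have h2 := hT₂ T (((le_max_right _ _).trans (le_max_left _ _)).trans hT)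
  have h3 : dist (timeAverage ℓ H x T) (timeAverage ℓ (fun y => H y * (χ k y : ℂ)) x T) ≤
      ‖timeAverage ℓ (fun y => (ψ k y : ℂ)) x T‖ := by
    have : timeAverage ℓ H x T - timeAverage ℓ (fun y => H y * (χ k y : ℂ)) x T
        = timeAverage ℓ (fun y => H y - H y * (χ k y : ℂ)) x T := by
      unfold timeAverage
      rw [← mul_sub, ← intervalIntegral.integral_sub (intervalIntegrable_flow hm hb x _ _)
        ((continuous_comp_flow (hHχ k) x).intervalIntegrable _ _)]
    rw [dist_eq_norm, this]
    exact norm_timeAverage_le (hψc k) (hdiff k) x hTpos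
  have h4 : dist (spaceAverage (fun y => H y * (χ k y : ℂ))) (spaceAverage H) ≤
      ‖spaceAverage (fun y => (ψ k y : ℂ))‖ := by
    have : spaceAverage H - spaceAverage (fun y => H y * (χ k y : ℂ))
        = spaceAverage (fun y => H y - H y * (χ k y : ℂ)) := by
      unfold spaceAverage
      rw [← mul_sub, ← integral_sub hHint (integrable_of_continuous_torus (hHχ k))]
    rw [dist_comm, dist_eq_norm, this]
    exact norm_spaceAverage_le (hψc k) (hdiff k)
  rw [Real.dist_eq] at h2
  have h5 := (abs_lt.1 h2).2
  have := dist_triangle4 (timeAverage ℓ H x T) (timeAverage ℓ (fun y => H y * (χ k y : ℂ)) x T)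
    (spaceAverage (fun y => H y * (χ k y : ℂ))) (spaceAverage H)
  linarith

/-- A point near which the set `S` is met exactly once by every orbit segment: for small `r`, every
orbit segment `{y + tℓ : |t| < r}` with `y` close to `x` meets `S` in exactly one point. -/
def IsRegularPoint (ℓ : Fin n → ℝ) (S : Set (Torus n)) (x : Torus n) : Prop :=
  ∃ r₀ > 0, ∀ r, 0 < r → r ≤ r₀ → ∀ᶠ y in 𝓝 x, ∃! t, |t| < r ∧ flow ℓ t y ∈ S

/-- Near a regular point the visiting time is a continuous function of the orbit. -/
theorem IsRegularPoint.exists_branch {y : Torus n} {t : ℝ} (h : IsRegularPoint ℓ S (flow ℓ t y)) :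
    ∃ r₀ > 0, ∀ δ, 0 < δ → δ ≤ r₀ → ∃ φ : Torus n → ℝ, Tendsto φ (𝓝 y) (𝓝 t) ∧
      ∀ᶠ y' in 𝓝 y, |φ y' - t| < δ ∧ flow ℓ (φ y') y' ∈ S ∧
        ∀ s, |s - t| < δ → flow ℓ s y' ∈ S → s = φ y' := by
  classical
  obtain ⟨r₀, hr₀, hr⟩ := h
  refine ⟨r₀, hr₀, fun δ hδ hδr => ?_⟩
  have hev : ∀ r, 0 < r → r ≤ r₀ → ∀ᶠ y' in 𝓝 y, ∃! u, |u| < r ∧ flow ℓ u (flow ℓ t y') ∈ S :=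
    fun r h1 h2 => ((continuous_flow_right t).tendsto y).eventually (hr r h1 h2)
  -- the visiting time, with the junk value `0` where there is no visit
  let u : Torus n → ℝ := fun y' =>
    if h : ∃ u, |u| < δ ∧ flow ℓ u (flow ℓ t y') ∈ S then h.choose else 0
  have hu : ∀ᶠ y' in 𝓝 y, (|u y'| < δ ∧ flow ℓ (u y') (flow ℓ t y') ∈ S) ∧
      ∀ v, |v| < δ → flow ℓ v (flow ℓ t y') ∈ S → v = u y' := by
    filter_upwards [hev δ hδ hδr] with y' hy'
    have hs : |u y'| < δ ∧ flow ℓ (u y') (flow ℓ t y') ∈ S := by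
      simp only [u, dif_pos hy'.exists]
      exact hy'.exists.choose_spec
    exact ⟨hs, fun v hv hvS => hy'.unique ⟨hv, hvS⟩ hs⟩
  refine ⟨fun y' => t + u y', ?_, ?_⟩
  · rw [Metric.tendsto_nhds]
    intro ε hε
    filter_upwards [hu, hev (min ε δ) (lt_min hε hδ) ((min_le_right _ _).trans hδr)] with y' h1 h2
    obtain ⟨v, ⟨hv, hvS⟩, -⟩ := h2
    rw [h1.2 v (hv.trans_le (min_le_right _ _)) hvS] at hv
    rw [Real.dist_eq, add_sub_cancel_left]
    exact hv.trans_le (min_le_left _ _)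
  · filter_upwards [hu] with y' h1
    refine ⟨by rw [add_sub_cancel_left]; exact h1.1.1, by rw [← flow_flow]; exact h1.1.2, ?_⟩
    intro s hs hsS
    have := h1.2 (s - t) hs (by rw [flow_flow]; simpa using hsS)
    linarith

/-- The sum of `g` over the visits to `S` during the time interval `(0, T]`. -/
def visitSum (ℓ : Fin n → ℝ) (S : Set (Torus n)) (g : Torus n → ℂ) (T : ℝ) (y : Torus n) : ℂ :=
  ∑ᶠ t ∈ {t | t ∈ Set.Ioc 0 T ∧ flow ℓ t y ∈ S}, g (flow ℓ t y)

theorem visitSum_eq_sum (hS : IsCrossSection ℓ S) (g : Torus n → ℂ) (T : ℝ) (y : Torus n) :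
    visitSum ℓ S g T y = ∑ t ∈ (hS.finite_hits y 0 T).toFinset, g (flow ℓ t y) :=
  finsum_mem_eq_finite_toFinset_sum _ _

theorem visitSum_eq_sum_range (hS : IsCrossSection ℓ S) (g : Torus n → ℂ) {T : ℝ} {y : Torus n}
    {N : ℕ} (hN : T < hitTime ℓ S (N + 1) y) :
    visitSum ℓ S g T y = ∑ k ∈ Finset.range N,
      if hitTime ℓ S (k + 1) y ≤ T then g ((firstReturnMap ℓ S)^[k + 1] y) else 0 := by
  rw [visitSum_eq_sum hS, ← Finset.sum_filter]
  symm
  refine Finset.sum_bij (fun k _ => hitTime ℓ S (k + 1) y) ?_ ?_ ?_ ?_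
  · intro k hk
    rw [Finset.mem_filter] at hk
    rw [Set.Finite.mem_toFinset]
    exact ⟨⟨hS.hitTime_succ_pos k y, hk.2⟩, hS.flow_hitTime_mem k y⟩
  · intro k _ m _ h
    simpa using (hS.strictMono_hitTime y).injective h
  · intro t ht
    rw [Set.Finite.mem_toFinset] at ht
    obtain ⟨k, hk⟩ := hS.exists_eq_hitTime ht.1.1 ht.2
    refine ⟨k, ?_, hk⟩
    rw [Finset.mem_filter, Finset.mem_range]
    refine ⟨?_, by rw [hk]; exact ht.1.2⟩
    by_contra! h
    have := (hS.strictMono_hitTime y).monotone (by omega : N + 1 ≤ k + 1)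
    linarith [ht.1.2]
  · intro k _
    rw [iterate_firstReturnMap]

theorem visitSum_hitTime (hS : IsCrossSection ℓ S) (g : Torus n → ℂ) (N : ℕ) (y : Torus n) :
    visitSum ℓ S g (hitTime ℓ S N y) y =
      ∑ j ∈ Finset.Icc 1 N, g ((firstReturnMap ℓ S)^[j] y) := by
  rw [visitSum_eq_sum_range hS g (hS.hitTime_lt_succ N y), Finset.sum_ite_of_true,
    Finset.range_eq_Ico, Finset.sum_Ico_add' (fun j => g ((firstReturnMap ℓ S)^[j] y)) 0 N 1]
  · rfl
  · intro k hk
    exact (hS.strictMono_hitTime y).monotone (Finset.mem_range.1 hk)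

/-- A uniform bound for the number of visits during unit time. -/
def visitBound (hS : IsCrossSection ℓ S) : ℕ := hS.bound.choose

theorem one_lt_hitTime (hS : IsCrossSection ℓ S) (y : Torus n) :
    1 < hitTime ℓ S (visitBound hS + 1) y := by
  by_contra! h
  have h1 := hS.bound.choose_spec y
  have hinj : Function.Injective fun k => hitTime ℓ S (k + 1) y :=
    (hS.strictMono_hitTime y).injective.comp (add_left_injective 1)
  have h2 : (fun k => hitTime ℓ S (k + 1) y) '' (Finset.range (visitBound hS + 1) : Set ℕ) ⊆
      {t | t ∈ Set.Ioc (0 : ℝ) 1 ∧ flow ℓ t y ∈ S} := by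
    rintro _ ⟨k, hk, rfl⟩
    refine ⟨⟨hS.hitTime_succ_pos k y, le_trans ?_ h⟩, hS.flow_hitTime_mem k y⟩
    have : k < visitBound hS + 1 := by simpa using hk
    exact (hS.strictMono_hitTime y).monotone (by omega)
  have h3 := (Set.encard_le_encard h2).trans h1
  rw [hinj.encard_image, Set.encard_coe_eq_coe_finsetCard, Finset.card_range] at h3
  have : visitBound hS + 1 ≤ visitBound hS := by exact_mod_cast h3
  omega

theorem card_visits_le (hS : IsCrossSection ℓ S) (y : Torus n) (a : ℝ) :
    (hS.finite_hits y a (a + 1)).toFinset.card ≤ visitBound hS := by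
  have h1 := hS.bound.choose_spec (flow ℓ a y)
  have h2 : {t | t ∈ Set.Ioc a (a + 1) ∧ flow ℓ t y ∈ S} =
      (fun t => a + t) '' {t | t ∈ Set.Ioc (0 : ℝ) 1 ∧ flow ℓ t (flow ℓ a y) ∈ S} := by
    ext t
    constructor
    · rintro ⟨⟨h3, h4⟩, h5⟩
      refine ⟨t - a, ⟨⟨by linarith, by linarith⟩, ?_⟩, by ring⟩
      rw [flow_flow]; simpa using h5
    · rintro ⟨u, ⟨⟨h3, h4⟩, h5⟩, rfl⟩
      rw [flow_flow] at h5
      exact ⟨⟨by simp [h3], by simp [h4]⟩, h5⟩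
  have h3 : {t | t ∈ Set.Ioc a (a + 1) ∧ flow ℓ t y ∈ S}.encard ≤ visitBound hS := by
    rw [h2, (add_right_injective a).encard_image]
    exact h1
  rw [(hS.finite_hits y a (a + 1)).encard_eq_coe_toFinset_card] at h3
  exact_mod_cast h3

theorem norm_visitSum_one_le (hS : IsCrossSection ℓ S) {g : Torus n → ℂ} {C : ℝ}
    (hg : ∀ x ∈ S, ‖g x‖ ≤ C) (y : Torus n) :
    ‖visitSum ℓ S g 1 y‖ ≤ visitBound hS * |C| := by
  rw [visitSum_eq_sum hS]
  refine (norm_sum_le_of_le _ (f := fun t => g (flow ℓ t y)) (n := fun _ => |C|)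
    fun t ht => ?_).trans ?_
  · rw [Set.Finite.mem_toFinset] at ht
    exact (hg _ ht.2).trans (le_abs_self C)
  · rw [Finset.sum_const, nsmul_eq_mul]
    have := card_visits_le hS y 0
    simp only [zero_add] at this
    gcongr

theorem measurable_visitSum_one (hS : IsCrossSection ℓ S) {g : Torus n → ℂ} (hg : Measurable g) :
    Measurable (visitSum ℓ S g 1) := by
  have : visitSum ℓ S g 1 = fun y => ∑ k ∈ Finset.range (visitBound hS),
      if hitTime ℓ S (k + 1) y ≤ 1 then g ((firstReturnMap ℓ S)^[k + 1] y) else 0 :=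
    funext fun y => visitSum_eq_sum_range hS g (one_lt_hitTime hS y)
  rw [this]
  refine Finset.measurable_sum _ fun k _ => Measurable.ite ?_ ?_ measurable_const
  · exact measurable_hitTime hS _ measurableSet_Iic
  · exact hg.comp (measurable_iterate_firstReturnMap hS _)

/-- The cross-section measure is the mean of the sums over the visits during unit time. -/
theorem integral_visitSum_one (hS : IsCrossSection ℓ S) {g : Torus n → ℂ} (hg : Measurable g)
    {C : ℝ} (hb : ∀ x, ‖g x‖ ≤ C) :
    ∫ y, visitSum ℓ S g 1 y = ∫ x, g x ∂(crossMeasure ℓ S) := by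
  have hfin := isFiniteMeasure_crossMeasure hS
  have hgi : Integrable g (crossMeasure ℓ S) :=
    (integrable_const C).mono' hg.aestronglyMeasurable (Eventually.of_forall hb)
  have hm : ∀ k, MeasurableSet {y | hitTime ℓ S (k + 1) y ≤ 1} := fun k =>
    measurable_hitTime hS _ measurableSet_Iic
  have h1 := hasSum_integral_measure (f := g) hgi
  have h2 : ∀ k, ∫ x, g x ∂((volume.restrict {y | hitTime ℓ S (k + 1) y ≤ 1}).map
      (firstReturnMap ℓ S)^[k + 1]) =
      ∫ y, if hitTime ℓ S (k + 1) y ≤ 1 then g ((firstReturnMap ℓ S)^[k + 1] y) else 0 := by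
    intro k
    rw [integral_map (measurable_iterate_firstReturnMap hS _).aemeasurable
      hg.aestronglyMeasurable, ← integral_indicator (hm k)]
    rfl
  simp only [h2] at h1
  have h3 : HasSum (fun k => ∫ y, if hitTime ℓ S (k + 1) y ≤ 1 then
      g ((firstReturnMap ℓ S)^[k + 1] y) else 0) (∑ k ∈ Finset.range (visitBound hS),
      ∫ y, if hitTime ℓ S (k + 1) y ≤ 1 then g ((firstReturnMap ℓ S)^[k + 1] y) else 0) :=
    hasSum_sum_of_ne_finset_zero (by
    intro k hk
    have : ∀ y, ¬ hitTime ℓ S (k + 1) y ≤ 1 := fun y => by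
      rw [Finset.mem_range, not_lt] at hk
      have := (hS.strictMono_hitTime y).monotone (by omega : visitBound hS + 1 ≤ k + 1)
      exact not_le.2 ((one_lt_hitTime hS y).trans_le this)
    simp [this])
  have h4 : ∫ x, g x ∂(crossMeasure ℓ S) = _ := h1.unique h3
  rw [h4, ← integral_finsetSum]
  · exact integral_congr_ae (Eventually.of_forall fun y =>
      visitSum_eq_sum_range hS g (one_lt_hitTime hS y))
  · intro k _
    refine (integrable_const C).mono' ?_ (Eventually.of_forall fun y => ?_)
    · exact (Measurable.ite (hm k) (hg.comp (measurable_iterate_firstReturnMap hS _))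
        measurable_const).aestronglyMeasurable
    · split_ifs
      · exact hb _
      · simpa using (norm_nonneg _).trans (hb y)

/-- The sum over the visits during unit time is continuous at every orbit whose visits are regular
points of continuity and do not occur at the ends of the time interval. -/
theorem continuousAt_visitSum_one (hS : IsCrossSection ℓ S) {g : Torus n → ℂ} {y : Torus n}
    (h0 : y ∉ S) (h1 : flow ℓ 1 y ∉ S)
    (hreg : ∀ t ∈ Set.Icc (0 : ℝ) 1, flow ℓ t y ∈ S →
      IsRegularPoint ℓ S (flow ℓ t y) ∧ ContinuousWithinAt g S (flow ℓ t y)) :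
    ContinuousAt (visitSum ℓ S g 1) y := by
  classical
  set Z := (hS.finite_hits y 0 1).toFinset with hZdef
  have hZ : ∀ t, t ∈ Z ↔ t ∈ Set.Ioc (0 : ℝ) 1 ∧ flow ℓ t y ∈ S := fun t =>
    Set.Finite.mem_toFinset _
  have hbr : ∀ t ∈ Z, ∃ r₀ > 0, ∀ δ, 0 < δ → δ ≤ r₀ → ∃ φ : Torus n → ℝ, Tendsto φ (𝓝 y) (𝓝 t) ∧
      ∀ᶠ y' in 𝓝 y, |φ y' - t| < δ ∧ flow ℓ (φ y') y' ∈ S ∧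
        ∀ s, |s - t| < δ → flow ℓ s y' ∈ S → s = φ y' := fun t ht =>
    (hreg t ⟨((hZ t).1 ht).1.1.le, ((hZ t).1 ht).1.2⟩ ((hZ t).1 ht).2).1.exists_branch
  -- a radius for which the windows around the visits are disjoint, in `(0, 1)`, and regular
  obtain ⟨δ, hδ, hδZ⟩ : ∃ δ > 0, ∀ t ∈ Z, δ ≤ t ∧ δ ≤ 1 - t ∧
      (∃ φ : Torus n → ℝ, Tendsto φ (𝓝 y) (𝓝 t) ∧
      ∀ᶠ y' in 𝓝 y, |φ y' - t| < δ ∧ flow ℓ (φ y') y' ∈ S ∧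
        ∀ s, |s - t| < δ → flow ℓ s y' ∈ S → s = φ y') ∧
      ∀ t' ∈ Z, t ≠ t' → 2 * δ ≤ |t - t'| := by
    have hev : ∀ᶠ δ in 𝓝[>] (0 : ℝ), ∀ t ∈ Z, δ ≤ t ∧ δ ≤ 1 - t ∧
      (∃ φ : Torus n → ℝ, Tendsto φ (𝓝 y) (𝓝 t) ∧
      ∀ᶠ y' in 𝓝 y, |φ y' - t| < δ ∧ flow ℓ (φ y') y' ∈ S ∧
        ∀ s, |s - t| < δ → flow ℓ s y' ∈ S → s = φ y') ∧
      ∀ t' ∈ Z, t ≠ t' → 2 * δ ≤ |t - t'| := by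
      have hsmall : ∀ c : ℝ, 0 < c → ∀ᶠ δ in 𝓝[>] (0 : ℝ), δ ≤ c := fun c hc =>
        (eventually_le_nhds hc).filter_mono nhdsWithin_le_nhds
      rw [Filter.eventually_all_finset]
      intro t ht
      obtain ⟨r₀, hr₀, hr⟩ := hbr t ht
      have ht1 : t < 1 := lt_of_le_of_ne ((hZ t).1 ht).1.2 (by
        rintro rfl; exact h1 ((hZ 1).1 ht).2)
      have hsep : ∀ᶠ δ in 𝓝[>] (0 : ℝ), ∀ t' ∈ Z, t ≠ t' → 2 * δ ≤ |t - t'| := by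
        rw [Filter.eventually_all_finset]
        intro t' _
        by_cases htt : t = t'
        · exact Eventually.of_forall fun δ h => absurd htt h
        · filter_upwards [hsmall (|t - t'| / 2) (by
            have := abs_pos.2 (sub_ne_zero.2 htt); positivity)] with δ hδ _
          linarith
      filter_upwards [hsmall t ((hZ t).1 ht).1.1, hsmall (1 - t) (by linarith), hsmall r₀ hr₀,
        hsep, self_mem_nhdsWithin] with δ d1 d2 d3 d4 d5
      exact ⟨d1, d2, hr δ d5 d3, d4⟩
    obtain ⟨δ, h, hpos⟩ := (hev.and self_mem_nhdsWithin).exists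
    exact ⟨δ, hpos, h⟩
  choose! φ hφlim hφ using fun t ht => (hδZ t ht).2.2.1
  have hev1 : ∀ᶠ y' in 𝓝 y, ∀ t ∈ Z, |φ t y' - t| < δ ∧ flow ℓ (φ t y') y' ∈ S ∧
      ∀ s, |s - t| < δ → flow ℓ s y' ∈ S → s = φ t y' :=
    (Filter.eventually_all_finset Z).2 hφ
  -- away from the windows there are no visits
  set Kc : Set ℝ := Set.Icc 0 1 \ ⋃ t ∈ Z, Metric.ball t δ with hKc
  have hKcomp : IsCompact Kc := isCompact_Icc.diff (isOpen_biUnion fun _ _ => Metric.isOpen_ball)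
  have hev2 : ∀ᶠ y' in 𝓝 y, ∀ t ∈ Kc, flow ℓ t y' ∉ S := by
    refine hKcomp.eventually_forall_of_forall_eventually fun t ht => ?_
    have hnot : flow ℓ t y ∉ S := by
      intro htS
      have ht0 : 0 < t := lt_of_le_of_ne ht.1.1 (by
        rintro rfl; rw [flow_zero] at htS; exact h0 htS)
      refine ht.2 (Set.mem_biUnion ((hZ t).2 ⟨⟨ht0, ht.1.2⟩, htS⟩) (Metric.mem_ball_self hδ))
    have hc : Continuous fun z : Torus n × ℝ => flow ℓ z.2 z.1 :=
      continuous_flow.comp (continuous_snd.prodMk continuous_fst)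
    exact (hc.continuousAt (x := (y, t))).eventually (hS.isClosed.isOpen_compl.mem_nhds hnot)
  -- near `y` the visits are in bijection with those of `y`
  have hev : ∀ᶠ y' in 𝓝 y, visitSum ℓ S g 1 y' = ∑ t ∈ Z, g (flow ℓ (φ t y') y') := by
    filter_upwards [hev1, hev2] with y' e1 e2
    rw [visitSum_eq_sum hS]
    symm
    refine Finset.sum_bij (fun t _ => φ t y') ?_ ?_ ?_ (fun _ _ => rfl)
    · intro t ht
      rw [Set.Finite.mem_toFinset]
      have a1 := abs_lt.1 (e1 t ht).1
      have a2 := hδZ t ht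
      exact ⟨⟨by linarith [a2.1], by linarith [a2.2.1]⟩, (e1 t ht).2.1⟩
    · intro t ht t' ht' heq
      by_contra hne
      have a1 := abs_lt.1 (e1 t ht).1
      have a2 := abs_lt.1 (e1 t' ht').1
      have a3 := (hδZ t ht).2.2.2 t' ht' hne
      have : |t - t'| < 2 * δ := by rw [abs_lt]; constructor <;> linarith
      linarith
    · intro s hs
      rw [Set.Finite.mem_toFinset] at hs
      by_cases hsK : s ∈ Kc
      · exact absurd hs.2 (e2 s hsK)
      · have : s ∈ ⋃ t ∈ Z, Metric.ball t δ := by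
          by_contra h
          exact hsK ⟨⟨hs.1.1.le, hs.1.2⟩, h⟩
        obtain ⟨t, ht, hst⟩ := Set.mem_iUnion₂.1 this
        rw [Metric.mem_ball, Real.dist_eq] at hst
        exact ⟨t, ht, ((e1 t ht).2.2 s hst hs.2).symm⟩
  have hval : visitSum ℓ S g 1 y = ∑ t ∈ Z, g (flow ℓ t y) := visitSum_eq_sum hS g 1 y
  rw [ContinuousAt, hval]
  refine Tendsto.congr' (hev.mono fun _ h => h.symm) ?_
  refine tendsto_finsetSum _ fun t ht => ?_
  have hcw := (hreg t ⟨((hZ t).1 ht).1.1.le, ((hZ t).1 ht).1.2⟩ ((hZ t).1 ht).2).2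
  refine hcw.tendsto.comp (tendsto_nhdsWithin_iff.2 ⟨?_, hev1.mono fun y' h => (h t ht).2.1⟩)
  exact (continuous_flow.tendsto (t, y)).comp ((hφlim t ht).prodMk_nhds tendsto_id)

end

section

variable {n : ℕ} {ℓ : Fin n → ℝ} {S : Set (Torus n)}

/-! ### Time averages of the visits -/

/-- A visit at time `u` is counted by the unit windows that start at a time in `[u - 1, u)`. -/
theorem visitSum_one_flow (hS : IsCrossSection ℓ S) (g : Torus n → ℂ) {T s : ℝ} (hs0 : 0 ≤ s)
    (hsT : s ≤ T) (x : Torus n) :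
    visitSum ℓ S g 1 (flow ℓ s x) = ∑ u ∈ (hS.finite_hits x 0 (T + 1)).toFinset,
      (Set.Ico (u - 1) u).indicator (fun _ => g (flow ℓ u x)) s := by
  classical
  rw [visitSum_eq_sum hS]
  simp only [Set.indicator_apply]
  rw [← Finset.sum_filter]
  refine Finset.sum_bij (fun t _ => s + t) ?_ ?_ ?_ ?_
  · intro t ht
    rw [Set.Finite.mem_toFinset] at ht
    rw [Finset.mem_filter, Set.Finite.mem_toFinset]
    have h2 := ht.2
    rw [flow_flow] at h2
    exact ⟨⟨⟨by linarith [ht.1.1], by linarith [ht.1.2]⟩, h2⟩, by linarith [ht.1.2],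
      by linarith [ht.1.1]⟩
  · intro t _ t' _ h
    exact add_left_cancel h
  · intro u hu
    rw [Finset.mem_filter, Set.Finite.mem_toFinset] at hu
    refine ⟨u - s, ?_, by ring⟩
    rw [Set.Finite.mem_toFinset]
    refine ⟨⟨by linarith [hu.2.2], by linarith [hu.2.1]⟩, ?_⟩
    rw [flow_flow]; simpa using hu.1.2
  · intro t _
    rw [flow_flow]

/-- The time integral of the unit-window sums differs from the sum over all visits only by the
contributions of the first and the last unit of time. -/
theorem norm_integral_visitSum_sub_le (hS : IsCrossSection ℓ S) {g : Torus n → ℂ} {C : ℝ}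
    (hg : ∀ x ∈ S, ‖g x‖ ≤ C) (x : Torus n) {T : ℝ} (hT : 0 ≤ T) :
    ‖(∫ s in (0 : ℝ)..T, visitSum ℓ S g 1 (flow ℓ s x)) - visitSum ℓ S g T x‖ ≤
      2 * visitBound hS * |C| := by
  classical
  set F := (hS.finite_hits x 0 (T + 1)).toFinset with hF
  have hFmem : ∀ u, u ∈ F ↔ u ∈ Set.Ioc 0 (T + 1) ∧ flow ℓ u x ∈ S := fun u =>
    Set.Finite.mem_toFinset _
  set μ := (volume : Measure ℝ).restrict (Set.Ioc 0 T) with hμ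
  -- the weight of a visit at time `u` in the time integral; it is one for `1 < u ≤ T`
  set w : ℝ → ℝ := fun u => μ.real (Set.Ico (u - 1) u) with hw
  have h1 : ∫ s in (0 : ℝ)..T, visitSum ℓ S g 1 (flow ℓ s x) = ∑ u ∈ F, w u • g (flow ℓ u x) := by
    rw [intervalIntegral.integral_of_le hT,
      setIntegral_congr_fun measurableSet_Ioc (g := fun s => ∑ u ∈ F,
      (Set.Ico (u - 1) u).indicator (fun _ => g (flow ℓ u x)) s)
      (fun s hs => visitSum_one_flow hS g hs.1.le hs.2 x)]
    rw [integral_finsetSum]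
    · refine Finset.sum_congr rfl fun u _ => ?_
      rw [integral_indicator_const _ measurableSet_Ico]
    · intro u _
      exact (integrable_const (g (flow ℓ u x))).indicator measurableSet_Ico
  have h2 : visitSum ℓ S g T x = ∑ u ∈ F, (if u ≤ T then (1 : ℝ) else 0) • g (flow ℓ u x) := by
    rw [visitSum_eq_sum hS]
    have : (hS.finite_hits x 0 T).toFinset = F.filter (· ≤ T) := by
      ext u
      rw [Set.Finite.mem_toFinset, Finset.mem_filter, hFmem]
      constructor
      · rintro ⟨⟨a, b⟩, c⟩; exact ⟨⟨⟨a, by linarith⟩, c⟩, b⟩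
      · rintro ⟨⟨⟨a, _⟩, c⟩, b⟩; exact ⟨⟨a, b⟩, c⟩
    rw [this, Finset.sum_filter]
    refine Finset.sum_congr rfl fun u _ => ?_
    split_ifs <;> simp
  have hw01 : ∀ u, 0 ≤ w u ∧ w u ≤ 1 := by
    intro u
    refine ⟨measureReal_nonneg, ?_⟩
    have h : μ (Set.Ico (u - 1) u) ≤ 1 := by
      refine (Measure.restrict_apply_le _ _).trans ?_
      rw [Real.volume_Ico]; simp
    calc w u ≤ (1 : ENNReal).toReal := ENNReal.toReal_mono (by simp) h
      _ = 1 := by simp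
  have hw1 : ∀ u, 1 < u → u ≤ T → w u = 1 := by
    intro u hu hu2
    have : Set.Ico (u - 1) u ⊆ Set.Ioc 0 T := fun s hs =>
      ⟨by linarith [hs.1], by linarith [hs.2]⟩
    simp only [hw, hμ, measureReal_def, Measure.restrict_apply measurableSet_Ico,
      Set.inter_eq_left.2 this, Real.volume_Ico]
    simp
  rw [h1, h2, ← Finset.sum_sub_distrib]
  calc ‖∑ u ∈ F, (w u • g (flow ℓ u x) - (if u ≤ T then (1 : ℝ) else 0) • g (flow ℓ u x))‖
      ≤ ∑ u ∈ F, ((if u ≤ 1 then |C| else 0) + (if T < u then |C| else 0)) := by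
        refine norm_sum_le_of_le _ fun u hu => ?_
        have hgu := (hg _ ((hFmem u).1 hu).2).trans (le_abs_self C)
        rw [← sub_smul, norm_smul, Real.norm_eq_abs]
        have hCn : 0 ≤ |C| := abs_nonneg C
        have hab : |w u - if u ≤ T then (1 : ℝ) else 0| ≤ 1 := by
          have := hw01 u
          split_ifs <;> rw [abs_le] <;> constructor <;> linarith
        by_cases a : u ≤ 1
        · rw [if_pos a]
          have : (0 : ℝ) ≤ if T < u then |C| else 0 := by split_ifs <;> simp
          have h3 := mul_le_mul hab hgu (norm_nonneg _) zero_le_one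
          linarith
        · rw [if_neg a, zero_add]
          by_cases b : u ≤ T
          · rw [if_pos b, hw1 u (not_le.1 a) b]
            simp [not_lt.2 b]
          · rw [if_pos (not_le.1 b)]
            have h3 := mul_le_mul hab hgu (norm_nonneg _) zero_le_one
            linarith
    _ = (F.filter (· ≤ 1)).card * |C| + (F.filter (T < ·)).card * |C| := by
        rw [Finset.sum_add_distrib, ← Finset.sum_filter, ← Finset.sum_filter, Finset.sum_const,
          Finset.sum_const, nsmul_eq_mul, nsmul_eq_mul]
    _ ≤ visitBound hS * |C| + visitBound hS * |C| := by
        have c1 : (F.filter (· ≤ 1)).card ≤ visitBound hS := by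
          refine (Finset.card_le_card ?_).trans (card_visits_le hS x 0)
          intro u hu
          rw [Finset.mem_filter, hFmem] at hu
          rw [Set.Finite.mem_toFinset]
          exact ⟨⟨hu.1.1.1, by linarith [hu.2]⟩, hu.1.2⟩
        have c2 : (F.filter (T < ·)).card ≤ visitBound hS := by
          refine (Finset.card_le_card ?_).trans (card_visits_le hS x T)
          intro u hu
          rw [Finset.mem_filter, hFmem] at hu
          rw [Set.Finite.mem_toFinset]
          exact ⟨⟨hu.2, hu.1.1.2⟩, hu.1.2⟩
        gcongr
    _ = _ := by ring

/-- The visits of an orbit are equidistributed with respect to the cross-section measure, for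
bounded Borel functions that are continuous off a closed null set of bad points. -/
theorem tendsto_visitSum_div_of_measurable (hind : LinearIndependent ℚ ℓ)
    (hS : IsCrossSection ℓ S) {E : Set (Torus n)} (hE : IsClosed E) (hES : E ⊆ S)
    (hE0 : crossMeasure ℓ S E = 0) (hreg : ∀ x ∈ S, x ∉ E → IsRegularPoint ℓ S x)
    {g : Torus n → ℂ} (hgm : Measurable g) {C : ℝ} (hgb : ∀ x, ‖g x‖ ≤ C)
    (hgc : ∀ x ∈ S, x ∉ E → ContinuousWithinAt g S x) (x : Torus n) :
    Tendsto (fun T : ℝ => (1 / (T : ℂ)) * visitSum ℓ S g T x) atTop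
      (𝓝 ((1 / ((2 * π) ^ n : ℂ)) * ∫ x, g x ∂(crossMeasure ℓ S))) := by
  -- the unit-window sum is continuous off `G`, so its time averages converge
  set G : Set (Torus n) := (S ∪ flow ℓ 1 ⁻¹' S) ∪ {y | ∃ t ∈ Set.Icc (0 : ℝ) 1, flow ℓ t y ∈ E}
  have hSc := hS.isClosed
  have hG : IsClosed G :=
    (hSc.union (hSc.preimage (continuous_flow_right 1))).union (isClosed_exists_Icc hE 0 1)
  have hG0 : volume G = 0 := by
    refine measure_union_null (measure_union_null (volume_crossSection_eq_zero hS) ?_)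
      (volume_exists_flow_mem_eq_zero hS hE hES hE0)
    rw [(measurePreserving_flow 1).measure_preimage hSc.measurableSet.nullMeasurableSet,
      volume_crossSection_eq_zero hS]
  have hlim := tendsto_timeAverage_of_continuousAt hind (measurable_visitSum_one hS hgm)
    (norm_visitSum_one_le hS (fun x _ => hgb x)) hG hG0 (fun y hy => by
      refine continuousAt_visitSum_one hS (fun h => hy (Or.inl (Or.inl h)))
        (fun h => hy (Or.inl (Or.inr h))) fun t ht htS => ?_
      have htE : flow ℓ t y ∉ E := fun h => hy (Or.inr ⟨t, ht, h⟩)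
      exact ⟨hreg _ htS htE, hgc _ htS htE⟩) x
  rw [spaceAverage, integral_visitSum_one hS hgm hgb] at hlim
  have herr : Tendsto (fun T : ℝ => (1 / (T : ℂ)) * visitSum ℓ S g T x -
      timeAverage ℓ (visitSum ℓ S g 1) x T) atTop (𝓝 0) := by
    refine squeeze_zero_norm' (a := fun T : ℝ => (1 / T) * (2 * visitBound hS * |C|)) ?_ ?_
    · filter_upwards [eventually_gt_atTop 0] with T hT
      rw [timeAverage, ← mul_sub, norm_mul, norm_sub_rev]
      have h2 : ‖(1 / (T : ℂ))‖ = 1 / T := by simp [abs_of_pos hT]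
      rw [h2]
      gcongr
      exact norm_integral_visitSum_sub_le hS (fun x _ => hgb x) x hT.le
    · simpa using (tendsto_const_nhds (x := (1 : ℝ)).div_atTop tendsto_id).mul_const
        (2 * visitBound hS * |C|)
  simpa using herr.add hlim

theorem norm_visitSum_le (hS : IsCrossSection ℓ S) {g : Torus n → ℂ} {φ : Torus n → ℝ}
    (h : ∀ x ∈ S, ‖g x‖ ≤ φ x) (T : ℝ) (x : Torus n) :
    ‖visitSum ℓ S g T x‖ ≤ ‖visitSum ℓ S (fun x => (φ x : ℂ)) T x‖ := by
  rw [visitSum_eq_sum hS, visitSum_eq_sum hS, ← Complex.ofReal_sum, Complex.norm_real]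
  refine (norm_sum_le_of_le _ fun t ht => ?_).trans (le_abs_self _)
  rw [Set.Finite.mem_toFinset] at ht
  exact h _ ht.2

theorem visitSum_sub (hS : IsCrossSection ℓ S) (g h : Torus n → ℂ) (T : ℝ) (x : Torus n) :
    visitSum ℓ S g T x - visitSum ℓ S h T x = visitSum ℓ S (fun x => g x - h x) T x := by
  simp only [visitSum_eq_sum hS, Finset.sum_sub_distrib]

theorem aestronglyMeasurable_of_continuousWithinAt (hSm : MeasurableSet S) {E : Set (Torus n)}
    (hE : IsClosed E) {m : Measure (Torus n)} (hE0 : m E = 0) {g : Torus n → ℂ}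
    (hgc : ∀ x ∈ S, x ∉ E → ContinuousWithinAt g S x) :
    AEStronglyMeasurable g (m.restrict S) := by
  have hSE : MeasurableSet (S \ E) := hSm.diff hE.measurableSet
  have hc : ContinuousOn g (S \ E) := fun x hx => (hgc x hx.1 hx.2).mono Set.sdiff_subset
  have h := hc.aestronglyMeasurable (μ := m) hSE
  rwa [Measure.restrict_congr_set (sdiff_null_ae_eq_self hE0)] at h

theorem integrableOn_of_continuousWithinAt (hSm : MeasurableSet S) {E : Set (Torus n)}
    (hE : IsClosed E) {m : Measure (Torus n)} [IsFiniteMeasure m] (hE0 : m E = 0) {g : Torus n → ℂ}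
    {C : ℝ} (hgb : ∀ x ∈ S, ‖g x‖ ≤ C)
    (hgc : ∀ x ∈ S, x ∉ E → ContinuousWithinAt g S x) : IntegrableOn g S m :=
  (integrable_const C).mono' (aestronglyMeasurable_of_continuousWithinAt hSm hE hE0 hgc)
    ((ae_restrict_iff' hSm).2 (Eventually.of_forall hgb))

/-- The visits of an orbit are equidistributed with respect to the cross-section measure. -/
theorem tendsto_visitSum_div (hind : LinearIndependent ℚ ℓ)
    (hS : IsCrossSection ℓ S) {E : Set (Torus n)} (hE : IsClosed E) (hES : E ⊆ S)
    (hE0 : crossMeasure ℓ S E = 0) (hreg : ∀ x ∈ S, x ∉ E → IsRegularPoint ℓ S x)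
    {g : Torus n → ℂ} {C : ℝ} (hgb : ∀ x ∈ S, ‖g x‖ ≤ C)
    (hgc : ∀ x ∈ S, x ∉ E → ContinuousWithinAt g S x) (x : Torus n) :
    Tendsto (fun T : ℝ => (1 / (T : ℂ)) * visitSum ℓ S g T x) atTop
      (𝓝 ((1 / ((2 * π) ^ n : ℂ)) * ∫ x in S, g x ∂(crossMeasure ℓ S))) := by
  classical
  have hSm := hS.isClosed.measurableSet
  have hSE : MeasurableSet (S \ E) := hSm.diff hE.measurableSet
  -- a Borel function that agrees with `g` off `E`, and the indicator of `E` controlling the error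
  set g' : Torus n → ℂ := (S \ E).piecewise g 0 with hg'
  set e : Torus n → ℝ := E.indicator (fun _ => |C|) with he
  have hEev : ∀ x ∉ E, ∀ᶠ y in 𝓝[S] x, y ∉ E := fun x hx =>
    nhdsWithin_le_nhds (hE.isOpen_compl.mem_nhds hx)
  have hg'm : Measurable g' := by
    refine ContinuousOn.measurable_piecewise (fun x hx => ?_) continuousOn_const hSE
    exact (hgc x hx.1 hx.2).mono Set.sdiff_subset
  have hg'b : ∀ x, ‖g' x‖ ≤ |C| := by
    intro x
    by_cases hx : x ∈ S \ E
    · rw [hg', Set.piecewise_eq_of_mem _ _ _ hx]; exact (hgb x hx.1).trans (le_abs_self C)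
    · rw [hg', Set.piecewise_eq_of_notMem _ _ _ hx]; simp
  have hg'c : ∀ x ∈ S, x ∉ E → ContinuousWithinAt g' S x := by
    intro x hx hxE
    refine (hgc x hx hxE).congr_of_eventuallyEq ?_ (Set.piecewise_eq_of_mem _ _ _ ⟨hx, hxE⟩)
    filter_upwards [hEev x hxE, self_mem_nhdsWithin] with y hy hyS
    exact Set.piecewise_eq_of_mem _ _ _ ⟨hyS, hy⟩
  have hem : Measurable fun x => (e x : ℂ) :=
    Complex.measurable_ofReal.comp (measurable_const.indicator hE.measurableSet)
  have heb : ∀ x, ‖(e x : ℂ)‖ ≤ |C| := by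
    intro x
    rw [Complex.norm_real]
    by_cases hx : x ∈ E <;> simp [he, hx]
  have hec : ∀ x ∈ S, x ∉ E → ContinuousWithinAt (fun x => (e x : ℂ)) S x := by
    intro x hx hxE
    refine (continuousWithinAt_const (b := (0 : ℂ))).congr_of_eventuallyEq ?_ (by simp [he, hxE])
    filter_upwards [hEev x hxE] with y hy
    simp [he, hy]
  have h1 := tendsto_visitSum_div_of_measurable hind hS hE hES hE0 hreg hg'm hg'b hg'c x
  have h2 := tendsto_visitSum_div_of_measurable hind hS hE hES hE0 hreg hem heb hec x
  have hint : ∫ x in S, g x ∂(crossMeasure ℓ S) = ∫ x, g' x ∂(crossMeasure ℓ S) := by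
    rw [hg', Set.piecewise_eq_indicator, integral_indicator hSE]
    exact setIntegral_congr_set (sdiff_null_ae_eq_self hE0).symm
  have hint0 : ∫ x, (e x : ℂ) ∂(crossMeasure ℓ S) = 0 := by
    refine integral_eq_zero_of_ae ?_
    filter_upwards [measure_eq_zero_iff_ae_notMem.1 hE0] with y hy
    simp [he, hy]
  rw [hint0, mul_zero] at h2
  rw [hint]
  have herr : Tendsto (fun T : ℝ => (1 / (T : ℂ)) * visitSum ℓ S g T x -
      (1 / (T : ℂ)) * visitSum ℓ S g' T x) atTop (𝓝 0) := by
    have h2' := h2.norm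
    rw [norm_zero] at h2'
    refine squeeze_zero_norm (fun T => ?_) h2'
    rw [← mul_sub, visitSum_sub hS, norm_mul, norm_mul]
    gcongr
    refine norm_visitSum_le hS (fun x hx => ?_) T x
    by_cases hxE : x ∈ E
    · have : g' x = 0 := Set.piecewise_eq_of_notMem _ _ _ (fun h => h.2 hxE)
      simp only [this, sub_zero, he, Set.indicator_of_mem hxE]
      exact (hgb x hx).trans (le_abs_self C)
    · have : g' x = g x := Set.piecewise_eq_of_mem _ _ _ ⟨hx, hxE⟩
      simp [this, he, hxE]
  simpa using herr.add h1

end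

section

/-! ### Averages over the visits, and listings of the visits with multiplicities -/

section Averages

variable {n : ℕ} {ℓ : Fin n → ℝ} {S : Set (Torus n)}

theorem visitSum_one_hitTime (hS : IsCrossSection ℓ S) (N : ℕ) (x : Torus n) :
    visitSum ℓ S (fun _ => 1) (hitTime ℓ S N x) x = N := by
  rw [visitSum_hitTime hS]; simp

/-- The Birkhoff averages of the first return map converge to the space average. -/
theorem tendsto_average_iterate (hind : LinearIndependent ℚ ℓ)
    (hS : IsCrossSection ℓ S) (hpos : crossMeasure ℓ S S ≠ 0)
    {E : Set (Torus n)} (hE : IsClosed E) (hES : E ⊆ S)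
    (hE0 : crossMeasure ℓ S E = 0) (hreg : ∀ x ∈ S, x ∉ E → IsRegularPoint ℓ S x)
    {g : Torus n → ℂ} {C : ℝ} (hgb : ∀ x ∈ S, ‖g x‖ ≤ C)
    (hgc : ∀ x ∈ S, x ∉ E → ContinuousWithinAt g S x) (x : Torus n) :
    Tendsto (fun N : ℕ => (1 / (N : ℂ)) * ∑ j ∈ Finset.Icc 1 N, g ((firstReturnMap ℓ S)^[j] x))
      atTop (𝓝 (1 / ((crossMeasure ℓ S).real S : ℂ) * ∫ x in S, g x ∂(crossMeasure ℓ S))) := by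
  have hfin := isFiniteMeasure_crossMeasure hS
  have hT := hS.tendsto_hitTime x
  have h1 := (tendsto_visitSum_div hind hS hE hES hE0 hreg hgb hgc x).comp hT
  have h2 := (tendsto_visitSum_div hind hS hE hES hE0 hreg (g := fun _ => 1) (C := 1) (by simp)
    (fun _ _ _ => continuousWithinAt_const) x).comp hT
  have hM : ((crossMeasure ℓ S).real S : ℂ) ≠ 0 := by
    simpa [measureReal_def, ENNReal.toReal_eq_zero_iff] using hpos
  have hpi : ((2 * π) ^ n : ℂ) ≠ 0 := by
    exact pow_ne_zero _ (mul_ne_zero two_ne_zero (by exact_mod_cast Real.pi_ne_zero))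
  have hint : ∫ _ in S, (1 : ℂ) ∂(crossMeasure ℓ S) = (crossMeasure ℓ S).real S := by
    rw [setIntegral_const]; simp
  rw [hint] at h2
  -- averages over visits are quotients of averages over time
  have h3 := h1.div h2 (mul_ne_zero (one_div_ne_zero hpi) hM)
  have e : (1 / ((2 * π) ^ n : ℂ) * ∫ x in S, g x ∂(crossMeasure ℓ S)) /
      (1 / ((2 * π) ^ n : ℂ) * ((crossMeasure ℓ S).real S : ℂ)) =
      1 / ((crossMeasure ℓ S).real S : ℂ) * ∫ x in S, g x ∂(crossMeasure ℓ S) := by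
    field_simp
  rw [e] at h3
  refine h3.congr' ?_
  filter_upwards [eventually_ge_atTop 1] with N hN
  simp only [Function.comp_apply, Pi.div_apply, visitSum_one_hitTime hS, visitSum_hitTime hS]
  have hT0 : (hitTime ℓ S N x : ℂ) ≠ 0 := by
    obtain ⟨k, rfl⟩ : ∃ k, N = k + 1 := ⟨N - 1, by omega⟩
    exact_mod_cast (hS.hitTime_succ_pos k x).ne'
  have hN0 : (N : ℂ) ≠ 0 := by exact_mod_cast (by omega : N ≠ 0)
  field_simp

/-- `x` lists the visits of the orbit of `x₀` in increasing order, each repeated as often as the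
weight function `w` prescribes. -/
structure IsVisitListing (ℓ : Fin n → ℝ) (S : Set (Torus n)) (w : Torus n → ℕ) (x₀ : Torus n)
    (x : ℤ → ℝ) : Prop where
  monotone : Monotone x
  encard_of_mem : ∀ t, flow ℓ t x₀ ∈ S → {j : ℤ | x j = t}.encard = w (flow ℓ t x₀)
  mem : ∀ j, flow ℓ (x j) x₀ ∈ S

variable {w : Torus n → ℕ} {x₀ : Torus n} {x : ℤ → ℝ}

theorem IsVisitListing.finite_fiber (hx : IsVisitListing ℓ S w x₀ x) (t : ℝ) :
    {j : ℤ | x j = t}.Finite := by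
  by_cases ht : flow ℓ t x₀ ∈ S
  · rw [← Set.encard_lt_top_iff, hx.encard_of_mem t ht]; simp
  · have : {j : ℤ | x j = t} = ∅ := by
      ext j
      simp only [Set.mem_ofPred_eq, Set.mem_empty_iff_false, iff_false]
      rintro rfl
      exact ht (hx.mem j)
    rw [this]; exact Set.finite_empty

theorem IsVisitListing.finite_preimage (hS : IsCrossSection ℓ S) (hx : IsVisitListing ℓ S w x₀ x)
    (a b : ℝ) : {j : ℤ | x j ∈ Set.Ioc a b}.Finite := by
  refine ((hS.finite_hits x₀ a b).biUnion fun t _ => hx.finite_fiber t).subset fun j hj => ?_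
  exact Set.mem_biUnion (x := x j) ⟨hj, hx.mem j⟩ rfl

theorem IsVisitListing.tendsto (hS : IsCrossSection ℓ S) (hx : IsVisitListing ℓ S w x₀ x) :
    Tendsto (fun N : ℕ => x N) atTop atTop := by
  refine tendsto_atTop_atTop_of_monotone (fun a b hab => hx.monotone (by exact_mod_cast hab))
    fun b => ?_
  by_contra! hcon
  refine Set.infinite_range_of_injective (Nat.cast_injective (R := ℤ))
    ((hx.finite_preimage hS (x 0 - 1) b).subset ?_)
  rintro _ ⟨N, rfl⟩
  have : x 0 ≤ x N := hx.monotone (by positivity)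
  exact ⟨by linarith, (hcon N).le⟩

/-- The sum over the first `N` terms of a listing is the weighted sum over the visits, up to the
contributions of the first and the last visit. -/
theorem IsVisitListing.norm_sum_sub_le (hS : IsCrossSection ℓ S) (hx : IsVisitListing ℓ S w x₀ x)
    {W : ℕ} (hW : ∀ y ∈ S, w y ≤ W) {h : Torus n → ℂ} {C : ℝ} (hb : ∀ y ∈ S, ‖h y‖ ≤ C) (N : ℕ) :
    ‖∑ j ∈ Finset.Icc 1 N, h (flow ℓ (x (j : ℤ)) x₀) -
      visitSum ℓ S (fun y => (w y : ℂ) * h y) (x N - x 0) (flow ℓ (x 0) x₀)‖ ≤ 2 * W * |C| := by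
  classical
  -- the weighted sum runs over `J`, which differs from `{1, …, N}` only by indices `j` with
  -- `x j = x 0` or `x j = x N`
  set J := (hx.finite_preimage hS (x 0) (x N)).toFinset with hJ
  have hJm : ∀ j, j ∈ J ↔ x 0 < x j ∧ x j ≤ x N := fun j => Set.Finite.mem_toFinset _
  set F := (hS.finite_hits (flow ℓ (x 0) x₀) 0 (x N - x 0)).toFinset with hF
  have hFm : ∀ t, t ∈ F ↔ t ∈ Set.Ioc 0 (x N - x 0) ∧ flow ℓ t (flow ℓ (x 0) x₀) ∈ S := fun t =>
    Set.Finite.mem_toFinset _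
  have e1 : visitSum ℓ S (fun y => (w y : ℂ) * h y) (x N - x 0) (flow ℓ (x 0) x₀)
      = ∑ j ∈ J, h (flow ℓ (x j) x₀) := by
    rw [visitSum_eq_sum hS, ← hF, ← Finset.sum_fiberwise_of_maps_to (s := J) (t := F)
      (g := fun j => x j - x 0)]
    · refine Finset.sum_congr rfl fun t ht => ?_
      rw [hFm, flow_flow] at ht
      have hset : (J.filter fun j => x j - x 0 = t) = (hx.finite_fiber (x 0 + t)).toFinset := by
        ext j
        rw [Finset.mem_filter, hJm, Set.Finite.mem_toFinset]
        constructor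
        · rintro ⟨_, h2⟩; change x j = _; linarith
        · intro h2
          have h2 : x j = x 0 + t := h2
          rw [h2]
          exact ⟨⟨by linarith [ht.1.1], by linarith [ht.1.2]⟩, by ring⟩
      have hcard : (J.filter fun j => x j - x 0 = t).card = w (flow ℓ (x 0 + t) x₀) := by
        rw [hset]
        have := hx.encard_of_mem _ ht.2
        rw [(hx.finite_fiber (x 0 + t)).encard_eq_coe_toFinset_card] at this
        exact_mod_cast this
      rw [flow_flow, ← hcard, ← nsmul_eq_mul, ← Finset.sum_const]
      refine Finset.sum_congr rfl fun j hj => ?_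
      rw [Finset.mem_filter] at hj
      rw [← hj.2]; congr 2; ring
    · intro j hj
      rw [hJm] at hj
      rw [hFm, flow_flow]
      exact ⟨⟨by linarith [hj.1], by linarith [hj.2]⟩, by simpa using hx.mem j⟩
  have e2 : ∑ j ∈ Finset.Icc 1 N, h (flow ℓ (x (j : ℤ)) x₀) =
      ∑ j ∈ Finset.Icc (1 : ℤ) N, h (flow ℓ (x j) x₀) := by
    refine Finset.sum_bij (fun j _ => (j : ℤ)) ?_ ?_ ?_ (fun _ _ => rfl)
    · intro j hj
      rw [Finset.mem_Icc] at hj ⊢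
      exact ⟨by exact_mod_cast hj.1, by exact_mod_cast hj.2⟩
    · intro a _ b _ hab; exact_mod_cast hab
    · intro j hj
      rw [Finset.mem_Icc] at hj
      refine ⟨j.toNat, ?_, Int.toNat_of_nonneg (by omega)⟩
      rw [Finset.mem_Icc]; omega
  have hfiber : ∀ (j₀ : ℤ) (A : Finset ℤ), (∀ j ∈ A, x j = x j₀) →
      ‖∑ j ∈ A, h (flow ℓ (x j) x₀)‖ ≤ W * |C| := by
    intro j₀ A hA
    refine (norm_sum_le_of_le _ (n := fun _ => |C|)
      fun j _ => (hb _ (hx.mem j)).trans (le_abs_self C)).trans ?_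
    rw [Finset.sum_const, nsmul_eq_mul]
    have hc : A.card ≤ W := by
      refine le_trans ?_ (hW _ (hx.mem j₀))
      have h1 := hx.encard_of_mem _ (hx.mem j₀)
      have h2 : (A : Set ℤ).encard ≤ {j : ℤ | x j = x j₀}.encard :=
        Set.encard_le_encard fun j hj => hA j hj
      rw [h1, Set.encard_coe_eq_coe_finsetCard] at h2
      exact_mod_cast h2
    gcongr
  rw [e1, e2, ← Finset.sum_sdiff_sub_sum_sdiff]
  refine (norm_sub_le _ _).trans ?_
  have h1 := hfiber 0 (Finset.Icc (1 : ℤ) N \ J) (by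
    intro j hj
    rw [Finset.mem_sdiff, Finset.mem_Icc, hJm] at hj
    refine le_antisymm ?_ (hx.monotone (by omega))
    by_contra! h
    exact hj.2 ⟨h, hx.monotone hj.1.2⟩)
  have h2 := hfiber N (J \ Finset.Icc (1 : ℤ) N) (by
    intro j hj
    rw [Finset.mem_sdiff, Finset.mem_Icc, hJm] at hj
    refine le_antisymm hj.1.2 ?_
    by_contra! h
    have hj0 : 0 < j := by
      by_contra! hle
      exact absurd (hx.monotone hle) (not_le.2 hj.1.1)
    refine hj.2 ⟨by omega, ?_⟩
    by_contra! hle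
    exact absurd (hx.monotone hle.le) (not_le.2 h))
  linarith

/-- The averages over a listing of the visits converge to the weighted space average. -/
theorem IsVisitListing.tendsto_average (hind : LinearIndependent ℚ ℓ) (hS : IsCrossSection ℓ S)
    (hx : IsVisitListing ℓ S w x₀ x) {E : Set (Torus n)} (hE : IsClosed E) (hES : E ⊆ S)
    (hE0 : crossMeasure ℓ S E = 0) (hreg : ∀ x ∈ S, x ∉ E → IsRegularPoint ℓ S x)
    {W : ℕ} (hW : ∀ y ∈ S, w y ≤ W)
    (hwc : ∀ x ∈ S, x ∉ E → ContinuousWithinAt (fun y => (w y : ℂ)) S x)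
    (hw0 : ∫ y in S, (w y : ℂ) ∂(crossMeasure ℓ S) ≠ 0)
    {h : Torus n → ℂ} {C : ℝ} (hb : ∀ y ∈ S, ‖h y‖ ≤ C)
    (hc : ∀ x ∈ S, x ∉ E → ContinuousWithinAt h S x) :
    Tendsto (fun N : ℕ => (1 / (N : ℂ)) * ∑ j ∈ Finset.Icc 1 N, h (flow ℓ (x (j : ℤ)) x₀)) atTop
      (𝓝 (1 / (∫ y in S, (w y : ℂ) ∂(crossMeasure ℓ S)) *
        ∫ y in S, (w y : ℂ) * h y ∂(crossMeasure ℓ S))) := by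
  have hT : Tendsto (fun N : ℕ => x N - x 0) atTop atTop :=
    tendsto_atTop_add_const_right _ _ (hx.tendsto hS)
  have hpi : ((2 * π) ^ n : ℂ) ≠ 0 := by
    exact pow_ne_zero _ (mul_ne_zero two_ne_zero (by exact_mod_cast Real.pi_ne_zero))
  have key : ∀ (f : Torus n → ℂ) (D : ℝ), (∀ y ∈ S, ‖f y‖ ≤ D) →
      (∀ x ∈ S, x ∉ E → ContinuousWithinAt f S x) →
      Tendsto (fun N : ℕ => (1 / ((x N - x 0 : ℝ) : ℂ)) *
        ∑ j ∈ Finset.Icc 1 N, f (flow ℓ (x (j : ℤ)) x₀)) atTop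
        (𝓝 (1 / ((2 * π) ^ n : ℂ) * ∫ y in S, (w y : ℂ) * f y ∂(crossMeasure ℓ S))) := by
    intro f D hfb hfc
    have h1 := (tendsto_visitSum_div hind hS hE hES hE0 hreg (g := fun y => (w y : ℂ) * f y)
      (C := W * |D|) (fun y hy => by
        rw [norm_mul, Complex.norm_natCast]
        have := hW y hy
        have := (hfb y hy).trans (le_abs_self D)
        gcongr) (fun y hy hyE => (hwc y hy hyE).mul (hfc y hy hyE)) (flow ℓ (x 0) x₀)).comp hT
    have herr : Tendsto (fun N : ℕ => (1 / ((x N - x 0 : ℝ) : ℂ)) *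
        ∑ j ∈ Finset.Icc 1 N, f (flow ℓ (x (j : ℤ)) x₀) -
        (1 / ((x N - x 0 : ℝ) : ℂ)) * visitSum ℓ S (fun y => (w y : ℂ) * f y) (x N - x 0)
          (flow ℓ (x 0) x₀)) atTop (𝓝 0) := by
      refine squeeze_zero_norm' (a := fun N : ℕ => (1 / (x N - x 0)) * (2 * W * |D|)) ?_ ?_
      · filter_upwards [hT.eventually_gt_atTop 0] with N hN
        rw [← mul_sub, norm_mul]
        have h2 : ‖(1 / ((x N - x 0 : ℝ) : ℂ))‖ = 1 / (x N - x 0) := by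
          rw [norm_div, Complex.norm_real, Real.norm_eq_abs, abs_of_pos hN, norm_one]
        rw [h2]
        gcongr
        exact hx.norm_sum_sub_le hS hW hfb N
      · simpa using (tendsto_const_nhds (x := (1 : ℝ)).div_atTop hT).mul_const (2 * W * |D|)
    simpa using herr.add h1
  have h1 := key h C hb hc
  have h2 := key (fun _ => 1) 1 (by simp) (fun _ _ _ => continuousWithinAt_const)
  simp only [mul_one] at h2
  -- the quotient of the averages for `h` and for the constant function one
  have h3 := h1.div h2 (mul_ne_zero (one_div_ne_zero hpi) hw0)
  have e : (1 / ((2 * π) ^ n : ℂ) * ∫ y in S, (w y : ℂ) * h y ∂(crossMeasure ℓ S)) /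
      (1 / ((2 * π) ^ n : ℂ) * ∫ y in S, (w y : ℂ) ∂(crossMeasure ℓ S)) =
      1 / (∫ y in S, (w y : ℂ) ∂(crossMeasure ℓ S)) *
        ∫ y in S, (w y : ℂ) * h y ∂(crossMeasure ℓ S) := by
    field_simp
  rw [e] at h3
  refine h3.congr' ?_
  filter_upwards [eventually_ge_atTop 1, hT.eventually_gt_atTop 0] with N hN hTN
  have hT0 : ((x N - x 0 : ℝ) : ℂ) ≠ 0 := by exact_mod_cast hTN.ne'
  have hN0 : (N : ℂ) ≠ 0 := by exact_mod_cast (by omega : N ≠ 0)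
  simp only [Pi.div_apply, Finset.sum_const, Nat.card_Icc, add_tsub_cancel_right, nsmul_eq_mul,
    mul_one]
  field_simp

end Averages

/-- A locally finite set of reals, unbounded in both directions, can be listed in increasing order
over `ℤ` with prescribed positive multiplicities. -/
theorem exists_monotone_listing {Z : Set ℝ} {w : ℝ → ℕ} (hfin : ∀ a b, (Z ∩ Set.Icc a b).Finite)
    (hgt : ∀ a, ∃ t ∈ Z, a < t) (hlt : ∀ a, ∃ t ∈ Z, t < a) (hw : ∀ t ∈ Z, 0 < w t) :
    ∃ x : ℤ → ℝ, Monotone x ∧ (∀ j, x j ∈ Z) ∧ ∀ t ∈ Z, {j | x j = t}.encard = w t := by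
  classical
  -- pairs (point, index of the repetition), in lexicographic order, are isomorphic to `ℤ`
  let Y := {z : ℝ ×ₗ ℕ // (ofLex z).1 ∈ Z ∧ (ofLex z).2 < w (ofLex z).1}
  have hIcc : ∀ a b : Y, (Set.Icc a b).Finite := by
    intro a b
    have hf : (⋃ t ∈ Z ∩ Set.Icc (ofLex a.1).1 (ofLex b.1).1,
        (fun k : ℕ => toLex (t, k)) '' (Set.Iio (w t))).Finite :=
      (hfin _ _).biUnion fun t _ => (Set.finite_Iio _).image _
    refine (hf.preimage (f := (Subtype.val : Y → ℝ ×ₗ ℕ))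
      Subtype.val_injective.injOn).subset fun z hz => ?_
    refine Set.mem_biUnion (x := (ofLex z.1).1)
      ⟨z.2.1, Prod.Lex.monotone_fst _ _ hz.1, Prod.Lex.monotone_fst _ _ hz.2⟩ ?_
    exact ⟨(ofLex z.1).2, z.2.2, rfl⟩
  let i1 : LocallyFiniteOrder Y := LocallyFiniteOrder.ofFiniteIcc hIcc
  let i2 : SuccOrder Y := LinearLocallyFiniteOrder.succOrder Y
  let i3 : PredOrder Y := LinearLocallyFiniteOrder.predOrder Y
  have i4 : NoMaxOrder Y := ⟨fun a => by
    obtain ⟨t, ht, hat⟩ := hgt (ofLex a.1).1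
    exact ⟨⟨toLex (t, 0), ht, hw t ht⟩, Prod.Lex.lt_iff.2 (Or.inl hat)⟩⟩
  have i5 : NoMinOrder Y := ⟨fun a => by
    obtain ⟨t, ht, hat⟩ := hlt (ofLex a.1).1
    exact ⟨⟨toLex (t, 0), ht, hw t ht⟩, Prod.Lex.lt_iff.2 (Or.inl hat)⟩⟩
  have i6 : Nonempty Y := by
    obtain ⟨t, ht, _⟩ := hgt 0
    exact ⟨⟨toLex (t, 0), ht, hw t ht⟩⟩
  let e : Y ≃o ℤ := orderIsoIntOfLinearSuccPredArch
  refine ⟨fun j => (ofLex (e.symm j).1).1, fun a b hab =>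
    Prod.Lex.monotone_fst _ _ (e.symm.monotone hab), fun j => (e.symm j).2.1, fun t ht => ?_⟩
  have hset : {j | (ofLex (e.symm j).1).1 = t} =
      e '' ((fun k : Fin (w t) => (⟨toLex (t, k), ht, k.2⟩ : Y)) '' Set.univ) := by
    ext j
    constructor
    · intro hj
      have hj : (ofLex (e.symm j).1).1 = t := hj
      have h2 := (e.symm j).2.2
      rw [hj] at h2
      refine ⟨e.symm j, ⟨⟨(ofLex (e.symm j).1).2, h2⟩, trivial, ?_⟩, by simp⟩
      apply Subtype.ext
      exact congrArg (fun s => toLex (s, (ofLex (e.symm j).1).2)) hj.symm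
    · rintro ⟨_, ⟨k, -, rfl⟩, rfl⟩
      simp
  rw [hset, e.injective.encard_image, Function.Injective.encard_image]
  · simp
  · intro a b hab
    have := congrArg (fun z : Y => (ofLex z.1).2) hab
    exact Fin.ext this

theorem exists_isVisitListing {n : ℕ} {ℓ : Fin n → ℝ} {S : Set (Torus n)}
    (hS : IsCrossSection ℓ S) {w : Torus n → ℕ} (hw : ∀ y ∈ S, 0 < w y) (x₀ : Torus n) :
    ∃ x, IsVisitListing ℓ S w x₀ x := by
  obtain ⟨x, h1, h2, h3⟩ := exists_monotone_listing (Z := {t | flow ℓ t x₀ ∈ S})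
    (w := fun t => w (flow ℓ t x₀)) (fun a b => (hS.finite_hits x₀ (a - 1) b).subset
      fun t ht => ⟨⟨by linarith [ht.2.1], ht.2.2⟩, ht.1⟩)
    (fun a => by obtain ⟨t, ht, htS⟩ := hS.exists_gt x₀ a; exact ⟨t, htS, ht⟩)
    (fun a => by obtain ⟨t, ht, htS⟩ := hS.exists_lt x₀ a; exact ⟨t, htS, ht⟩)
    (fun t ht => hw _ ht)
  exact ⟨x, h1, h3, h2⟩

end

section

/-! ### Persistence of zeros -/

/-- **Hurwitz's theorem**: zeros of a holomorphic function that does not vanish identically persist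
under perturbations. -/
theorem eventually_exists_zero {Y : Type*} [TopologicalSpace Y] {F : Y → ℂ → ℂ}
    (hF : Continuous fun z : Y × ℂ => F z.1 z.2) (hd : ∀ y, Differentiable ℂ (F y)) {y₀ : Y} {c : ℂ}
    (h0 : F y₀ c = 0) (hne : ∃ w, F y₀ w ≠ 0) {r : ℝ} (hr : 0 < r) :
    ∀ᶠ y in 𝓝 y₀, ∃ w ∈ Metric.ball c r, F y w = 0 := by
  have han : AnalyticOnNhd ℂ (F y₀) Set.univ := fun w _ => (hd y₀).analyticAt w
  have hev : ∀ᶠ w in 𝓝[≠] c, F y₀ w ≠ 0 := by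
    refine (han c trivial).eventually_eq_zero_or_eventually_ne_zero.resolve_left fun hz => ?_
    obtain ⟨w, hw⟩ := hne
    refine hw ?_
    have := han.eqOn_zero_of_preconnected_of_eventuallyEq_zero isPreconnected_univ
      (Set.mem_univ c) hz
    exact this (Set.mem_univ w)
  obtain ⟨ε, hε, hεne⟩ := Metric.eventually_nhds_iff.1 (eventually_nhdsWithin_iff.1 hev)
  set ρ := min (ε / 2) (r / 2) with hρdef
  have hρ : 0 < ρ := lt_min (by positivity) (by positivity)
  have hρε : ρ < ε := (min_le_left _ _).trans_lt (by linarith)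
  have hρr : ρ < r := (min_le_right _ _).trans_lt (by linarith)
  have hsph : ∀ w ∈ Metric.sphere c ρ, F y₀ w ≠ 0 := fun w hw =>
    hεne (by rw [Metric.mem_sphere.1 hw]; exact hρε) (by
      rintro rfl; simp at hw; linarith)
  -- on a small circle `|F|` stays above `m / 2`, while it is small at the centre; without zeros
  -- this would contradict the maximum principle for `1 / F`
  obtain ⟨w₁, hw₁, hmin⟩ := (isCompact_sphere c ρ).exists_isMinOn
    (NormedSpace.sphere_nonempty.2 hρ.le) (hd y₀).continuous.norm.continuousOn
  set m := ‖F y₀ w₁‖ with hm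
  have hmpos : 0 < m := norm_pos_iff.2 (hsph w₁ hw₁)
  have e1 : ∀ᶠ y in 𝓝 y₀, ∀ w ∈ Metric.sphere c ρ, m / 2 < ‖F y w‖ := by
    refine (isCompact_sphere c ρ).eventually_forall_of_forall_eventually fun w hw => ?_
    refine (hF.norm.tendsto (y₀, w)).eventually (lt_mem_nhds ?_)
    have : m ≤ ‖F y₀ w‖ := hmin hw
    simp only; linarith
  have e2 : ∀ᶠ y in 𝓝 y₀, ‖F y c‖ < m / 2 := by
    have hc : Continuous fun y => ‖F y c‖ :=
      (hF.comp (continuous_id.prodMk continuous_const)).norm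
    refine (hc.tendsto y₀).eventually (gt_mem_nhds ?_)
    simp only [h0, norm_zero]; positivity
  filter_upwards [e1, e2] with y hy1 hy2
  by_contra! hcon
  have hball : ∀ w ∈ Metric.closedBall c ρ, F y w ≠ 0 := fun w hw =>
    hcon w (Metric.closedBall_subset_ball hρr hw)
  have hdc : DiffContOnCl ℂ (fun w => (F y w)⁻¹) (Metric.ball c ρ) := by
    refine DifferentiableOn.diffContOnCl fun w hw => ?_
    rw [closure_ball c hρ.ne'] at hw
    exact ((hd y).differentiableAt.inv (hball w hw)).differentiableWithinAt
  have hle := Complex.norm_le_of_forall_mem_frontier_norm_le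
    (Metric.isBounded_ball (x := c) (r := ρ))
    hdc (C := (m / 2)⁻¹) (fun w hw => by
      rw [frontier_ball c hρ.ne'] at hw
      rw [norm_inv]
      exact inv_anti₀ (by positivity) (hy1 w hw).le)
    (subset_closure (Metric.mem_ball_self hρ))
  rw [norm_inv] at hle
  have hc0 : 0 < ‖F y c‖ := norm_pos_iff.2 (hball c (Metric.mem_closedBall_self hρ.le))
  have := (inv_le_inv₀ hc0 (by positivity : 0 < m / 2)).1 hle
  linarith

/-! ### The polynomial along complex lines -/

variable {n : ℕ} {ℓ : Fin n → ℝ} {p : MvPolynomial (Fin n) ℂ} {d : Fin n → ℕ}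

theorem continuous_expI : Continuous (expI (n := n)) :=
  continuous_pi fun j =>
    continuous_subtype_val.comp (AddCircle.continuous_toCircle.comp (continuous_apply j))

theorem isClosed_zeroSet (p : MvPolynomial (Fin n) ℂ) : IsClosed (zeroSet p) :=
  isClosed_eq (p.continuous_eval.comp continuous_expI) continuous_const

@[simp] theorem norm_expI (x : Torus n) (j : Fin n) : ‖expI x j‖ = 1 := Circle.norm_coe _

theorem expI_ne_zero (x : Torus n) (j : Fin n) : expI x j ≠ 0 := Circle.coe_ne_zero _

/-- The point `exp(i(y + wℓ))` of a complex line. -/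
def linePoint (ℓ : Fin n → ℝ) (y : Torus n) (w : ℂ) : Fin n → ℂ :=
  fun j => expI y j * Complex.exp (w * ℓ j * Complex.I)

/-- The entire function `w ↦ p(exp(i(y + wℓ)))`, which extends `lineFun` to complex times. -/
def lineC (p : MvPolynomial (Fin n) ℂ) (ℓ : Fin n → ℝ) (y : Torus n) (w : ℂ) : ℂ :=
  MvPolynomial.eval (linePoint ℓ y w) p

theorem toCircle_coe (t : ℝ) :
    ((AddCircle.toCircle (t : AddCircle (2 * π)) : Circle) : ℂ) = Complex.exp (t * Complex.I) := by
  rw [AddCircle.toCircle_apply_mk, Circle.coe_exp]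
  congr 1
  have : (π : ℂ) ≠ 0 := by exact_mod_cast Real.pi_ne_zero
  push_cast
  field_simp

theorem expI_flow (t : ℝ) (y : Torus n) : expI (flow ℓ t y) = linePoint ℓ y t := by
  funext j
  simp only [expI, flow, linePoint, AddCircle.toCircle_add, Circle.coe_mul, toCircle_coe]
  push_cast; rfl

theorem linePoint_flow (s : ℝ) (y : Torus n) (w : ℂ) :
    linePoint ℓ (flow ℓ s y) w = linePoint ℓ y (s + w) := by
  funext j
  have := congrFun (expI_flow (ℓ := ℓ) s y) j
  simp only [linePoint] at this ⊢
  rw [this, mul_assoc, ← Complex.exp_add]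
  congr 2; ring

theorem lineC_ofReal (y : Torus n) (t : ℝ) : lineC p ℓ y t = lineFun p ℓ y t := by
  rw [lineFun, expI_flow, lineC]

theorem lineC_flow (s : ℝ) (y : Torus n) (w : ℂ) :
    lineC p ℓ (flow ℓ s y) w = lineC p ℓ y (s + w) := by
  rw [lineC, lineC, linePoint_flow]

theorem lineC_ofReal_eq_zero_iff {y : Torus n} {t : ℝ} :
    lineC p ℓ y t = 0 ↔ flow ℓ t y ∈ zeroSet p := by
  rw [lineC_ofReal]; rfl

theorem norm_linePoint (y : Torus n) (w : ℂ) (j : Fin n) :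
    ‖linePoint ℓ y w j‖ = Real.exp (-(w.im * ℓ j)) := by
  simp [linePoint, Complex.norm_exp]

theorem continuous_lineC : Continuous fun z : Torus n × ℂ => lineC p ℓ z.1 z.2 := by
  refine p.continuous_eval.comp (continuous_pi fun j => ?_)
  exact ((continuous_apply j).comp (continuous_expI.comp continuous_fst)).mul
    (Complex.continuous_exp.comp ((continuous_snd.mul continuous_const).mul continuous_const))

theorem differentiable_eval_comp {σ : Type*} (p : MvPolynomial σ ℂ) {f : ℂ → σ → ℂ}
    (hf : ∀ j, Differentiable ℂ fun w => f w j) :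
    Differentiable ℂ fun w => MvPolynomial.eval (f w) p := by
  simp only [MvPolynomial.eval_eq]
  fun_prop

theorem differentiable_lineC (y : Torus n) : Differentiable ℂ (lineC p ℓ y) :=
  differentiable_eval_comp p fun j => by unfold linePoint; fun_prop

theorem lineC_ne_zero (hp : p ∈ LY d) (hpos : ∀ j, 0 < ℓ j) (y : Torus n) {w : ℂ} (hw : w.im ≠ 0) :
    lineC p ℓ y w ≠ 0 := by
  rcases hw.lt_or_gt with h | h
  · refine hp.2.2 _ fun j => ?_
    rw [norm_linePoint, Real.one_lt_exp_iff]
    nlinarith [hpos j]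
  · refine hp.2.1 _ fun j => ?_
    rw [norm_linePoint, Real.exp_lt_one_iff]
    nlinarith [hpos j]

theorem im_eq_zero_of_lineC (hp : p ∈ LY d) (hpos : ∀ j, 0 < ℓ j) {y : Torus n} {w : ℂ}
    (hw : lineC p ℓ y w = 0) : w = (w.re : ℂ) := by
  by_contra hne
  refine lineC_ne_zero hp hpos y (fun him => hne ?_) hw
  exact Complex.ext rfl (by simpa using him)

/-- Zeros on a line persist, as real zeros, on all nearby lines. -/
theorem eventually_exists_hit (hp : p ∈ LY d) (hpos : ∀ j, 0 < ℓ j) {x : Torus n}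
    (hx : x ∈ zeroSet p) {r : ℝ} (hr : 0 < r) :
    ∀ᶠ y in 𝓝 x, ∃ t, |t| < r ∧ flow ℓ t y ∈ zeroSet p := by
  have h0 : lineC p ℓ x 0 = 0 := by
    have := (lineC_ofReal_eq_zero_iff (p := p) (ℓ := ℓ) (y := x) (t := 0)).2 (by simpa using hx)
    simpa using this
  filter_upwards [eventually_exists_zero continuous_lineC (fun y => differentiable_lineC y) h0
    ⟨Complex.I, lineC_ne_zero hp hpos x (by simp)⟩ hr] with y hy
  obtain ⟨w, hw, hw0⟩ := hy
  have hre := im_eq_zero_of_lineC hp hpos hw0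
  refine ⟨w.re, ?_, ?_⟩
  · rw [hre] at hw
    simpa using hw
  · rw [← lineC_ofReal_eq_zero_iff, ← hre]; exact hw0

/-- The number of zeros on a line segment of length one is bounded, by Jensen's inequality. -/
theorem exists_hits_bound (hp : p ∈ LY d) (hpos : ∀ j, 0 < ℓ j) :
    ∃ K : ℕ, ∀ x : Torus n, {t | t ∈ Set.Ioc (0 : ℝ) 1 ∧ flow ℓ t x ∈ zeroSet p}.encard ≤ K := by
  -- centre `i`, where `|p|` is bounded below; the disc of radius `2` contains the segment `(0, 1]`
  obtain ⟨y₁, -, hmin⟩ := isCompact_univ.exists_isMinOn (Set.univ_nonempty (α := Torus n))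
    ((continuous_lineC (p := p) (ℓ := ℓ)).comp
      (continuous_id.prodMk (continuous_const (y := Complex.I)))).norm.continuousOn
  set m := ‖lineC p ℓ y₁ Complex.I‖ with hm
  have hmpos : 0 < m := norm_pos_iff.2 (lineC_ne_zero hp hpos y₁ (by simp))
  obtain ⟨M₀, hM₀⟩ :=
    (isCompact_univ.prod (isCompact_sphere Complex.I 4)).exists_bound_of_continuousOn
    (continuous_lineC (p := p) (ℓ := ℓ)).continuousOn
  set M := max M₀ 1 with hM
  obtain ⟨K, hK⟩ := exists_nat_ge (Real.log (M / m) / Real.log (4 / 2))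
  refine ⟨K, fun x => ?_⟩
  have hdf := differentiable_lineC (p := p) (ℓ := ℓ) x
  have han : ∀ s, AnalyticOnNhd ℂ (lineC p ℓ x) s := fun s w _ => hdf.analyticAt w
  set D := MeromorphicOn.divisor (lineC p ℓ x) (Metric.closedBall Complex.I |(2 : ℝ)|) with hD
  have hJ := AnalyticOnNhd.sum_divisor_le (c := Complex.I) (r := 2) (R := 4) (M := M)
    (f := lineC p ℓ x) (by norm_num) (by norm_num) (le_max_right _ _) (han _)
    (lineC_ne_zero hp hpos x (by simp)) (fun z hz => (hM₀ (x, z)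
      ⟨trivial, by simpa using hz⟩).trans (le_max_left _ _))
  have hle : Real.log (M / ‖lineC p ℓ x Complex.I‖) / Real.log (4 / 2) ≤
      Real.log (M / m) / Real.log (4 / 2) := by
    have h1 : m ≤ ‖lineC p ℓ x Complex.I‖ := hmin (Set.mem_univ x)
    have h2 : 0 < Real.log (4 / 2) := Real.log_pos (by norm_num)
    have h3 : 0 < M := lt_of_lt_of_le one_pos (le_max_right _ _)
    have h4 : 0 < M / ‖lineC p ℓ x Complex.I‖ := div_pos h3 (hmpos.trans_le h1)
    gcongr
  have hsum : ∑ᶠ u, D u ≤ (K : ℤ) := by exact_mod_cast (hJ.trans hle).trans hK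
  have hfin : D.support.Finite := D.finiteSupport (isCompact_closedBall _ _)
  have hnn : ∀ u, 0 ≤ D u := fun u => MeromorphicOn.AnalyticOnNhd.divisor_nonneg (han _) u
  have hsub : (fun t : ℝ => (t : ℂ)) '' {t | t ∈ Set.Ioc (0 : ℝ) 1 ∧ flow ℓ t x ∈ zeroSet p} ⊆
      D.support := by
    rintro _ ⟨t, ⟨ht, htS⟩, rfl⟩
    have hmem : (t : ℂ) ∈ Metric.closedBall Complex.I |(2 : ℝ)| := by
      rw [Metric.mem_closedBall, dist_eq_norm, abs_of_pos two_pos]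
      refine (norm_sub_le _ _).trans ?_
      rw [Complex.norm_real, Complex.norm_I, Real.norm_eq_abs, abs_of_pos ht.1]
      linarith [ht.2]
    rw [Function.mem_support, hD, MeromorphicOn.AnalyticOnNhd.divisor_apply (han _) hmem]
    have h1 : analyticOrderAt (lineC p ℓ x) t ≠ 0 := by
      rw [(han Set.univ t trivial).analyticOrderAt_ne_zero]
      exact lineC_ofReal_eq_zero_iff.2 htS
    have h2 : analyticOrderAt (lineC p ℓ x) t ≠ ⊤ := by
      intro htop
      rw [analyticOrderAt_eq_top] at htop
      have := (han Set.univ).eqOn_zero_of_preconnected_of_eventuallyEq_zero isPreconnected_univ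
        (Set.mem_univ (t : ℂ)) htop
      exact lineC_ne_zero hp hpos x (w := Complex.I) (by simp) (this (Set.mem_univ _))
    lift analyticOrderAt (lineC p ℓ x) t to ℕ using h2 with k
    simpa using h1
  have hcard : (hfin.toFinset.card : ℤ) ≤ K := by
    refine le_trans ?_ hsum
    rw [finsum_eq_sum_of_support_subset D (s := hfin.toFinset) (by simp)]
    rw [Finset.cast_card]
    refine Finset.sum_le_sum fun u hu => ?_
    rw [Set.Finite.mem_toFinset, Function.mem_support] at hu
    have := hnn u
    omega
  have h1 := Set.encard_le_encard hsub
  rw [Complex.ofReal_injective.encard_image, hfin.encard_eq_coe_toFinset_card] at h1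
  refine h1.trans ?_
  exact_mod_cast hcard

end

section

/-! ### The reversed polynomial -/

variable {n : ℕ} {ℓ : Fin n → ℝ} {p : MvPolynomial (Fin n) ℂ} {d : Fin n → ℕ}

/-- The reversed polynomial `z^d p(1/z)`. -/
def revPoly (d : Fin n → ℕ) (p : MvPolynomial (Fin n) ℂ) : MvPolynomial (Fin n) ℂ :=
  ∑ k ∈ p.support, MvPolynomial.monomial (Finsupp.equivFunOnFinite.symm d - k) (p.coeff k)

theorem eval_revPoly_eq_sum (d : Fin n → ℕ) (p : MvPolynomial (Fin n) ℂ) (z : Fin n → ℂ) :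
    MvPolynomial.eval z (revPoly d p) = ∑ k ∈ p.support, p.coeff k * ∏ j, z j ^ (d j - k j) := by
  rw [revPoly, map_sum]
  refine Finset.sum_congr rfl fun k _ => ?_
  rw [MvPolynomial.eval_monomial, Finsupp.prod_fintype _ _ fun _ => pow_zero _]
  rfl

theorem ne_zero_of_mem_LY (hp : p ∈ LY d) : p ≠ 0 := by
  rintro rfl
  exact hp.2.1 0 (by simp) (by simp)

theorem le_of_mem_support (hp : p ∈ LY d) {k : Fin n →₀ ℕ} (hk : k ∈ p.support) (j : Fin n) :
    k j ≤ d j :=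
  MvPolynomial.degreeOf_le_iff.1 (hp.1 j).le k hk

theorem exists_mem_support (hp : p ∈ LY d) (j : Fin n) : ∃ k ∈ p.support, k j = d j := by
  obtain ⟨k, hk, hk'⟩ := Finset.exists_mem_eq_sup p.support
    (MvPolynomial.support_nonempty.2 (ne_zero_of_mem_LY hp)) fun m => m j
  exact ⟨k, hk, by rw [← hk', ← MvPolynomial.degreeOf_eq_sup, hp.1]⟩

theorem eval_revPoly (hp : p ∈ LY d) {z : Fin n → ℂ} (hz : ∀ j, z j ≠ 0) :
    MvPolynomial.eval z (revPoly d p) =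
      (∏ j, z j ^ d j) * MvPolynomial.eval (fun j => (z j)⁻¹) p := by
  rw [eval_revPoly_eq_sum, MvPolynomial.eval_eq', Finset.mul_sum]
  refine Finset.sum_congr rfl fun k hk => ?_
  rw [mul_left_comm, ← Finset.prod_mul_distrib]
  congr 1
  refine Finset.prod_congr rfl fun j _ => ?_
  rw [pow_sub₀ _ (hz j) (le_of_mem_support hp hk j), inv_pow]

/-- The reversed polynomial is not divisible by a coordinate: its restriction to a coordinate
hyperplane does not vanish on a product of infinite sets. -/
theorem not_forall_eval_revPoly_update (hp : p ∈ LY d) (a : Fin n) {s : Fin n → Set ℂ}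
    (hs : ∀ j, (s j).Infinite)
    (h : ∀ z ∈ Set.univ.pi s, MvPolynomial.eval (Function.update z a 0) (revPoly d p) = 0) :
    False := by
  -- the part of the reversed polynomial that is free of `z_a`
  set Q : MvPolynomial (Fin n) ℂ := ∑ k ∈ p.support with k a = d a,
    MvPolynomial.monomial (Finsupp.equivFunOnFinite.symm d - k) (p.coeff k) with hQ
  have hQ0 : Q = 0 := by
    refine MvPolynomial.funext_set s hs fun z hz => ?_
    rw [map_zero, ← h z hz, eval_revPoly_eq_sum, hQ, map_sum, Finset.sum_filter]
    refine Finset.sum_congr rfl fun k hk => ?_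
    split_ifs with hka
    · rw [MvPolynomial.eval_monomial, Finsupp.prod_fintype _ _ fun _ => pow_zero _]
      congr 1
      refine Finset.prod_congr rfl fun j _ => ?_
      rcases eq_or_ne j a with rfl | hj
      · have : (Finsupp.equivFunOnFinite.symm d - k) j = 0 := by simp [hka]
        rw [this, hka]; simp
      · rw [Function.update_of_ne hj]; rfl
    · rw [Finset.prod_eq_zero (Finset.mem_univ a), mul_zero]
      rw [Function.update_self, zero_pow]
      have := le_of_mem_support hp hk a
      omega
  obtain ⟨k₀, hk₀, hk₀a⟩ := exists_mem_support hp a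
  have hc : Q.coeff (Finsupp.equivFunOnFinite.symm d - k₀) = p.coeff k₀ := by
    rw [hQ, MvPolynomial.coeff_sum, Finset.sum_eq_single k₀]
    · simp
    · intro k hk hne
      rw [MvPolynomial.coeff_monomial, if_neg]
      intro heq
      refine hne (Finsupp.ext fun j => ?_)
      have h1 := DFunLike.congr_fun heq j
      have h2 := le_of_mem_support hp (Finset.mem_filter.1 hk).1 j
      have h3 := le_of_mem_support hp hk₀ j
      simp only [Finsupp.tsub_apply, Finsupp.equivFunOnFinite_symm_apply_apply] at h1
      omega
    · intro hk
      exact absurd (Finset.mem_filter.2 ⟨hk₀, hk₀a⟩) hk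
  rw [hQ0, MvPolynomial.coeff_zero] at hc
  exact MvPolynomial.mem_support_iff.1 hk₀ hc.symm

/-- The reversed polynomial has no zeros in the open polydisc. On the part where no coordinate
vanishes this is the definition; the coordinates are then allowed to vanish one after the other,
a new zero being excluded by Hurwitz's theorem. -/
theorem eval_revPoly_ne_zero (hp : p ∈ LY d) {z : Fin n → ℂ} (hz : ∀ j, ‖z j‖ < 1) :
    MvPolynomial.eval z (revPoly d p) ≠ 0 := by
  have base : ∀ z : Fin n → ℂ, (∀ j, ‖z j‖ < 1) → (∀ j, z j ≠ 0) →
      MvPolynomial.eval z (revPoly d p) ≠ 0 := by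
    intro z hz hz0
    rw [eval_revPoly hp hz0]
    refine mul_ne_zero (Finset.prod_ne_zero_iff.2 fun j _ => pow_ne_zero _ (hz0 j))
      (hp.2.2 _ fun j => ?_)
    rw [norm_inv]
    exact (one_lt_inv₀ (norm_pos_iff.2 (hz0 j))).2 (hz j)
  -- induction on the set of coordinates that are allowed to vanish
  suffices H : ∀ s : Finset (Fin n), ∀ z : Fin n → ℂ, (∀ j, ‖z j‖ < 1) → (∀ j, z j = 0 → j ∈ s) →
      MvPolynomial.eval z (revPoly d p) ≠ 0 from
    H Finset.univ z hz fun _ _ => Finset.mem_univ _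
  intro s
  induction s using Finset.induction_on with
  | empty => exact fun z hz h0 => base z hz fun j hj => absurd (h0 j hj) (Finset.notMem_empty j)
  | insert a s ha ih =>
    intro z hz h0 hzero
    rcases ne_or_eq (z a) 0 with hza | hza
    · refine ih z hz (fun j hj => ?_) hzero
      rcases Finset.mem_insert.1 (h0 j hj) with rfl | h
      · exact absurd hj hza
      · exact h
    have hupd : ∀ z' : Fin n → ℂ, (∀ j, ‖z' j‖ < 1) → ∀ w : ℂ, ‖w‖ < 1 →
        ∀ j, ‖Function.update z' a w j‖ < 1 := by
      intro z' hz' w hw j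
      rcases eq_or_ne j a with rfl | hj
      · simpa using hw
      · simpa [Function.update_of_ne hj] using hz' j
    have hFc : Continuous fun q : (Fin n → ℂ) × ℂ =>
        MvPolynomial.eval (Function.update q.1 a q.2) (revPoly d p) :=
      (MvPolynomial.continuous_eval _).comp (continuous_fst.update a continuous_snd)
    have hFd : ∀ z' : Fin n → ℂ, Differentiable ℂ fun w =>
        MvPolynomial.eval (Function.update z' a w) (revPoly d p) := by
      refine fun z' => differentiable_eval_comp _ fun j => ?_
      rcases eq_or_ne j a with rfl | hj
      · simp
      · simp [Function.update_of_ne hj]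
    have hne : MvPolynomial.eval (Function.update z a (1 / 2)) (revPoly d p) ≠ 0 := by
      refine ih _ (hupd z hz _ (by norm_num)) fun j hj => ?_
      rcases eq_or_ne j a with rfl | hja
      · norm_num at hj
      · rw [Function.update_of_ne hja] at hj
        exact (Finset.mem_insert.1 (h0 j hj)).resolve_left hja
    have hupd0 : Function.update z a 0 = z := by rw [← hza, Function.update_eq_self]
    have hev := eventually_exists_zero (F := fun (z' : Fin n → ℂ) w =>
      MvPolynomial.eval (Function.update z' a w) (revPoly d p)) hFc hFd (y₀ := z) (c := 0)
      (by simp only [hupd0, hzero]) ⟨_, hne⟩ one_pos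
    obtain ⟨ε, hε, hball⟩ := Metric.eventually_nhds_iff.1 hev
    -- nearby, where the other coordinates do not vanish, the zero must have `z_a = 0`
    refine not_forall_eval_revPoly_update hp a
      (s := fun j => (Metric.ball (z j) ε ∩ Metric.ball 0 1) \ {0}) (fun j => ?_) fun z' hz' => ?_
    · refine Set.Infinite.sdiff ?_ (Set.finite_singleton 0)
      exact infinite_of_mem_nhds (z j) (inter_mem (Metric.ball_mem_nhds _ hε)
        (Metric.isOpen_ball.mem_nhds (by simpa using hz j)))
    · have hz'' : ∀ j, dist (z' j) (z j) < ε ∧ ‖z' j‖ < 1 ∧ z' j ≠ 0 := fun j => by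
        have := hz' j trivial
        simpa [and_assoc] using this
      obtain ⟨w, hw, hw0⟩ := hball ((dist_pi_lt_iff hε).2 fun j => (hz'' j).1)
      rw [mem_ball_zero_iff] at hw
      rcases eq_or_ne w 0 with rfl | hwne
      · exact hw0
      · refine absurd hw0 (base _ (hupd z' (fun j => (hz'' j).2.1) w hw) fun j => ?_)
        rcases eq_or_ne j a with rfl | hj
        · simpa using hwne
        · rw [Function.update_of_ne hj]; exact (hz'' j).2.2

/-! ### Zero sets are cross-sections -/

/-- The polynomial in one variable `p(w, …, w)` is not constant, for otherwise the reversed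
polynomial would vanish at the origin. Its roots lie on the unit circle. -/
theorem zeroSet_nonempty (hp : p ∈ LY d) (hd : d ≠ 0) : (zeroSet p).Nonempty := by
  set q : Polynomial ℂ := MvPolynomial.aeval (fun _ => Polynomial.X) p with hq
  have hqe : ∀ w : ℂ, q.eval w = MvPolynomial.eval (fun _ => w) p := by
    intro w
    rw [hq, ← Polynomial.coe_evalRingHom, MvPolynomial.aeval_def, MvPolynomial.hom_eval₂]
    simp only [Polynomial.coe_evalRingHom, Polynomial.eval_X, MvPolynomial.eval]
    rw [MvPolynomial.coe_eval₂Hom]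
    congr 1
    ext
    simp
  have hdeg : 0 < q.degree := by
    by_contra hcon
    have hC := Polynomial.eq_C_of_degree_le_zero (not_lt.1 hcon)
    have hconst : ∀ w : ℂ, MvPolynomial.eval (fun _ => w) p = q.coeff 0 := fun w => by
      rw [← hqe, hC]; simp
    have heq : (fun w : ℂ => MvPolynomial.eval (fun _ => w) (revPoly d p)) =
        fun w => (∏ j, w ^ d j) * q.coeff 0 := by
      refine Continuous.ext_on (dense_compl_singleton (0 : ℂ))
        ((MvPolynomial.continuous_eval _).comp (continuous_pi fun _ => continuous_id))
        (by fun_prop) fun w hw => ?_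
      rw [eval_revPoly hp fun _ => hw, hconst]
    refine eval_revPoly_ne_zero hp (z := fun _ => 0) (by simp) ?_
    refine (congrFun heq 0).trans ?_
    obtain ⟨j, hj⟩ := Function.ne_iff.1 hd
    rw [Finset.prod_eq_zero (Finset.mem_univ j) (zero_pow hj), zero_mul]
  obtain ⟨w, hw⟩ := Complex.exists_root hdeg
  rw [Polynomial.IsRoot, hqe] at hw
  have hnorm : ‖w‖ = 1 := by
    rcases lt_trichotomy ‖w‖ 1 with h | h | h
    · exact absurd hw (hp.2.1 _ fun _ => h)
    · exact h
    · exact absurd hw (hp.2.2 _ fun _ => h)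
  refine ⟨fun _ => (w.arg : AddCircle (2 * π)), ?_⟩
  have : expI (n := n) (fun _ => (w.arg : AddCircle (2 * π))) = fun _ => w := by
    funext j
    rw [expI, toCircle_coe]
    have := Complex.norm_mul_exp_arg_mul_I w
    rwa [hnorm, Complex.ofReal_one, one_mul] at this
  change MvPolynomial.eval _ p = 0
  rw [this]; exact hw

/-- A nonempty zero set meets every line again and again, in both directions, because zeros persist
and all lines are dense; it does so with bounded density. -/
theorem isCrossSection_zeroSet (hp : p ∈ LY d) (hpos : ∀ j, 0 < ℓ j)
    (hind : LinearIndependent ℚ ℓ) (hne : (zeroSet p).Nonempty) :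
    IsCrossSection ℓ (zeroSet p) := by
  obtain ⟨x₀, hx₀⟩ := hne
  obtain ⟨U, hU, hUo, hxU⟩ := eventually_nhds_iff.1 (eventually_exists_hit hp hpos hx₀ one_pos)
  refine ⟨isClosed_zeroSet p, fun x a => ?_, fun x a => ?_, exists_hits_bound hp hpos⟩
  · obtain ⟨t, ht, htU⟩ := exists_flow_mem hind hUo ⟨x₀, hxU⟩ x (a + 1)
    obtain ⟨s, hs, hsS⟩ := hU _ htU
    rw [flow_flow] at hsS
    exact ⟨t + s, by linarith [(abs_lt.1 hs).1], hsS⟩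
  · obtain ⟨t, ht, htU⟩ := exists_flow_mem_neg hind hUo ⟨x₀, hxU⟩ x (a - 1)
    obtain ⟨s, hs, hsS⟩ := hU _ htU
    rw [flow_flow] at hsS
    exact ⟨t + s, by linarith [(abs_lt.1 hs).2], hsS⟩

end

section

/-! ### Differentiation along the flow -/

variable {n : ℕ} {ℓ : Fin n → ℝ} {p : MvPolynomial (Fin n) ℂ} {d : Fin n → ℕ}

/-- The derivation `∑ i ℓ_j z_j ∂_j`: differentiation along the flow. -/
def lineDeriv (ℓ : Fin n → ℝ) :
    Derivation ℂ (MvPolynomial (Fin n) ℂ) (MvPolynomial (Fin n) ℂ) :=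
  MvPolynomial.mkDerivation ℂ fun j =>
    MvPolynomial.C (Complex.I * ℓ j) * MvPolynomial.X j

theorem hasDerivAt_lineC (p : MvPolynomial (Fin n) ℂ) (y : Torus n) (w : ℂ) :
    HasDerivAt (lineC p ℓ y) (lineC (lineDeriv ℓ p) ℓ y w) w := by
  induction p using MvPolynomial.induction_on with
  | C a =>
    rw [lineDeriv, MvPolynomial.derivation_C]
    have h : lineC (MvPolynomial.C a) ℓ y = fun _ => a := by funext w; simp [lineC]
    rw [h]
    simpa [lineC] using hasDerivAt_const w a
  | add p q hp hq =>
    have h : lineC (p + q) ℓ y = fun w => lineC p ℓ y w + lineC q ℓ y w := by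
      funext w; simp [lineC]
    rw [h, map_add, lineC, map_add]
    exact hp.fun_add hq
  | mul_X p j hp =>
    have hj : HasDerivAt (fun w => linePoint ℓ y w j)
        (Complex.I * ℓ j * linePoint ℓ y w j) w := by
      have h1 : HasDerivAt (fun w : ℂ => w * ℓ j * Complex.I) (ℓ j * Complex.I) w := by
        simpa using ((hasDerivAt_id w).mul_const (ℓ j : ℂ)).mul_const Complex.I
      refine (h1.cexp.const_mul (expI y j)).congr_deriv ?_
      simp only [linePoint]; ring
    have h2 := hp.fun_mul hj
    refine (h2.congr_deriv ?_).congr_of_eventuallyEq (Eventually.of_forall fun u => ?_)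
    · simp only [lineC, Derivation.leibniz, map_add, smul_eq_mul, map_mul, MvPolynomial.eval_X]
      rw [lineDeriv, MvPolynomial.mkDerivation_X]
      simp only [map_mul, MvPolynomial.eval_C, MvPolynomial.eval_X]
      ring
    · simp [lineC]

theorem iteratedDeriv_lineC (p : MvPolynomial (Fin n) ℂ) (y : Torus n) (i : ℕ) :
    iteratedDeriv i (lineC p ℓ y) = lineC ((lineDeriv ℓ)^[i] p) ℓ y := by
  induction i generalizing p with
  | zero => simp
  | succ i ih =>
    rw [iteratedDeriv_succ', (funext fun w => (hasDerivAt_lineC p y w).deriv :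
      deriv (lineC p ℓ y) = lineC (lineDeriv ℓ p) ℓ y), ih, Function.iterate_succ_apply]

theorem hasDerivAt_lineFun (p : MvPolynomial (Fin n) ℂ) (y : Torus n) (t : ℝ) :
    HasDerivAt (lineFun p ℓ y) (lineFun (lineDeriv ℓ p) ℓ y t) t := by
  have h := (hasDerivAt_lineC (ℓ := ℓ) p y t).comp_ofReal
  simpa only [lineC_ofReal] using h

theorem iteratedDeriv_lineFun (p : MvPolynomial (Fin n) ℂ) (y : Torus n) (i : ℕ) :
    iteratedDeriv i (lineFun p ℓ y) = lineFun ((lineDeriv ℓ)^[i] p) ℓ y := by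
  induction i generalizing p with
  | zero => simp
  | succ i ih =>
    rw [iteratedDeriv_succ', (funext fun w => (hasDerivAt_lineFun p y w).deriv :
      deriv (lineFun p ℓ y) = lineFun (lineDeriv ℓ p) ℓ y), ih, Function.iterate_succ_apply]

theorem analyticAt_lineC (p : MvPolynomial (Fin n) ℂ) (y : Torus n) (w : ℂ) :
    AnalyticAt ℂ (lineC p ℓ y) w := (differentiable_lineC y).analyticAt w

theorem analyticAt_lineFun (p : MvPolynomial (Fin n) ℂ) (y : Torus n) (t : ℝ) :
    AnalyticAt ℝ (lineFun p ℓ y) t := by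
  have h := ((analyticAt_lineC (ℓ := ℓ) p y t).restrictScalars (𝕜 := ℝ)).comp_of_eq
    (Complex.ofRealCLM.analyticAt t) (by simp)
  refine h.congr (Eventually.of_forall fun s => ?_)
  exact lineC_ofReal y s

theorem le_analyticOrderAt_lineC {y : Torus n} {t : ℝ} {k : ℕ} :
    (k : ℕ∞) ≤ analyticOrderAt (lineC p ℓ y) t ↔
      ∀ i < k, flow ℓ t y ∈ zeroSet ((lineDeriv ℓ)^[i] p) := by
  rw [natCast_le_analyticOrderAt_iff_iteratedDeriv_eq_zero (analyticAt_lineC p y t)]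
  simp only [iteratedDeriv_lineC, lineC_ofReal_eq_zero_iff]

theorem le_analyticOrderAt_lineFun {y : Torus n} {t : ℝ} {k : ℕ} :
    (k : ℕ∞) ≤ analyticOrderAt (lineFun p ℓ y) t ↔
      ∀ i < k, flow ℓ t y ∈ zeroSet ((lineDeriv ℓ)^[i] p) := by
  rw [natCast_le_analyticOrderAt_iff_iteratedDeriv_eq_zero (analyticAt_lineFun p y t)]
  simp only [iteratedDeriv_lineFun]; rfl

theorem eq_of_forall_natCast_le_iff {a b : ℕ∞} (h : ∀ k : ℕ, (k : ℕ∞) ≤ a ↔ (k : ℕ∞) ≤ b) :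
    a = b :=
  le_antisymm (ENat.forall_natCast_le_iff_le.1 fun k => (h k).1)
    (ENat.forall_natCast_le_iff_le.1 fun k => (h k).2)

/-! ### Multiplicity -/

/-- The Taylor polynomial of `p` at a point. -/
def taylorAt (p : MvPolynomial (Fin n) ℂ) (a : Fin n → ℂ) : MvPolynomial (Fin n) ℂ :=
  MvPolynomial.bind₁ (fun j => MvPolynomial.X j + MvPolynomial.C (a j)) p

theorem eval_taylorAt (p : MvPolynomial (Fin n) ℂ) (a u : Fin n → ℂ) :
    MvPolynomial.eval u (taylorAt p a) = MvPolynomial.eval (u + a) p := by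
  have := MvPolynomial.aeval_bind₁ (R := ℂ) (S := ℂ) u
    (fun j => MvPolynomial.X j + MvPolynomial.C (a j)) p
  simpa [taylorAt, MvPolynomial.aeval_eq_eval, Pi.add_def] using this

theorem taylorAt_ne_zero (hp : p ≠ 0) (a : Fin n → ℂ) : taylorAt p a ≠ 0 := by
  intro h
  refine hp (MvPolynomial.funext fun z => ?_)
  have := eval_taylorAt p a (z - a)
  rw [h] at this
  simpa using this.symm

/-- `P(εz) / ε^m`, for a polynomial `P` all of whose terms have degree at least `m`; for `ε = 0`
this is the value of the homogeneous part of degree `m`. -/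
def scaledEval (P : MvPolynomial (Fin n) ℂ) (m : ℕ) (ε : ℂ) (z : Fin n → ℂ) : ℂ :=
  ∑ α ∈ P.support, P.coeff α * ε ^ (α.degree - m) * ∏ j, z j ^ α j

theorem continuous_scaledEval (P : MvPolynomial (Fin n) ℂ) (m : ℕ) :
    Continuous fun q : ℂ × (Fin n → ℂ) => scaledEval P m q.1 q.2 := by
  unfold scaledEval; fun_prop

theorem differentiable_scaledEval (P : MvPolynomial (Fin n) ℂ) (m : ℕ) {e : ℂ → ℂ}
    (he : Differentiable ℂ e) {f : ℂ → Fin n → ℂ} (hf : ∀ j, Differentiable ℂ fun w => f w j) :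
    Differentiable ℂ fun w => scaledEval P m (e w) (f w) := by
  unfold scaledEval; fun_prop

theorem prod_mul_pow_eq (α : Fin n →₀ ℕ) (c : ℂ) (z : Fin n → ℂ) :
    ∏ j, (c * z j) ^ α j = c ^ α.degree * ∏ j, z j ^ α j := by
  simp only [mul_pow]
  rw [Finset.prod_mul_distrib, Finset.prod_pow_eq_pow_sum, Finsupp.degree_eq_sum]

theorem eval_mul_eq_scaledEval {P : MvPolynomial (Fin n) ℂ} {m : ℕ}
    (hm : ∀ α ∈ P.support, m ≤ α.degree) (ε : ℂ) (z : Fin n → ℂ) :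
    MvPolynomial.eval (fun j => ε * z j) P = ε ^ m * scaledEval P m ε z := by
  rw [MvPolynomial.eval_eq', scaledEval, Finset.mul_sum]
  refine Finset.sum_congr rfl fun α hα => ?_
  rw [prod_mul_pow_eq, ← pow_mul_pow_sub ε (hm α hα)]
  ring

theorem scaledEval_zero_mul {P : MvPolynomial (Fin n) ℂ} {m : ℕ}
    (hm : ∀ α ∈ P.support, m ≤ α.degree) (c : ℂ) (z : Fin n → ℂ) :
    scaledEval P m 0 (fun j => c * z j) = c ^ m * scaledEval P m 0 z := by
  rw [scaledEval, scaledEval, Finset.mul_sum]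
  refine Finset.sum_congr rfl fun α hα => ?_
  rw [prod_mul_pow_eq]
  rcases (hm α hα).eq_or_lt with h | h
  · rw [← h]; ring
  · rw [zero_pow (by omega)]; ring

theorem exists_scaledEval_zero_ne_zero {P : MvPolynomial (Fin n) ℂ} {m : ℕ}
    (hm : ∃ α ∈ P.support, α.degree = m) : ∃ z, scaledEval P m 0 z ≠ 0 := by
  by_contra! hcon
  obtain ⟨α, hα, hαm⟩ := hm
  set L : MvPolynomial (Fin n) ℂ :=
    ∑ β ∈ P.support, MvPolynomial.monomial β (P.coeff β * 0 ^ (β.degree - m)) with hL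
  have hL0 : L = 0 := by
    refine MvPolynomial.funext fun z => ?_
    rw [map_zero, ← hcon z, hL, map_sum, scaledEval]
    refine Finset.sum_congr rfl fun β _ => ?_
    rw [MvPolynomial.eval_monomial, Finsupp.prod_fintype _ _ fun _ => pow_zero _]
  have hc : L.coeff α = P.coeff α := by
    rw [hL, MvPolynomial.coeff_sum, Finset.sum_eq_single α]
    · simp [hαm]
    · intro β _ hne
      rw [MvPolynomial.coeff_monomial, if_neg hne]
    · exact fun h => absurd hα h
  rw [hL0, MvPolynomial.coeff_zero] at hc
  exact MvPolynomial.mem_support_iff.1 hα hc.symm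

theorem mult_spec (hp : p ≠ 0) (x : Torus n) :
    (∃ α ∈ (taylorAt p (expI x)).support, α.degree = mult p x) ∧
      ∀ α ∈ (taylorAt p (expI x)).support, mult p x ≤ α.degree := by
  obtain ⟨α, hα⟩ := MvPolynomial.support_nonempty.2 (taylorAt_ne_zero hp (expI x))
  exact ⟨Nat.sInf_mem (s := {k : ℕ | ∃ α ∈ (taylorAt p (expI x)).support, α.degree = k})
    ⟨_, α, hα, rfl⟩, fun β hβ => Nat.sInf_le ⟨β, hβ, rfl⟩⟩

/-- Let `P` be the Taylor polynomial, at a point `a` of the torus, of a polynomial without zeros in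
the open polydisc. Then the leading form of `P` does not vanish at the tangent vector `(ℓ_j a_j)`.
Otherwise, by Hurwitz's theorem, the polynomial would vanish at a point `a_j (1 - ε (ℓ_j + small))`,
which lies in the open polydisc. -/
theorem scaledEval_zero_ne_zero {P : MvPolynomial (Fin n) ℂ} {m : ℕ}
    (hex : ∃ α ∈ P.support, α.degree = m) (hle : ∀ α ∈ P.support, m ≤ α.degree)
    (hpos : ∀ j, 0 < ℓ j) {a : Fin n → ℂ} (ha : ∀ j, ‖a j‖ = 1)
    (hP : ∀ u : Fin n → ℂ, (∀ j, ‖u j + a j‖ < 1) → MvPolynomial.eval u P ≠ 0) :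
    scaledEval P m 0 (fun j => a j * ℓ j) ≠ 0 := by
  intro h0
  obtain ⟨z, hz⟩ := exists_scaledEval_zero_ne_zero hex
  -- the direction in which the tangent vector is moved, so that `c 1 = z`
  obtain ⟨ξ, hξ⟩ : ∃ ξ : Fin n → ℂ, ∀ j, -1 * (a j * (ℓ j + ξ j)) = z j := by
    refine ⟨fun j => -(z j / a j) + -ℓ j, fun j => ?_⟩
    have : a j ≠ 0 := by rw [← norm_pos_iff, ha]; exact one_pos
    rw [add_comm (ℓ j : ℂ), neg_add_cancel_right, mul_neg, mul_div_cancel₀ _ this]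
    ring
  obtain ⟨c, hc⟩ : ∃ c : ℂ → Fin n → ℂ, ∀ w j, c w j = -1 * (a j * (ℓ j + w * ξ j)) :=
    ⟨fun w j => -1 * (a j * (ℓ j + w * ξ j)), fun _ _ => rfl⟩
  have hcd : ∀ j, Differentiable ℂ fun w => c w j := fun j => by
    simp only [hc]; fun_prop
  have hcC : Continuous c := continuous_pi fun j => (hcd j).continuous
  have hcc : Continuous fun q : ℂ × ℂ => scaledEval P m q.1 (c q.2) :=
    (continuous_scaledEval P m).comp₂ continuous_fst (hcC.comp continuous_snd)
  have hone : c 1 = z := by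
    funext j
    rw [hc, one_mul, hξ]
  have hzero : scaledEval P m 0 (c 0) = 0 := by
    have : c 0 = fun j => -1 * (a j * ℓ j) := by
      funext j
      rw [hc, zero_mul, add_zero]
    rw [this, scaledEval_zero_mul hle, h0, mul_zero]
  obtain ⟨r, hr, hrξ⟩ : ∃ r > 0, ∀ w : ℂ, ‖w‖ < r → ∀ j, ‖w * ξ j‖ < ℓ j / 2 := by
    have : ∀ᶠ w : ℂ in 𝓝 0, ∀ j, ‖w * ξ j‖ < ℓ j / 2 := by
      refine eventually_all.2 fun j => ?_
      have hcj : Continuous fun w : ℂ => ‖w * ξ j‖ := by fun_prop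
      refine (hcj.tendsto 0).eventually (gt_mem_nhds ?_)
      simpa using half_pos (hpos j)
    obtain ⟨r, hr, h⟩ := Metric.eventually_nhds_iff.1 this
    exact ⟨r, hr, fun w hw => h (by simpa using hw)⟩
  have hev := eventually_exists_zero (F := fun ε w => scaledEval P m ε (c w)) hcc
    (fun ε => differentiable_scaledEval P m (differentiable_const ε) hcd) (y₀ := 0) (c := 0)
    hzero ⟨1, by rw [hone]; exact hz⟩ hr
  have hsmall : ∀ᶠ ε : ℝ in 𝓝[>] 0, ∀ j, ε * ℓ j < 1 / 4 := by
    refine eventually_all.2 fun j => Eventually.filter_mono nhdsWithin_le_nhds ?_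
    have hcj : Continuous fun ε : ℝ => ε * ℓ j := by fun_prop
    refine (hcj.tendsto 0).eventually (gt_mem_nhds ?_)
    simp
  have hev' : ∀ᶠ ε : ℝ in 𝓝[>] 0, ∃ w ∈ Metric.ball (0 : ℂ) r, scaledEval P m ε (c w) = 0 := by
    refine Tendsto.eventually (f := fun ε : ℝ => (ε : ℂ)) ?_ hev
    exact (Complex.continuous_ofReal.tendsto' 0 0 (by simp)).mono_left nhdsWithin_le_nhds
  obtain ⟨ε, ⟨⟨w, hw, hw0⟩, hεℓ⟩, hε⟩ := ((hev'.and hsmall).and self_mem_nhdsWithin).exists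
  have hε : 0 < ε := hε
  rw [mem_ball_zero_iff] at hw
  have heval := eval_mul_eq_scaledEval hle ε (c w)
  rw [hw0, mul_zero] at heval
  refine hP _ (fun j => ?_) heval
  have hfac : (ε : ℂ) * c w j + a j = a j * (1 - ε * (ℓ j + w * ξ j)) := by rw [hc]; ring
  rw [hfac, norm_mul, ha, one_mul]
  have hu := hrξ w hw j
  have hεj := hεℓ j
  have hpj := hpos j
  calc ‖1 - (ε : ℂ) * (ℓ j + w * ξ j)‖ = ‖((1 - ε * ℓ j : ℝ) : ℂ) - ε * (w * ξ j)‖ := by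
        congr 1; push_cast; ring
    _ ≤ ‖((1 - ε * ℓ j : ℝ) : ℂ)‖ + ‖(ε : ℂ) * (w * ξ j)‖ := norm_sub_le _ _
    _ < 1 := by
        rw [Complex.norm_real, norm_mul (ε : ℂ), Complex.norm_real, Real.norm_eq_abs,
          Real.norm_eq_abs, abs_of_pos hε, abs_of_pos (by linarith)]
        have := mul_lt_mul_of_pos_left hu hε
        have := mul_pos hε hpj
        linarith

/-- The multiplicity at a point is the order of vanishing along the flow line. -/
theorem analyticOrderAt_lineC_zero (hp : p ∈ LY d) (hpos : ∀ j, 0 < ℓ j) (x : Torus n) :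
    analyticOrderAt (lineC p ℓ x) 0 = mult p x := by
  obtain ⟨hex, hle⟩ := mult_spec (ne_zero_of_mem_LY hp) x
  set P := taylorAt p (expI x) with hP
  set m := mult p x with hm
  set f : Fin n → ℂ → ℂ := fun j w => expI x j * Complex.exp (w * ℓ j * Complex.I)
  have hf : ∀ j, Differentiable ℂ (f j) := fun j => by fun_prop
  have hv : ∀ j, Differentiable ℂ (dslope (f j) 0) := fun j =>
    differentiableOn_univ.1
      ((Complex.differentiableOn_dslope univ_mem).2 (hf j).differentiableOn)
  rw [(analyticAt_lineC p x 0).analyticOrderAt_eq_natCast]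
  refine ⟨fun w => scaledEval P m w fun j => dslope (f j) 0 w,
    (differentiable_scaledEval P m differentiable_id hv).analyticAt 0, ?_,
    Eventually.of_forall fun w => ?_⟩
  · simp only
    have hd0 : (fun j => dslope (f j) 0 0) = fun j => Complex.I * (expI x j * ℓ j) := by
      funext j
      rw [dslope_same]
      have h1 : HasDerivAt (fun w : ℂ => w * ℓ j * Complex.I) (ℓ j * Complex.I) 0 := by
        simpa using ((hasDerivAt_id (0 : ℂ)).mul_const (ℓ j : ℂ)).mul_const Complex.I
      rw [(h1.cexp.const_mul (expI x j)).deriv]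
      simp; ring
    rw [hd0, scaledEval_zero_mul hle]
    exact mul_ne_zero (pow_ne_zero _ Complex.I_ne_zero) (scaledEval_zero_ne_zero hex hle hpos
      (norm_expI x) fun u hu => by rw [hP, eval_taylorAt]; exact hp.2.1 _ hu)
  · rw [sub_zero, smul_eq_mul, ← eval_mul_eq_scaledEval hle, hP, eval_taylorAt, lineC]
    congr 2
    funext j
    have h1 : w * dslope (f j) 0 w = f j w - f j 0 := by
      simpa using sub_smul_dslope (f j) 0 w
    rw [Pi.add_apply, h1]
    simp [f, linePoint]

theorem le_mult_iff (hp : p ∈ LY d) (hpos : ∀ j, 0 < ℓ j) {x : Torus n} {k : ℕ} :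
    k ≤ mult p x ↔ ∀ i < k, x ∈ zeroSet ((lineDeriv ℓ)^[i] p) := by
  have h := le_analyticOrderAt_lineC (p := p) (ℓ := ℓ) (y := x) (t := 0) (k := k)
  rwa [Complex.ofReal_zero, analyticOrderAt_lineC_zero hp hpos, flow_zero, Nat.cast_le] at h

theorem analyticOrderAt_lineC (hp : p ∈ LY d) (hpos : ∀ j, 0 < ℓ j) (y : Torus n) (t : ℝ) :
    analyticOrderAt (lineC p ℓ y) t = mult p (flow ℓ t y) :=
  eq_of_forall_natCast_le_iff fun k => by
    rw [le_analyticOrderAt_lineC, Nat.cast_le, le_mult_iff hp hpos]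

theorem analyticOrderAt_lineFun (hp : p ∈ LY d) (hpos : ∀ j, 0 < ℓ j) (y : Torus n) (t : ℝ) :
    analyticOrderAt (lineFun p ℓ y) t = mult p (flow ℓ t y) :=
  eq_of_forall_natCast_le_iff fun k => by
    rw [le_analyticOrderAt_lineFun, Nat.cast_le, le_mult_iff hp hpos]

theorem mult_pos_iff (hp : p ∈ LY d) (hpos : ∀ j, 0 < ℓ j) {x : Torus n} :
    0 < mult p x ↔ x ∈ zeroSet p := by
  have := le_mult_iff hp hpos (x := x) (k := 1)
  rw [← Nat.succ_le_iff, this]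
  simp

theorem isClosed_le_mult (hp : p ∈ LY d) (hpos : ∀ j, 0 < ℓ j) (k : ℕ) :
    IsClosed {x | k ≤ mult p x} := by
  simp only [le_mult_iff hp hpos, Set.ofPred_forall]
  exact isClosed_iInter fun i => isClosed_iInter fun _ => isClosed_zeroSet _

theorem measurable_mult (hp : p ∈ LY d) (hpos : ∀ j, 0 < ℓ j) : Measurable (mult p) :=
  measurable_of_Ici fun k => (isClosed_le_mult hp hpos k).measurableSet

theorem exists_mult_le (hp : p ∈ LY d) (hpos : ∀ j, 0 < ℓ j) : ∃ K, ∀ x, mult p x ≤ K := by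
  by_contra! hcon
  obtain ⟨x, hx⟩ := IsCompact.nonempty_iInter_of_sequence_nonempty_isCompact_isClosed
    (fun k => {x | k ≤ mult p x}) (fun k x hx => (Nat.le_succ k).trans hx)
    (fun k => (hcon k).imp fun x hx => hx.le)
    (isClosed_le_mult hp hpos 0).isCompact (isClosed_le_mult hp hpos)
  have := Set.mem_iInter.1 hx (mult p x + 1)
  have : mult p x + 1 ≤ mult p x := this
  omega

end

section

/-! ### Logarithmic means -/

variable {n : ℕ} {ℓ : Fin n → ℝ} {p : MvPolynomial (Fin n) ℂ} {d : Fin n → ℕ}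

instance isNegInvariant_volume_torus : (volume : Measure (Torus n)).IsNegInvariant :=
  Measure.IsAddHaarMeasure.isNegInvariant_of_regular (G := Torus n) _

theorem integral_real_flow (t : ℝ) (f : Torus n → ℝ) : ∫ y, f (flow ℓ t y) = ∫ y, f y :=
  integral_add_right_eq_self (μ := (volume : Measure (Torus n))) f
    (fun j => ((t * ℓ j : ℝ) : AddCircle (2 * π)))

theorem integrable_of_continuous_torus_real {f : Torus n → ℝ} (hf : Continuous f) : Integrable f :=
  hf.integrable_of_hasCompactSupport (HasCompactSupport.of_compactSpace f)

/-- Mean value property of `log |q|` on a torus, for a polynomial without zeros in the open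
polydisc: averaging over the diagonal rotations reduces it to one variable. -/
theorem integral_log_norm_lineC_of_pos {q : MvPolynomial (Fin n) ℂ}
    (hq : ∀ z : Fin n → ℂ, (∀ j, ‖z j‖ < 1) → MvPolynomial.eval z q ≠ 0) (hpos : ∀ j, 0 < ℓ j)
    {s : ℝ} (hs : 0 < s) :
    ∫ y : Torus n, Real.log ‖lineC q ℓ y (s * Complex.I)‖ =
      (2 * π) ^ n * Real.log ‖MvPolynomial.eval 0 q‖ := by
  set F : Torus n → ℝ := fun y => Real.log ‖lineC q ℓ y (s * Complex.I)‖ with hF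
  have hlt : ∀ (y : Torus n) j, ‖linePoint ℓ y (s * Complex.I) j‖ < 1 := fun y j => by
    rw [norm_linePoint, Real.exp_lt_one_iff]
    simp [hs, hpos j]
  have hFc : Continuous F := by
    refine Continuous.log ?_ fun y => norm_ne_zero_iff.2 (hq _ (hlt y))
    exact (continuous_lineC.comp (continuous_id.prodMk continuous_const)).norm
  obtain ⟨C, hC⟩ := isCompact_univ.exists_bound_of_continuousOn hFc.continuousOn
  -- the diagonal rotation by the angle `θ`
  set rot : ℝ → Torus n → Torus n := fun θ => flow (fun _ => 1) θ
  have hmean : ∀ y, ∫ θ in (0 : ℝ)..2 * π, F (rot θ y) =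
      2 * π * Real.log ‖MvPolynomial.eval 0 q‖ := by
    intro y
    set g : ℂ → ℂ := fun w => MvPolynomial.eval (fun j => w * linePoint ℓ y (s * Complex.I) j) q
    have hg : Differentiable ℂ g := differentiable_eval_comp q fun j => by fun_prop
    have hav := AnalyticOnNhd.circleAverage_log_norm_of_ne_zero (R := 1) (c := 0) (g := g)
      (fun w _ => hg.analyticAt w) (fun w hw => hq _ fun j => by
        rw [norm_mul]
        have h1 : ‖w‖ ≤ 1 := by simpa using hw
        nlinarith [hlt y j, norm_nonneg (linePoint ℓ y (s * Complex.I) j)])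
    have hg0 : g 0 = MvPolynomial.eval 0 q := by simp only [g, zero_mul]; rfl
    rw [Real.circleAverage, hg0, smul_eq_mul, inv_mul_eq_iff_eq_mul₀ Real.two_pi_pos.ne'] at hav
    rw [← hav]
    refine intervalIntegral.integral_congr fun θ _ => ?_
    simp only [hF, g, lineC]
    congr 4
    funext j
    have := congrFun (expI_flow (ℓ := fun _ : Fin n => (1 : ℝ)) θ y) j
    simp only [linePoint] at this ⊢
    rw [this]
    simp [circleMap]; ring
  have hswap := intervalIntegral_integral_swap (μ := (volume : Measure (Torus n)))
    (a := 0) (b := 2 * π) (f := fun θ y => F (rot θ y)) (by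
      rw [Set.uIoc_of_le Real.two_pi_pos.le]
      refine Integrable.of_bound (C := C) ?_ (Eventually.of_forall fun z => hC _ trivial)
      exact (hFc.comp continuous_flow).aestronglyMeasurable)
  simp only [hmean, rot, integral_real_flow, integral_const, intervalIntegral.integral_const,
    sub_zero, smul_eq_mul, volume_real_univ_torus] at hswap
  have h2 : 2 * π ≠ 0 := Real.two_pi_pos.ne'
  refine mul_left_cancel₀ h2 (hswap.trans ?_)
  ring

theorem expI_neg (y : Torus n) (j : Fin n) : expI (-y) j = (expI y j)⁻¹ := by
  simp [expI, AddCircle.toCircle_neg]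

/-- On the far side of the torus the logarithmic mean grows linearly, with slope `⟨d, ℓ⟩`; there
`p` is compared with the reversed polynomial. -/
theorem integral_log_norm_lineC_of_neg (hp : p ∈ LY d) (hpos : ∀ j, 0 < ℓ j) {s : ℝ} (hs : 0 < s) :
    ∫ y : Torus n, Real.log ‖lineC p ℓ y (-s * Complex.I)‖ =
      (2 * π) ^ n * (Real.log ‖MvPolynomial.eval 0 (revPoly d p)‖ + s * pairing d ℓ) := by
  have hrev : ∀ z : Fin n → ℂ, (∀ j, ‖z j‖ < 1) → MvPolynomial.eval z (revPoly d p) ≠ 0 :=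
    fun z => eval_revPoly_ne_zero hp
  have hpt : ∀ y : Torus n, Real.log ‖lineC p ℓ y (-s * Complex.I)‖ =
      Real.log ‖lineC (revPoly d p) ℓ (-y) (s * Complex.I)‖ + s * pairing d ℓ := by
    intro y
    have hne : ∀ j, linePoint ℓ (-y) (s * Complex.I) j ≠ 0 := fun j =>
      mul_ne_zero (expI_ne_zero _ _) (Complex.exp_ne_zero _)
    have hinv : (fun j => (linePoint ℓ (-y) (s * Complex.I) j)⁻¹) =
        linePoint ℓ y (-s * Complex.I) := by
      funext j
      rw [linePoint, linePoint, mul_inv, expI_neg, inv_inv, ← Complex.exp_neg]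
      congr 2; ring
    have hlp : ‖lineC p ℓ y (-s * Complex.I)‖ ≠ 0 := by
      refine norm_ne_zero_iff.2 (lineC_ne_zero hp hpos y ?_)
      simpa using hs.ne'
    have hprod : ‖∏ j, linePoint ℓ (-y) (s * Complex.I) j ^ d j‖ =
        Real.exp (-(s * pairing d ℓ)) := by
      rw [norm_prod, pairing, Finset.mul_sum, ← Finset.sum_neg_distrib, Real.exp_sum]
      refine Finset.prod_congr rfl fun j _ => ?_
      rw [norm_pow, norm_linePoint, ← Real.exp_nat_mul]
      congr 1
      simp; ring
    have h1 : lineC (revPoly d p) ℓ (-y) (s * Complex.I) =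
        (∏ j, linePoint ℓ (-y) (s * Complex.I) j ^ d j) * lineC p ℓ y (-s * Complex.I) := by
      rw [lineC, eval_revPoly hp hne, hinv, lineC]
    rw [h1, norm_mul, hprod, Real.log_mul (Real.exp_ne_zero _) hlp, Real.log_exp]
    ring
  have hc : Continuous fun y : Torus n =>
      Real.log ‖lineC (revPoly d p) ℓ (-y) (s * Complex.I)‖ := by
    refine Continuous.log ?_ fun y => norm_ne_zero_iff.2 (hrev _ fun j => ?_)
    · exact (continuous_lineC.comp (continuous_neg.prodMk continuous_const)).norm
    · rw [norm_linePoint, Real.exp_lt_one_iff]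
      simp [hs, hpos j]
  simp only [hpt]
  rw [integral_add (integrable_of_continuous_torus_real hc) (integrable_const _), integral_const,
    volume_real_univ_torus, integral_neg_eq_self
      (fun y : Torus n => Real.log ‖lineC (revPoly d p) ℓ y (s * Complex.I)‖),
    integral_log_norm_lineC_of_pos hrev hpos hs, smul_eq_mul]
  ring

/-- The logarithmic mean of a Lee–Yang polynomial `p` of multidegree `d` at height `s ≠ 0`, in
closed form: the integral of `log |p(exp(i(y + isℓ)))|` over the torus. -/
def logMean (p : MvPolynomial (Fin n) ℂ) (d : Fin n → ℕ) (ℓ : Fin n → ℝ) (s : ℝ) : ℝ :=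
  (2 * π) ^ n * if 0 < s then Real.log ‖MvPolynomial.eval 0 p‖ else
    Real.log ‖MvPolynomial.eval 0 (revPoly d p)‖ + -s * pairing d ℓ

theorem integral_log_norm_lineC (hp : p ∈ LY d) (hpos : ∀ j, 0 < ℓ j) {w : ℂ} (hw : w.im ≠ 0) :
    ∫ y : Torus n, Real.log ‖lineC p ℓ y w‖ = logMean p d ℓ w.im := by
  have h1 : ∀ y : Torus n, lineC p ℓ y w = lineC p ℓ (flow ℓ w.re y) (w.im * Complex.I) := by
    intro y
    rw [lineC_flow, Complex.re_add_im]
  simp only [h1]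
  rw [integral_real_flow w.re fun y => Real.log ‖lineC p ℓ y (w.im * Complex.I)‖, logMean]
  split_ifs with h
  · exact integral_log_norm_lineC_of_pos hp.2.1 hpos h
  · have h2 := integral_log_norm_lineC_of_neg hp hpos
      (s := -w.im) (neg_pos.2 (lt_of_le_of_ne (not_lt.1 h) hw))
    rw [← h2]
    simp

end

section

/-! ### The kernel of Jensen's formula -/

variable {n : ℕ} {ℓ : Fin n → ℝ} {p : MvPolynomial (Fin n) ℂ} {d : Fin n → ℕ}

/-- The weight of a real zero `t` in Jensen's formula for the circle of centre `R + i` and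
radius `R`. -/
def jensenKernel (R t : ℝ) : ℝ := Real.posLog (R * ‖(R + Complex.I : ℂ) - t‖⁻¹)

theorem abs_sub_le_norm_centre_sub (R t : ℝ) : |R - t| ≤ ‖(R + Complex.I : ℂ) - t‖ := by
  refine le_of_eq_of_le ?_ (Complex.abs_re_le_norm _)
  simp

theorem norm_centre_sub_pos (R t : ℝ) : 0 < ‖(R + Complex.I : ℂ) - t‖ := by
  refine norm_pos_iff.2 fun h => ?_
  have := congrArg Complex.im h
  simp at this

theorem norm_centre_sub_le (R t : ℝ) : ‖(R + Complex.I : ℂ) - t‖ ≤ |R - t| + 1 := by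
  calc ‖(R + Complex.I : ℂ) - t‖ = ‖((R - t : ℝ) : ℂ) + Complex.I‖ := by
        congr 1; push_cast; ring
    _ ≤ _ := by
        refine (norm_add_le _ _).trans ?_
        rw [Complex.norm_real, Complex.norm_I, Real.norm_eq_abs]

theorem continuous_jensenKernel (R : ℝ) : Continuous (jensenKernel R) := by
  unfold jensenKernel
  refine Real.continuous_posLog.comp (continuous_const.mul (Continuous.inv₀ (by fun_prop)
    fun t => (norm_centre_sub_pos R t).ne'))

theorem jensenKernel_eq_zero {R t : ℝ} (hR : 0 < R) (h : R ≤ ‖(R + Complex.I : ℂ) - t‖) :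
    jensenKernel R t = 0 := by
  rw [jensenKernel, Real.posLog_eq_zero_iff, abs_of_nonneg (by positivity),
    mul_inv_le_iff₀ (hR.trans_le h), one_mul]
  exact h

theorem jensenKernel_eq_log {R t : ℝ} (hR : 0 < R) (h : ‖(R + Complex.I : ℂ) - t‖ ≤ R) :
    jensenKernel R t = Real.log (R * ‖(R + Complex.I : ℂ) - t‖⁻¹) := by
  refine Real.posLog_eq_log ?_
  rwa [abs_of_nonneg (by positivity), le_mul_inv_iff₀ (norm_centre_sub_pos R t), one_mul]

/-- The kernel is at most `log R - log |t - R|` on `(0, 2R]`, and zero outside. -/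
theorem lintegral_jensenKernel_le {R : ℝ} (hR : 1 ≤ R) :
    ∫⁻ t, ENNReal.ofReal (jensenKernel R t) ≤ ENNReal.ofReal (2 * R) := by
  have hR0 : 0 < R := one_pos.trans_le hR
  have hint : IntervalIntegrable (fun t => Real.log R - Real.log (t - R)) volume 0 (2 * R) :=
    intervalIntegrable_const.sub
      (intervalIntegral.intervalIntegrable_log'.comp_sub_right (a := 0 - R) (b := 2 * R - R) R |>
        fun h => by simpa using h)
  have hval : ∫ t in (0 : ℝ)..2 * R, (Real.log R - Real.log (t - R)) = 2 * R := by
    rw [intervalIntegral.integral_sub intervalIntegrable_const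
      (intervalIntegral.intervalIntegrable_log'.comp_sub_right (a := 0 - R) (b := 2 * R - R) R |>
        fun h => by simpa using h),
      intervalIntegral.integral_comp_sub_right (fun t => Real.log t), integral_log]
    simp only [zero_sub, Real.log_neg_eq_log, intervalIntegral.integral_const, smul_eq_mul]
    rw [show 2 * R - R = R by ring]; ring
  have hnn : ∀ t ∈ Set.Ioc (0 : ℝ) (2 * R), 0 ≤ Real.log R - Real.log (t - R) := by
    intro t ht
    rw [sub_nonneg, ← Real.log_abs (t - R)]
    rcases (abs_nonneg (t - R)).eq_or_lt with h | h
    · rw [← h, Real.log_zero]; exact Real.log_nonneg hR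
    · exact Real.log_le_log h (abs_le.2 ⟨by linarith [ht.1], by linarith [ht.2]⟩)
  rw [intervalIntegral.integral_of_le (by positivity)] at hval
  rw [← hval, ofReal_integral_eq_lintegral_ofReal
    ((intervalIntegrable_iff_integrableOn_Ioc_of_le (by positivity)).1 hint)
    ((ae_restrict_iff' measurableSet_Ioc).2 (Eventually.of_forall hnn)),
    ← lintegral_indicator measurableSet_Ioc]
  refine lintegral_mono fun t => ?_
  by_cases ht : ‖(R + Complex.I : ℂ) - t‖ < R
  · have h1 := (abs_sub_le_norm_centre_sub R t).trans_lt ht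
    rw [abs_lt] at h1
    have htm : t ∈ Set.Ioc (0 : ℝ) (2 * R) := ⟨by linarith, by linarith⟩
    rw [Set.indicator_of_mem htm, jensenKernel_eq_log hR0 ht.le]
    refine ENNReal.ofReal_le_ofReal ?_
    rw [Real.log_mul hR0.ne' (inv_ne_zero (norm_centre_sub_pos R t).ne'), Real.log_inv,
      ← sub_eq_add_neg]
    refine sub_le_sub_left ?_ _
    rw [← Real.log_abs (t - R), abs_sub_comm]
    rcases (abs_nonneg (R - t)).eq_or_lt with h | h
    · rw [← h, Real.log_zero]
      refine Real.log_nonneg ?_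
      refine le_of_eq_of_le ?_ (Complex.abs_im_le_norm _)
      simp
    · exact Real.log_le_log h (abs_sub_le_norm_centre_sub R t)
  · rw [jensenKernel_eq_zero hR0 (not_lt.1 ht), ENNReal.ofReal_zero]
    exact zero_le

/-- The kernel is at least `log R - log (|R - t| + 1)` on `[1, 2R - 1]`. -/
theorem le_lintegral_jensenKernel {R : ℝ} (hR : 1 ≤ R) :
    ENNReal.ofReal (2 * (R - 1 - Real.log R)) ≤ ∫⁻ t, ENNReal.ofReal (jensenKernel R t) := by
  have hR0 : 0 < R := one_pos.trans_le hR
  have hlow : ∀ t, |R - t| ≤ R - 1 → Real.log R - Real.log (|R - t| + 1) ≤ jensenKernel R t := by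
    intro t ht
    have h1 := norm_centre_sub_le R t
    rw [jensenKernel_eq_log hR0 (by linarith), Real.log_mul hR0.ne'
      (inv_ne_zero (norm_centre_sub_pos R t).ne'), Real.log_inv, ← sub_eq_add_neg]
    exact sub_le_sub_left (Real.log_le_log (norm_centre_sub_pos R t) h1) _
  have hnn : ∀ t, |R - t| ≤ R - 1 → 0 ≤ Real.log R - Real.log (|R - t| + 1) := fun t ht =>
    sub_nonneg.2 (Real.log_le_log (by positivity) (by linarith))
  have hcont : Continuous fun t => Real.log R - Real.log (|R - t| + 1) :=
    continuous_const.sub (Continuous.log (by fun_prop) fun t => by positivity)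
  have hval : ∫ t in (1 : ℝ)..2 * R - 1, (Real.log R - Real.log (|R - t| + 1)) =
      2 * (R - 1 - Real.log R) := by
    rw [← intervalIntegral.integral_add_adjacent_intervals (b := R)
      (hcont.intervalIntegrable _ _) (hcont.intervalIntegrable _ _)]
    have hi : ∀ a b : ℝ, IntervalIntegrable (fun t => Real.log t) volume a b := fun a b =>
      intervalIntegral.intervalIntegrable_log'
    have e1 : ∫ t in (1 : ℝ)..R, (Real.log R - Real.log (|R - t| + 1)) =
        ∫ t in (1 : ℝ)..R, (fun u => Real.log R - Real.log u) (R + 1 - t) := by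
      refine intervalIntegral.integral_congr fun t ht => ?_
      rw [Set.uIcc_of_le hR] at ht
      simp only
      rw [abs_of_nonneg (by linarith [ht.2])]
      ring_nf
    have e2 : ∫ t in R..2 * R - 1, (Real.log R - Real.log (|R - t| + 1)) =
        ∫ t in R..2 * R - 1, (fun u => Real.log R - Real.log u) (t - (R - 1)) := by
      refine intervalIntegral.integral_congr fun t ht => ?_
      rw [Set.uIcc_of_le (by linarith)] at ht
      simp only
      rw [abs_of_nonpos (by linarith [ht.1])]
      ring_nf
    rw [e1, e2, intervalIntegral.integral_comp_sub_left (fun u => Real.log R - Real.log u),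
      intervalIntegral.integral_comp_sub_right (fun u => Real.log R - Real.log u),
      show R + 1 - R = 1 by ring, show R + 1 - 1 = R by ring, show R - (R - 1) = 1 by ring,
      show 2 * R - 1 - (R - 1) = R by ring,
      intervalIntegral.integral_sub intervalIntegrable_const (hi _ _), integral_log]
    simp only [intervalIntegral.integral_const, smul_eq_mul, Real.log_one]
    ring
  rw [intervalIntegral.integral_of_le (by linarith)] at hval
  have habs : ∀ t ∈ Set.Ioc 1 (2 * R - 1), |R - t| ≤ R - 1 := fun t ht =>
    abs_le.2 ⟨by linarith [ht.2], by linarith [ht.1]⟩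
  rw [← hval, ofReal_integral_eq_lintegral_ofReal
    ((intervalIntegrable_iff_integrableOn_Ioc_of_le (by linarith)).1
      (hcont.intervalIntegrable _ _))
    ((ae_restrict_iff' measurableSet_Ioc).2 (Eventually.of_forall fun t ht => hnn t (habs t ht)))]
  refine (setLIntegral_mono (continuous_jensenKernel R).measurable.ennreal_ofReal
    fun t ht => ENNReal.ofReal_le_ofReal (hlow t (habs t ht))).trans ?_
  exact setLIntegral_le_lintegral _ _

/-! ### Jensen's formula along the flow lines -/

/-- Jensen's formula on a line, for the circle of centre `R + i` and radius `R`; all its zeros are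
real, and they are the visits of the line to the zero set. -/
theorem hitSum_jensenKernel (hp : p ∈ LY d) (hpos : ∀ j, 0 < ℓ j)
    (hS : IsCrossSection ℓ (zeroSet p)) {R : ℝ} (hR : 0 < R) (y : Torus n) :
    0 ≤ Real.circleAverage (fun w => Real.log ‖lineC p ℓ y w‖) (R + Complex.I) R -
        Real.log ‖lineC p ℓ y (R + Complex.I)‖ ∧
    hitSum ℓ (zeroSet p) (fun z => mult p z.1 * ENNReal.ofReal (jensenKernel R z.2)) y =
      ENNReal.ofReal (Real.circleAverage (fun w => Real.log ‖lineC p ℓ y w‖) (R + Complex.I) R -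
        Real.log ‖lineC p ℓ y (R + Complex.I)‖) := by
  have hfin := hS.finite_hits y (-1) (2 * R)
  have hmemT : ∀ t : ℝ, ‖(R + Complex.I : ℂ) - t‖ < R ∨ ‖(R + Complex.I : ℂ) - t‖ ≤ R →
      t ∈ Set.Ioc (-1) (2 * R) := by
    intro t ht
    have h1 := (abs_sub_le_norm_centre_sub R t).trans (ht.elim le_of_lt id)
    rw [abs_le] at h1
    exact ⟨by linarith, by linarith⟩
  have han : AnalyticOnNhd ℂ (lineC p ℓ y) (Metric.closedBall (R + Complex.I) |R|) :=
    fun w _ => analyticAt_lineC p y w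
  rw [AnalyticOnNhd.circleAverage_log_norm hR.ne' han (lineC_ne_zero hp hpos y (by simp)),
    add_sub_cancel_right]
  -- the zeros in the disc and their orders
  set D := MeromorphicOn.divisor (lineC p ℓ y) (Metric.closedBall (R + Complex.I) |R|) with hD
  have hball : ∀ t : ℝ, (t : ℂ) ∈ Metric.closedBall (R + Complex.I : ℂ) |R| ↔
      ‖(R + Complex.I : ℂ) - t‖ ≤ R := fun t => by
    rw [Metric.mem_closedBall, dist_comm, dist_eq_norm, abs_of_pos hR]
  have hDt : ∀ t : ℝ, (D t : ℝ) * Real.log (R * ‖(R + Complex.I : ℂ) - t‖⁻¹) =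
      mult p (flow ℓ t y) * jensenKernel R t := by
    intro t
    by_cases ht : ‖(R + Complex.I : ℂ) - t‖ ≤ R
    · rw [hD, MeromorphicOn.AnalyticOnNhd.divisor_apply han ((hball t).2 ht),
        analyticOrderAt_lineC hp hpos, jensenKernel_eq_log hR ht]
      simp
    · rw [Function.locallyFinsuppWithin.apply_eq_zero_of_notMem D (fun h => ht ((hball t).1 h)),
        jensenKernel_eq_zero hR (not_le.1 ht).le]
      simp
  have hsupp : (Function.support fun u : ℂ => (D u : ℝ) *
      Real.log (R * ‖(R + Complex.I : ℂ) - u‖⁻¹)) ⊆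
      (hfin.toFinset.map ⟨fun t : ℝ => (t : ℂ), Complex.ofReal_injective⟩ : Finset ℂ) := by
    intro u hu
    have hDu : D u ≠ 0 := fun h => hu (by simp [h])
    have hub : u ∈ Metric.closedBall (R + Complex.I : ℂ) |R| := by
      by_contra h
      exact hDu (Function.locallyFinsuppWithin.apply_eq_zero_of_notMem D h)
    have hu0 : lineC p ℓ y u = 0 := by
      by_contra h
      refine hDu ?_
      rw [hD, MeromorphicOn.AnalyticOnNhd.divisor_apply han hub,
        (analyticAt_lineC p y u).analyticOrderAt_eq_zero.2 h]
      simp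
    have hre := im_eq_zero_of_lineC hp hpos hu0
    rw [hre] at hub hu0
    rw [hre]
    simp only [Finset.coe_map, Function.Embedding.coeFn_mk, Set.mem_image, Finset.mem_coe,
      Set.Finite.mem_toFinset]
    exact ⟨u.re, ⟨hmemT _ (Or.inr ((hball _).1 hub)), lineC_ofReal_eq_zero_iff.1 hu0⟩, rfl⟩
  have hnn : ∀ t ∈ hfin.toFinset, 0 ≤ (D ((⟨fun t : ℝ => (t : ℂ), Complex.ofReal_injective⟩ :
      ℝ ↪ ℂ) t) : ℝ) * Real.log (R * ‖(R + Complex.I : ℂ) -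
        (⟨fun t : ℝ => (t : ℂ), Complex.ofReal_injective⟩ : ℝ ↪ ℂ) t‖⁻¹) := fun t _ => by
    rw [Function.Embedding.coeFn_mk, hDt]
    exact mul_nonneg (Nat.cast_nonneg _) Real.posLog_nonneg
  rw [finsum_eq_sum_of_support_subset _ hsupp, Finset.sum_map]
  refine ⟨Finset.sum_nonneg hnn, ?_⟩
  rw [ENNReal.ofReal_sum_of_nonneg hnn, hitSum, tsum_eq_sum (s := hfin.toFinset)]
  · refine Finset.sum_congr rfl fun t ht => ?_
    rw [Set.Finite.mem_toFinset] at ht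
    rw [Set.indicator_of_mem (s := {t | flow ℓ t y ∈ zeroSet p}) ht.2,
      Function.Embedding.coeFn_mk, hDt, ENNReal.ofReal_mul (Nat.cast_nonneg _),
      ENNReal.ofReal_natCast]
  · intro t ht
    by_cases htS : flow ℓ t y ∈ zeroSet p
    · rw [Set.indicator_of_mem (s := {t | flow ℓ t y ∈ zeroSet p}) htS,
        jensenKernel_eq_zero hR, ENNReal.ofReal_zero, mul_zero]
      by_contra hlt
      exact ht ((Set.Finite.mem_toFinset hfin).2 ⟨hmemT t (Or.inl (not_le.1 hlt)), htS⟩)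
    · exact Set.indicator_of_notMem (s := {t | flow ℓ t y ∈ zeroSet p}) htS _

end

section

/-! ### The total mass counted with multiplicity -/

variable {n : ℕ} {ℓ : Fin n → ℝ} {p : MvPolynomial (Fin n) ℂ} {d : Fin n → ℕ}

theorem pairing_nonneg (d : Fin n → ℕ) (hpos : ∀ j, 0 < ℓ j) : 0 ≤ pairing d ℓ :=
  Finset.sum_nonneg fun j _ => mul_nonneg (Nat.cast_nonneg _) (hpos j).le

theorem circleMap_centre_im (R θ : ℝ) :
    (circleMap (R + Complex.I) R θ).im = 1 + R * Real.sin θ := by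
  simp [circleMap, Complex.exp_ofReal_mul_I_im]

/-- A circle of centre `R + i` and radius `R` meets the real line in a null set of angles. -/
theorem ae_circleMap_im_ne_zero {R : ℝ} (hR : R ≠ 0) :
    ∀ᵐ θ : ℝ, (circleMap (R + Complex.I) R θ).im ≠ 0 := by
  set s : Set ℂ := {((R + √(R ^ 2 - 1) : ℝ) : ℂ), ((R - √(R ^ 2 - 1) : ℝ) : ℂ)}
  have hs : s.Countable := Set.Countable.insert _ (Set.countable_singleton _)
  refine measure_mono_null (t := circleMap (R + Complex.I) R ⁻¹' s) (fun θ hθ => ?_)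
    ((hs.preimage_circleMap _ hR).measure_zero _)
  have hθ : (circleMap (R + Complex.I) R θ).im = 0 := by
    by_contra h; exact hθ h
  have hre : (circleMap (R + Complex.I) R θ).re = R + R * Real.cos θ := by
    simp [circleMap, Complex.exp_ofReal_mul_I_re]
  have h1 := circleMap_centre_im R θ
  rw [hθ] at h1
  have h2 : R ^ 2 - 1 = (R * Real.cos θ) ^ 2 := by
    have := Real.sin_sq_add_cos_sq θ
    have h3 : R * Real.sin θ = -1 := by linarith
    have h4 : R ^ 2 * (Real.sin θ ^ 2 + Real.cos θ ^ 2) = (R * Real.sin θ) ^ 2 +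
      (R * Real.cos θ) ^ 2 := by ring
    rw [this, h3] at h4
    linarith
  have h5 : circleMap (R + Complex.I) R θ = ((R + R * Real.cos θ : ℝ) : ℂ) :=
    Complex.ext (by rw [hre, Complex.ofReal_re]) (by rw [hθ, Complex.ofReal_im])
  change circleMap (R + Complex.I) R θ ∈ ({((R + √(R ^ 2 - 1) : ℝ) : ℂ),
    ((R - √(R ^ 2 - 1) : ℝ) : ℂ)} : Set ℂ)
  rw [h5, h2, Real.sqrt_sq_eq_abs]
  rcases abs_choice (R * Real.cos θ) with h | h <;> rw [h]
  · exact Or.inl rfl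
  · right; rw [sub_neg_eq_add]; rfl

/-- Up to a bounded error, the logarithmic mean at the point of the circle with sine `x` is `⟨d, ℓ⟩`
times the depth below the real line. -/
theorem abs_logMean_sub_le (hpos : ∀ j, 0 < ℓ j) {R : ℝ} (hR : 0 ≤ R) (x : ℝ) :
    |logMean p d ℓ (1 + R * x) - (2 * π) ^ n * pairing d ℓ * R * max 0 (-x)| ≤
      (2 * π) ^ n * (|Real.log ‖MvPolynomial.eval 0 p‖| +
        |Real.log ‖MvPolynomial.eval 0 (revPoly d p)‖| + pairing d ℓ) := by
  have hδ := pairing_nonneg d hpos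
  set A := Real.log ‖MvPolynomial.eval 0 p‖
  set B := Real.log ‖MvPolynomial.eval 0 (revPoly d p)‖
  set δ := pairing d ℓ
  have hV : 0 < (2 * π) ^ n := pow_pos Real.two_pi_pos n
  have key : |(if 0 < 1 + R * x then A else B + -(1 + R * x) * δ) - δ * (R * max 0 (-x))| ≤
      |A| + |B| + δ := by
    split_ifs with h
    · have h1 : R * max 0 (-x) ≤ 1 := by
        rcases max_cases 0 (-x) with ⟨h2, h3⟩ | ⟨h2, h3⟩ <;> rw [h2] <;> linarith
      have h2 : 0 ≤ R * max 0 (-x) := mul_nonneg hR (le_max_left _ _)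
      have h3 : 0 ≤ δ * (R * max 0 (-x)) := mul_nonneg hδ h2
      have h4 : δ * (R * max 0 (-x)) ≤ δ := mul_le_of_le_one_right hδ h1
      rw [abs_le]
      constructor <;> linarith [neg_abs_le A, le_abs_self A, abs_nonneg B]
    · have hx : x < 0 := by
        by_contra hx
        have := mul_nonneg hR (not_lt.1 hx)
        linarith
      rw [max_eq_right (by linarith)]
      rw [show B + -(1 + R * x) * δ - δ * (R * -x) = B - δ by ring, abs_le]
      constructor <;> linarith [neg_abs_le B, le_abs_self B, abs_nonneg A]
  calc _ = |(2 * π) ^ n * ((if 0 < 1 + R * x then A else B + -(1 + R * x) * δ) -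
        δ * (R * max 0 (-x)))| := by
        congr 1
        rw [logMean]
        ring
    _ ≤ _ := by
        rw [abs_mul, abs_of_pos hV]
        exact mul_le_mul_of_nonneg_left key hV.le

theorem integral_max_neg_sin : ∫ θ in (0 : ℝ)..2 * π, max 0 (-Real.sin θ) = 2 := by
  have hc : Continuous fun θ : ℝ => max 0 (-Real.sin θ) := by fun_prop
  have hpi := Real.pi_pos
  rw [← intervalIntegral.integral_add_adjacent_intervals (b := π) (hc.intervalIntegrable _ _)
    (hc.intervalIntegrable _ _)]
  have e1 : ∫ θ in (0 : ℝ)..π, max 0 (-Real.sin θ) = ∫ θ in (0 : ℝ)..π, (0 : ℝ) := by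
    refine intervalIntegral.integral_congr fun θ hθ => ?_
    rw [Set.uIcc_of_le hpi.le] at hθ
    have := Real.sin_nonneg_of_nonneg_of_le_pi hθ.1 hθ.2
    exact max_eq_left (by linarith)
  have e2 : ∫ θ in π..2 * π, max 0 (-Real.sin θ) = ∫ θ in π..2 * π, -Real.sin θ := by
    refine intervalIntegral.integral_congr fun θ hθ => ?_
    rw [Set.uIcc_of_le (by linarith)] at hθ
    have := Real.sin_nonneg_of_nonneg_of_le_pi (x := θ - π) (by linarith [hθ.1])
      (by linarith [hθ.2])
    rw [Real.sin_sub_pi] at this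
    exact max_eq_right this
  rw [e1, e2, intervalIntegral.integral_neg, integral_sin]
  simp
  norm_num

theorem integrable_log_norm_lineC (hp : p ∈ LY d) (hpos : ∀ j, 0 < ℓ j) {w : ℂ} (hw : w.im ≠ 0) :
    Integrable fun y : Torus n => Real.log ‖lineC p ℓ y w‖ :=
  integrable_of_continuous_torus_real <| Continuous.log
    (continuous_lineC.comp (continuous_id.prodMk continuous_const)).norm
    fun y => norm_ne_zero_iff.2 (lineC_ne_zero hp hpos y hw)

theorem exists_abs_logMean_le (hpos : ∀ j, 0 < ℓ j) {R : ℝ} (hR : 0 ≤ R) :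
    ∃ K, ∀ θ : ℝ, |logMean p d ℓ (1 + R * Real.sin θ)| ≤ K := by
  refine ⟨(2 * π) ^ n * (|Real.log ‖MvPolynomial.eval 0 p‖| +
    |Real.log ‖MvPolynomial.eval 0 (revPoly d p)‖| + pairing d ℓ) +
    (2 * π) ^ n * pairing d ℓ * R, fun θ => ?_⟩
  have h := abs_logMean_sub_le (p := p) (d := d) hpos hR (Real.sin θ)
  have hc : 0 ≤ (2 * π) ^ n * pairing d ℓ * R :=
    mul_nonneg (mul_nonneg (pow_pos Real.two_pi_pos n).le (pairing_nonneg d hpos)) hR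
  have h1 : max 0 (-Real.sin θ) ≤ 1 := max_le zero_le_one (by linarith [Real.neg_one_le_sin θ])
  have h2 : |(2 * π) ^ n * pairing d ℓ * R * max 0 (-Real.sin θ)| ≤
      (2 * π) ^ n * pairing d ℓ * R := by
    rw [abs_of_nonneg (mul_nonneg hc (le_max_left _ _))]
    exact mul_le_of_le_one_right hc h1
  have h3 := abs_sub_abs_le_abs_sub (logMean p d ℓ (1 + R * Real.sin θ))
    ((2 * π) ^ n * pairing d ℓ * R * max 0 (-Real.sin θ))
  linarith

/-- The logarithm of `|p|` on all circles is jointly integrable: it is bounded above, and its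
integrals over the torus are bounded below. -/
theorem integrable_log_norm_lineC_prod (hp : p ∈ LY d) (hpos : ∀ j, 0 < ℓ j) {R : ℝ} (hR : 0 < R) :
    Integrable (fun z : ℝ × Torus n => Real.log ‖lineC p ℓ z.2 (circleMap (R + Complex.I) R z.1)‖)
      ((volume.restrict (Set.Ioc 0 (2 * π))).prod volume) := by
  have hmeas : Measurable fun z : ℝ × Torus n =>
      Real.log ‖lineC p ℓ z.2 (circleMap (R + Complex.I) R z.1)‖ :=
    Real.measurable_log.comp (continuous_lineC.comp (continuous_snd.prodMk
      ((continuous_circleMap _ _).comp continuous_fst))).norm.measurable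
  obtain ⟨M₀, hM₀⟩ : ∃ M₀, ∀ (y : Torus n), ∀ w ∈ Metric.sphere (R + Complex.I : ℂ) |R|,
      ‖lineC p ℓ y w‖ ≤ M₀ := by
    obtain ⟨M₀, hM₀⟩ := (isCompact_univ.prod (isCompact_sphere
      (R + Complex.I : ℂ) |R|)).exists_bound_of_continuousOn
      (continuous_lineC (p := p) (ℓ := ℓ)).continuousOn
    exact ⟨M₀, fun y w hw => hM₀ (y, w) (Set.mk_mem_prod (Set.mem_univ y) hw)⟩
  obtain ⟨M, hMM, hM1⟩ : ∃ M, M₀ ≤ M ∧ 1 ≤ M := ⟨max M₀ 1, le_max_left _ _, le_max_right _ _⟩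
  have hM : 0 ≤ Real.log M := Real.log_nonneg hM1
  have hup : ∀ (θ : ℝ) (y : Torus n),
      Real.log ‖lineC p ℓ y (circleMap (R + Complex.I) R θ)‖ ≤ Real.log M := by
    intro θ y
    have h1 : ‖lineC p ℓ y (circleMap (R + Complex.I) R θ)‖ ≤ M :=
      (hM₀ y _ (circleMap_mem_sphere' _ _ _)).trans hMM
    rcases (norm_nonneg (lineC p ℓ y (circleMap (R + Complex.I) R θ))).eq_or_lt with h | h
    · rw [← h, Real.log_zero]; exact hM
    · exact Real.log_le_log h h1
  obtain ⟨K, hK⟩ := exists_abs_logMean_le (p := p) (d := d) hpos hR.le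
  have hae := ae_restrict_of_ae (s := Set.Ioc 0 (2 * π)) (ae_circleMap_im_ne_zero hR.ne')
  rw [integrable_prod_iff hmeas.aestronglyMeasurable]
  refine ⟨?_, ?_⟩
  · filter_upwards [hae] with θ hθ
    exact integrable_log_norm_lineC hp hpos hθ
  · refine Integrable.of_bound (C := (2 * π) ^ n * (2 * Real.log M) + K)
      hmeas.norm.aestronglyMeasurable.integral_prod_right' ?_
    filter_upwards [hae] with θ hθ
    have hint := integrable_log_norm_lineC hp hpos hθ
    rw [Real.norm_eq_abs, abs_of_nonneg (integral_nonneg fun _ => norm_nonneg _)]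
    have h1 : ∫ y, ‖Real.log ‖lineC p ℓ y (circleMap (R + Complex.I) R θ)‖‖ ≤
        ∫ y, (2 * Real.log M - Real.log ‖lineC p ℓ y (circleMap (R + Complex.I) R θ)‖) := by
      refine integral_mono hint.norm ((integrable_const _).sub hint) fun y => ?_
      have := hup θ y
      rw [Real.norm_eq_abs, abs_le]
      constructor <;> linarith
    rw [integral_sub (integrable_const _) hint, integral_const, volume_real_univ_torus,
      integral_log_norm_lineC hp hpos hθ, smul_eq_mul, circleMap_centre_im] at h1
    have := neg_le_of_abs_le (hK θ)
    linarith

/-- Jensen's formula, integrated over the torus. -/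
theorem lintegral_mult_mul_lintegral_jensenKernel (hp : p ∈ LY d) (hpos : ∀ j, 0 < ℓ j)
    (hS : IsCrossSection ℓ (zeroSet p)) {R : ℝ} (hR : 0 < R) :
    (∫⁻ x, mult p x ∂crossMeasure ℓ (zeroSet p)) * ∫⁻ t, ENNReal.ofReal (jensenKernel R t) =
      ENNReal.ofReal ((2 * π)⁻¹ * (∫ θ in (0 : ℝ)..2 * π, logMean p d ℓ (1 + R * Real.sin θ)) -
        logMean p d ℓ 1) := by
  have hk : Measurable fun t => ENNReal.ofReal (jensenKernel R t) :=
    (continuous_jensenKernel R).measurable.ennreal_ofReal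
  have hm : Measurable fun x => (mult p x : ENNReal) :=
    measurable_from_nat.comp (measurable_mult hp hpos)
  -- by the formula of Campbell the sum over the zeros has a product of integrals as its mean
  have hcamp := lintegral_hitSum_eq hS
    (g := fun z => mult p z.1 * ENNReal.ofReal (jensenKernel R z.2))
    ((hm.comp measurable_fst).mul (hk.comp measurable_snd)) (fun z hz => by
      rw [jensenKernel_eq_zero hR, ENNReal.ofReal_zero, mul_zero]
      refine le_trans ?_ ((le_abs_self _).trans (abs_sub_le_norm_centre_sub R z.2))
      linarith)
  have hinner : ∀ x, ∫⁻ t, mult p x * ENNReal.ofReal (jensenKernel R t) =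
      mult p x * ∫⁻ t, ENNReal.ofReal (jensenKernel R t) := fun x => lintegral_const_mul _ hk
  simp only [hinner] at hcamp
  rw [lintegral_mul_const _ hm] at hcamp
  rw [← hcamp]
  simp only [fun y => (hitSum_jensenKernel hp hpos hS hR y).2]
  have hint := integrable_log_norm_lineC_prod hp hpos hR
  have him : ((R + Complex.I : ℂ)).im = 1 := by simp
  have hint1 := integrable_log_norm_lineC hp hpos (w := R + Complex.I) (by simp)
  have hintc : Integrable fun y : Torus n =>
      Real.circleAverage (fun w => Real.log ‖lineC p ℓ y w‖) (R + Complex.I) R := by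
    have := (hint.integral_prod_right).const_mul (2 * π)⁻¹
    refine this.congr (Eventually.of_forall fun y => ?_)
    simp only [Real.circleAverage, smul_eq_mul]
    rw [intervalIntegral.integral_of_le Real.two_pi_pos.le]
  have hnn : ∀ y : Torus n, 0 ≤
      Real.circleAverage (fun w => Real.log ‖lineC p ℓ y w‖) (R + Complex.I) R -
        Real.log ‖lineC p ℓ y (R + Complex.I)‖ := fun y =>
    (hitSum_jensenKernel hp hpos hS hR y).1
  have hlint := ofReal_integral_eq_lintegral_ofReal (hintc.sub hint1) (Eventually.of_forall hnn)
  simp only [Pi.sub_apply] at hlint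
  rw [← hlint, integral_sub hintc hint1, integral_log_norm_lineC hp hpos (by simp), him]
  congr 2
  have hswap := intervalIntegral_integral_swap (μ := (volume : Measure (Torus n)))
    (a := 0) (b := 2 * π)
    (f := fun θ y => Real.log ‖lineC p ℓ y (circleMap (R + Complex.I) R θ)‖) (by
      rw [Set.uIoc_of_le Real.two_pi_pos.le]; exact hint)
  simp only [Real.circleAverage]
  rw [integral_smul, smul_eq_mul, ← hswap]
  congr 1
  refine intervalIntegral.integral_congr_ae ?_
  filter_upwards [ae_circleMap_im_ne_zero hR.ne'] with θ hθ _
  rw [integral_log_norm_lineC hp hpos hθ, circleMap_centre_im]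

end

section

variable {n : ℕ} {ℓ : Fin n → ℝ} {p : MvPolynomial (Fin n) ℂ} {d : Fin n → ℕ}

/-! ### Asymptotics of Jensen's formula -/

/-- The kernel has mass `2R + o(R)`. -/
theorem tendsto_lintegral_jensenKernel_div :
    Tendsto (fun R : ℝ => (∫⁻ t, ENNReal.ofReal (jensenKernel R t)).toReal / R) atTop (𝓝 2) := by
  have hlog : Tendsto (fun R : ℝ => 2 * (1 - R⁻¹ - Real.log R / R)) atTop (𝓝 2) := by
    have h1 : Tendsto (fun R : ℝ => Real.log R / R) atTop (𝓝 0) :=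
      Real.isLittleO_log_id_atTop.tendsto_div_nhds_zero
    have := (((tendsto_const_nhds (x := (1 : ℝ))).sub tendsto_inv_atTop_zero).sub h1).const_mul 2
    simpa using this
  refine tendsto_of_tendsto_of_tendsto_of_le_of_le' hlog tendsto_const_nhds ?_ ?_
  · filter_upwards [eventually_ge_atTop 1] with R hR
    have hR0 : 0 < R := one_pos.trans_le hR
    have hfin : ∫⁻ t, ENNReal.ofReal (jensenKernel R t) ≠ ⊤ :=
      ne_top_of_le_ne_top ENNReal.ofReal_ne_top (lintegral_jensenKernel_le hR)
    have h1 := (ENNReal.ofReal_le_iff_le_toReal hfin).1 (le_lintegral_jensenKernel hR)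
    rw [le_div_iff₀ hR0]
    refine le_of_eq_of_le ?_ h1
    field_simp
  · filter_upwards [eventually_ge_atTop 1] with R hR
    have hR0 : 0 < R := one_pos.trans_le hR
    rw [div_le_iff₀ hR0]
    exact ENNReal.toReal_le_of_le_ofReal (by positivity) (lintegral_jensenKernel_le hR)

/-- Asymptotics of the integrated form of Jensen's formula: the circle reaches below the real line
to depth of order `R`, where the logarithmic mean has slope `⟨d, ℓ⟩`. -/
theorem tendsto_integral_logMean_div (hpos : ∀ j, 0 < ℓ j) :
    Tendsto (fun R : ℝ => ((2 * π)⁻¹ *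
      (∫ θ in (0 : ℝ)..2 * π, logMean p d ℓ (1 + R * Real.sin θ)) - logMean p d ℓ 1) / R) atTop
      (𝓝 ((2 * π) ^ n * pairing d ℓ / π)) := by
  have hpi := Real.pi_pos
  set V := (2 * π) ^ n * pairing d ℓ with hV
  set K := (2 * π) ^ n * (|Real.log ‖MvPolynomial.eval 0 p‖| +
    |Real.log ‖MvPolynomial.eval 0 (revPoly d p)‖| + pairing d ℓ)
  have hmeas : Measurable (logMean p d ℓ) := by
    unfold logMean
    refine Measurable.const_mul (Measurable.ite measurableSet_Ioi measurable_const ?_) _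
    fun_prop
  have hbound : ∀ R : ℝ, 0 < R →
      |(∫ θ in (0 : ℝ)..2 * π, logMean p d ℓ (1 + R * Real.sin θ)) - V * R * 2| ≤ K * (2 * π) := by
    intro R hR
    have hi : IntervalIntegrable (fun θ => logMean p d ℓ (1 + R * Real.sin θ)) volume
        0 (2 * π) := by
      obtain ⟨C, hC⟩ := exists_abs_logMean_le (p := p) (d := d) hpos hR.le
      rw [intervalIntegrable_iff]
      have : IsFiniteMeasure (volume.restrict (Set.uIoc 0 (2 * π))) := by
        rw [Set.uIoc_of_le (by positivity)]; infer_instance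
      exact Integrable.of_bound (C := C) (hmeas.comp (by fun_prop)).aestronglyMeasurable
        (Eventually.of_forall hC)
    have hV2 : V * R * 2 = ∫ θ in (0 : ℝ)..2 * π, V * R * max 0 (-Real.sin θ) := by
      rw [intervalIntegral.integral_const_mul, integral_max_neg_sin]
    rw [hV2, ← intervalIntegral.integral_sub hi
        (Continuous.intervalIntegrable (by fun_prop) _ _), ← Real.norm_eq_abs]
    refine (intervalIntegral.norm_integral_le_of_norm_le_const (C := K) fun θ _ => ?_).trans ?_
    · exact abs_logMean_sub_le hpos hR.le _
    · rw [sub_zero, abs_of_pos (by positivity)]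
  set K' := K + |logMean p d ℓ 1|
  refine tendsto_iff_norm_sub_tendsto_zero.2 (squeeze_zero' (Eventually.of_forall fun _ =>
    norm_nonneg _) (g := fun R => K' / R) ?_ (tendsto_const_nhds.div_atTop tendsto_id))
  filter_upwards [eventually_gt_atTop 0] with R hR
  set I := ∫ θ in (0 : ℝ)..2 * π, logMean p d ℓ (1 + R * Real.sin θ)
  have h1 : ((2 * π)⁻¹ * I - logMean p d ℓ 1) / R - V / π =
      ((2 * π)⁻¹ * (I - V * R * 2) - logMean p d ℓ 1) / R := by
    field_simp; ring
  rw [h1, norm_div, Real.norm_eq_abs, Real.norm_eq_abs, abs_of_pos hR]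
  refine div_le_div_of_nonneg_right ((abs_sub _ _).trans (add_le_add_left ?_ _)) hR.le
  rw [abs_mul, abs_of_pos (by positivity), inv_mul_le_iff₀ (by positivity)]
  linarith [hbound R hR]

/-- The mass of the cross-section, counted with multiplicity: both sides of the integrated form of
Jensen's formula are linear in the radius `R` to leading order, and their slopes are compared. -/
theorem lintegral_mult (hn : 1 ≤ n) (hp : p ∈ LY d) (hpos : ∀ j, 0 < ℓ j)
    (hS : IsCrossSection ℓ (zeroSet p)) :
    ∫⁻ x, mult p x ∂crossMeasure ℓ (zeroSet p) =
      ENNReal.ofReal ((2 * π) ^ (n - 1) * pairing d ℓ) := by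
  have hfin := isFiniteMeasure_crossMeasure hS
  set M := ∫⁻ x, mult p x ∂crossMeasure ℓ (zeroSet p) with hM
  have hMfin : M ≠ ⊤ := by
    obtain ⟨K, hK⟩ := exists_mult_le hp hpos
    refine ne_top_of_le_ne_top ?_ (lintegral_mono (g := fun _ => (K : ENNReal))
      fun x => Nat.cast_le.2 (hK x))
    rw [lintegral_const]
    exact ENNReal.mul_ne_top (ENNReal.natCast_ne_top K) (measure_ne_top _ _)
  have hV : 0 ≤ (2 * π) ^ n * pairing d ℓ / π :=
    div_nonneg (mul_nonneg (by positivity) (pairing_nonneg d hpos)) Real.pi_pos.le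
  have h1 := (tendsto_lintegral_jensenKernel_div).const_mul M.toReal
  have h2 := (tendsto_integral_logMean_div (p := p) (d := d) hpos).max (tendsto_const_nhds (x := 0))
  rw [max_eq_left hV] at h2
  have h3 := tendsto_nhds_unique (h1.congr' ?_) h2
  · rw [← ENNReal.ofReal_toReal hMfin]
    congr 1
    have hpow : (2 * π) ^ n = (2 * π) ^ (n - 1) * (2 * π) := by
      rw [← pow_succ, Nat.sub_add_cancel hn]
    rw [hpow, eq_div_iff Real.pi_ne_zero] at h3
    have : 2 * π ≠ 0 := Real.two_pi_pos.ne'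
    refine mul_right_cancel₀ this ?_
    linarith
  · filter_upwards [eventually_gt_atTop 0] with R hR
    have h := congrArg ENNReal.toReal (lintegral_mult_mul_lintegral_jensenKernel hp hpos hS hR)
    rw [ENNReal.toReal_mul, ENNReal.toReal_ofReal'] at h
    rw [← mul_div_assoc, h, ← max_div_div_right hR.le, zero_div]

end

section

/-! ### Irreducible factors and elimination -/

variable {n : ℕ} {ℓ : Fin n → ℝ} {p : MvPolynomial (Fin n) ℂ} {d : Fin n → ℕ}

theorem reduced_dvd (p : MvPolynomial (Fin n) ℂ) : reduced p ∣ p :=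
  letI : StrongNormalizationMonoid (MvPolynomial (Fin n) ℂ) :=
    UniqueFactorizationMonoid.strongNormalizationMonoid
  UniqueFactorizationMonoid.radical_dvd_self

theorem squarefree_reduced (p : MvPolynomial (Fin n) ℂ) : Squarefree (reduced p) :=
  letI : StrongNormalizationMonoid (MvPolynomial (Fin n) ℂ) :=
    UniqueFactorizationMonoid.strongNormalizationMonoid
  UniqueFactorizationMonoid.squarefree_radical

theorem dvd_reduced_iff {g : MvPolynomial (Fin n) ℂ} (hg : Irreducible g) (hp : p ≠ 0) :
    g ∣ reduced p ↔ g ∣ p :=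
  letI : StrongNormalizationMonoid (MvPolynomial (Fin n) ℂ) :=
    UniqueFactorizationMonoid.strongNormalizationMonoid
  UniqueFactorizationMonoid.dvd_radical_iff_of_irreducible hg hp

theorem exists_dvd_reduced_pow (hp : p ≠ 0) : ∃ k, p ∣ reduced p ^ k :=
  letI : StrongNormalizationMonoid (MvPolynomial (Fin n) ℂ) :=
    UniqueFactorizationMonoid.strongNormalizationMonoid
  UniqueFactorizationMonoid.exists_dvd_radical_self_pow hp

/-- Factors of Lee–Yang polynomials are Lee–Yang polynomials. -/
theorem mem_LY_of_dvd (hp : p ∈ LY d) {g : MvPolynomial (Fin n) ℂ} (hg : g ∣ p) :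
    g ∈ LY fun j => g.degreeOf j := by
  obtain ⟨r, rfl⟩ := hg
  refine ⟨fun _ => rfl, fun z hz h => hp.2.1 z hz ?_, fun z hz h => hp.2.2 z hz ?_⟩ <;>
  rw [map_mul, h, zero_mul]

theorem reduced_mem_LY (hp : p ∈ LY d) : reduced p ∈ LY (redDegree p) :=
  mem_LY_of_dvd hp (reduced_dvd p)

theorem zeroSet_subset_of_dvd {g : MvPolynomial (Fin n) ℂ} (hg : g ∣ p) :
    zeroSet g ⊆ zeroSet p := by
  obtain ⟨r, rfl⟩ := hg
  intro x hx
  change MvPolynomial.eval _ _ = 0 at hx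
  change MvPolynomial.eval _ _ = 0
  rw [map_mul, hx, zero_mul]

theorem zeroSet_reduced (hp : p ≠ 0) : zeroSet (reduced p) = zeroSet p := by
  refine (zeroSet_subset_of_dvd (reduced_dvd p)).antisymm fun x hx => ?_
  obtain ⟨k, hk⟩ := exists_dvd_reduced_pow hp
  have h : MvPolynomial.eval (expI x) (reduced p ^ k) = 0 := zeroSet_subset_of_dvd hk hx
  rw [map_pow] at h
  exact (pow_eq_zero_iff fun h0 => by simp [h0] at h).1 h

/-- Differentiation along the flow acts diagonally on the monomials. -/
theorem coeff_lineDeriv (g : MvPolynomial (Fin n) ℂ) (k : Fin n →₀ ℕ) :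
    (lineDeriv ℓ g).coeff k = (Complex.I * ∑ j, (ℓ j : ℂ) * k j) * g.coeff k := by
  induction g using MvPolynomial.induction_on generalizing k with
  | C a =>
    rw [lineDeriv, MvPolynomial.derivation_C, MvPolynomial.coeff_zero, MvPolynomial.coeff_C]
    split_ifs with h
    · rw [← h]; simp
    · simp
  | add p q hp hq => rw [map_add, MvPolynomial.coeff_add, hp, hq, MvPolynomial.coeff_add]; ring
  | mul_X p i hp =>
    have h1 : lineDeriv ℓ (p * MvPolynomial.X i) =
        MvPolynomial.C (Complex.I * ℓ i) * p * MvPolynomial.X i +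
          lineDeriv ℓ p * MvPolynomial.X i := by
      have hX : lineDeriv ℓ (MvPolynomial.X i) =
          MvPolynomial.C (Complex.I * ℓ i) * MvPolynomial.X i := by
        rw [lineDeriv, MvPolynomial.mkDerivation_X]
      rw [Derivation.leibniz, hX, smul_eq_mul, smul_eq_mul]
      ring
    rw [h1, MvPolynomial.coeff_add, MvPolynomial.coeff_mul_X', MvPolynomial.coeff_mul_X',
      MvPolynomial.coeff_mul_X']
    split_ifs with hi
    · rw [hp, MvPolynomial.coeff_C_mul]
      have hk : ∑ j, (ℓ j : ℂ) * k j =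
          ∑ j, (ℓ j : ℂ) * ((k - Finsupp.single i 1 : Fin n →₀ ℕ) j : ℕ) + ℓ i := by
        have hk1 : k = (k - Finsupp.single i 1) + Finsupp.single i 1 := by
          refine (tsub_add_cancel_of_le ?_).symm
          rw [Finsupp.single_le_iff]
          exact Nat.one_le_iff_ne_zero.2 (Finsupp.mem_support_iff.1 hi)
        conv_lhs => rw [hk1]
        simp only [Finsupp.add_apply, Nat.cast_add, mul_add, Finset.sum_add_distrib]
        congr 1
        rw [Finset.sum_eq_single_of_mem i (Finset.mem_univ i)]
        · simp
        · intro b _ hb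
          rw [Finsupp.single_eq_of_ne hb]; simp
      rw [hk]; ring
    · simp

/-- A nonconstant polynomial with `g(0) ≠ 0` does not divide its derivative along the flow: as the
degree is not raised, it would be an eigenvector, and hence a constant. -/
theorem not_dvd_lineDeriv (hpos : ∀ j, 0 < ℓ j) {g : MvPolynomial (Fin n) ℂ}
    (hg : Irreducible g) (hg0 : MvPolynomial.eval 0 g ≠ 0) : ¬ g ∣ lineDeriv ℓ g := by
  rintro ⟨c, hc⟩
  have hc0 : g.coeff 0 ≠ 0 := by
    change MvPolynomial.eval (fun _ => 0) g ≠ 0 at hg0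
    rwa [MvPolynomial.eval_zero', MvPolynomial.constantCoeff_eq] at hg0
  have hD : lineDeriv ℓ g = 0 := by
    by_contra hne
    have hcne : c ≠ 0 := by rintro rfl; exact hne (by rw [hc, mul_zero])
    have hdeg : (lineDeriv ℓ g).totalDegree ≤ g.totalDegree :=
      Finset.sup_mono fun k hk => by
        rw [MvPolynomial.mem_support_iff, coeff_lineDeriv] at hk
        exact MvPolynomial.mem_support_iff.2 (right_ne_zero_of_mul hk)
    rw [hc, MvPolynomial.totalDegree_mul_of_isDomain hg.ne_zero hcne] at hdeg
    have hcC := MvPolynomial.totalDegree_eq_zero_iff_eq_C.1 (by omega : c.totalDegree = 0)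
    have h1 := coeff_lineDeriv (ℓ := ℓ) g 0
    rw [hc, hcC, mul_comm g, MvPolynomial.coeff_C_mul] at h1
    simp only [Finsupp.coe_zero, Pi.zero_apply, Nat.cast_zero, mul_zero, Finset.sum_const_zero,
      zero_mul] at h1
    refine hcne ?_
    rw [hcC, (mul_eq_zero.1 h1).resolve_right hc0, map_zero]
  refine hg.not_isUnit ?_
  have hgC : g = MvPolynomial.C (g.coeff 0) := by
    ext k
    rw [MvPolynomial.coeff_C]
    split_ifs with hk
    · rw [hk]
    · have h1 := coeff_lineDeriv (ℓ := ℓ) g k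
      rw [hD, MvPolynomial.coeff_zero] at h1
      refine (mul_eq_zero.1 h1.symm).resolve_left (mul_ne_zero Complex.I_ne_zero ?_)
      obtain ⟨i, hi⟩ := DFunLike.ne_iff.1 (Ne.symm hk)
      have hsum : 0 < ∑ j, ℓ j * k j :=
        Finset.sum_pos' (fun j _ => mul_nonneg (hpos j).le (Nat.cast_nonneg _))
          ⟨i, Finset.mem_univ i, mul_pos (hpos i) (Nat.cast_pos.2 (Nat.pos_of_ne_zero hi))⟩
      exact_mod_cast hsum.ne'
  rw [hgC]
  exact (isUnit_iff_ne_zero.2 hc0).map MvPolynomial.C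

/-- No irreducible factor of a squarefree polynomial `q` divides the derivative of `q` along the
flow. -/
theorem not_dvd_lineDeriv_of_squarefree (hpos : ∀ j, 0 < ℓ j) {g q : MvPolynomial (Fin n) ℂ}
    (hq : Squarefree q) (hg : Irreducible g) (hg0 : MvPolynomial.eval 0 g ≠ 0) (hgq : g ∣ q) :
    ¬ g ∣ lineDeriv ℓ q := by
  obtain ⟨r, rfl⟩ := hgq
  intro h
  rw [Derivation.leibniz, smul_eq_mul, smul_eq_mul, dvd_add_right (dvd_mul_right g _)] at h
  rcases (UniqueFactorizationMonoid.irreducible_iff_prime.1 hg).dvd_or_dvd h with h | h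
  · exact hg.not_isUnit (hq g (mul_dvd_mul_left g h))
  · exact not_dvd_lineDeriv hpos hg hg0 h

/-- **Elimination**: an irreducible polynomial over a factorial domain `R` and a polynomial that it
does not divide have a nonzero constant combination, by Gauss's lemma. -/
theorem exists_combination_eq_C {R : Type*} [CommRing R] [IsDomain R]
    [UniqueFactorizationMonoid R] {g w : Polynomial R} (hg : Irreducible g) (hw : ¬ g ∣ w) :
    ∃ a b : Polynomial R, ∃ r : R, r ≠ 0 ∧ a * g + b * w = Polynomial.C r := by
  by_cases hdeg : g.natDegree = 0
  · refine ⟨1, 0, g.coeff 0, fun h => hg.ne_zero ?_, ?_⟩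
    · rw [Polynomial.eq_C_of_natDegree_eq_zero hdeg, h, map_zero]
    · rw [← Polynomial.eq_C_of_natDegree_eq_zero hdeg]; ring
  have hprim := hg.isPrimitive hdeg
  set K := FractionRing R
  have hgcd : IsGCDMonoid R := inferInstance
  have hgK := (hprim.irreducible_iff_irreducible_map_fraction_map (K := K)).1 hg
  have hwK : ¬ g.map (algebraMap R K) ∣ w.map (algebraMap R K) := fun h =>
    hw (hprim.dvd_of_fraction_map_dvd_fraction_map h)
  obtain ⟨a, b, hab⟩ := hgK.coprime_iff_not_dvd.2 hwK
  -- clear the denominators of the Bézout coefficients over the fraction field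
  obtain ⟨s, hs, hs'⟩ := IsLocalization.integerNormalization_spec (nonZeroDivisors R) a
  obtain ⟨t, ht, ht'⟩ := IsLocalization.integerNormalization_spec (nonZeroDivisors R) b
  set a' := IsLocalization.integerNormalization (nonZeroDivisors R) a
  set b' := IsLocalization.integerNormalization (nonZeroDivisors R) b
  refine ⟨Polynomial.C t * a', Polynomial.C s * b', s * t,
    mul_ne_zero (nonZeroDivisors.ne_zero hs) (nonZeroDivisors.ne_zero ht), ?_⟩
  apply Polynomial.map_injective (algebraMap R K) (IsFractionRing.injective R K)
  have e : ∀ (x : R) (f : Polynomial K), x • f = Polynomial.C (algebraMap R K x) * f :=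
      fun x f => by
    rw [← Polynomial.smul_eq_C_mul, algebraMap_smul]
  simp only [Polynomial.map_add, Polynomial.map_mul, Polynomial.map_C, hs', ht', e, map_mul]
  linear_combination (Polynomial.C (algebraMap R K s) * Polynomial.C (algebraMap R K t)) * hab

/-- The isomorphism that singles out the variable `z_j`. -/
def singleOut {k : ℕ} (j : Fin (k + 1)) :
    MvPolynomial (Fin (k + 1)) ℂ ≃ₐ[ℂ] Polynomial (MvPolynomial (Fin k) ℂ) :=
  (MvPolynomial.renameEquiv ℂ j.cycleRange).trans (MvPolynomial.finSuccEquiv ℂ k)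

theorem eval_singleOut {k : ℕ} (j : Fin (k + 1)) (f : MvPolynomial (Fin (k + 1)) ℂ)
    (z : Fin (k + 1) → ℂ) :
    ((singleOut j f).map (MvPolynomial.eval fun i => z (j.succAbove i))).eval (z j) =
      MvPolynomial.eval z f := by
  rw [singleOut, AlgEquiv.trans_apply, ← MvPolynomial.eval_eq_eval_mv_eval',
    MvPolynomial.renameEquiv_apply, MvPolynomial.eval_rename]
  congr 2
  funext i
  rcases Fin.eq_self_or_eq_succAbove j i with rfl | ⟨i, rfl⟩
  · simp
  · simp [Fin.cycleRange_succAbove]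

/-- On the common zeros of an irreducible polynomial and a polynomial that it does not divide, any
coordinate can be eliminated. -/
theorem exists_eliminant {k : ℕ} {g w : MvPolynomial (Fin (k + 1)) ℂ} (hg : Irreducible g)
    (hw : ¬ g ∣ w) (j : Fin (k + 1)) :
    ∃ r : MvPolynomial (Fin k) ℂ, r ≠ 0 ∧ ∀ z, MvPolynomial.eval z g = 0 →
      MvPolynomial.eval z w = 0 → MvPolynomial.eval (fun i => z (j.succAbove i)) r = 0 := by
  obtain ⟨a, b, r, hr, hab⟩ := exists_combination_eq_C
    ((MulEquiv.irreducible_iff (singleOut j)).2 hg) (fun h => hw ((map_dvd_iff (singleOut j)).1 h))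
  refine ⟨r, hr, fun z hz hz' => ?_⟩
  have h := congrArg (fun f : Polynomial (MvPolynomial (Fin k) ℂ) =>
    (f.map (MvPolynomial.eval fun i => z (j.succAbove i))).eval (z j)) hab
  simp only [Polynomial.map_add, Polynomial.map_mul, Polynomial.eval_add, Polynomial.eval_mul,
    eval_singleOut, hz, hz', mul_zero, add_zero, Polynomial.map_C, Polynomial.eval_C] at h
  exact h.symm

/-- The zeros of a nonzero polynomial on the torus form a null set. -/
theorem volume_eval_circleMap_eq_zero {k : ℕ} {r : MvPolynomial (Fin k) ℂ} (hr : r ≠ 0) :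
    volume {u : Fin k → ℝ | MvPolynomial.eval (fun i => circleMap 0 1 (u i)) r = 0} = 0 := by
  induction k with
  | zero =>
    have : {u : Fin 0 → ℝ | MvPolynomial.eval (fun i => circleMap 0 1 (u i)) r = 0} = ∅ := by
      refine Set.eq_empty_of_forall_notMem fun u hu => hr ?_
      have hu : MvPolynomial.eval (fun i => circleMap 0 1 (u i)) r = 0 := hu
      rw [MvPolynomial.eq_C_of_isEmpty r, MvPolynomial.eval_C] at hu
      rw [MvPolynomial.eq_C_of_isEmpty r, hu, map_zero]
    rw [this, measure_empty]
  | succ k ih =>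
    set F := MvPolynomial.finSuccEquiv ℂ k r with hF
    have hF0 : F ≠ 0 := (map_ne_zero_iff _ (MvPolynomial.finSuccEquiv ℂ k).injective).2 hr
    set A : Set ((Fin k → ℝ) × ℝ) := {v | MvPolynomial.eval
      (Fin.cons (circleMap 0 1 v.2) fun i => circleMap 0 1 (v.1 i)) r = 0} with hA
    have hAc : IsClosed A := by
      refine isClosed_eq ((MvPolynomial.continuous_eval r).comp (continuous_pi fun i => ?_))
        continuous_const
      refine Fin.cases ?_ (fun i => ?_) i
      · exact (continuous_circleMap 0 1).comp continuous_snd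
      · exact (continuous_circleMap 0 1).comp ((continuous_apply i).comp continuous_fst)
    -- Fubini: for almost all values of the other coordinates, a nonzero polynomial remains
    have hA0 : (volume.prod volume) A = 0 := by
      rw [Measure.measure_prod_null hAc.measurableSet]
      have hae := measure_eq_zero_iff_ae_notMem.1 (ih (Polynomial.leadingCoeff_ne_zero.2 hF0))
      filter_upwards [hae] with u hu
      set f := F.map (MvPolynomial.eval fun i => circleMap 0 1 (u i)) with hf
      have hf0 : f ≠ 0 := by
        intro h
        refine hu ?_
        have := congrArg (fun q => Polynomial.coeff q F.natDegree) h
        simpa [hf] using this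
      refine measure_mono_null (t := circleMap 0 1 ⁻¹' (f.roots.toFinset : Set ℂ)) (fun t ht => ?_)
        ((f.roots.toFinset.countable_toSet.preimage_circleMap 0 one_ne_zero).measure_zero _)
      have ht : MvPolynomial.eval (Fin.cons (circleMap 0 1 t) fun i => circleMap 0 1 (u i)) r = 0 :=
        ht
      rw [MvPolynomial.eval_eq_eval_mv_eval'] at ht
      simpa [hf0] using ht
    have hmp := (volume_preserving_piFinSuccAbove (fun _ : Fin (k + 1) => ℝ) 0)
    have hmp' : MeasurePreserving (fun u : Fin (k + 1) → ℝ =>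
        (MeasurableEquiv.piFinSuccAbove (fun _ => ℝ) 0 u).swap) volume (volume.prod volume) :=
      Measure.measurePreserving_swap.comp hmp
    have h0 := hmp'.measure_preimage hAc.measurableSet.nullMeasurableSet
    rw [hA0] at h0
    refine measure_mono_null (fun u hu => ?_) h0
    change MvPolynomial.eval _ r = 0
    have hu : MvPolynomial.eval (fun i => circleMap 0 1 (u i)) r = 0 := hu
    refine Eq.trans ?_ hu
    congr 2
    funext i
    refine Fin.cases ?_ (fun i => ?_) i
    · rfl
    · rfl

end

section

/-! ### Hausdorff measure and the measure of the cross-section -/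

variable {n : ℕ} {ℓ : Fin n → ℝ} {S : Set (Torus n)} {p : MvPolynomial (Fin n) ℂ} {d : Fin n → ℕ}

theorem dist_flow_le (hpos : ∀ j, 0 < ℓ j) (t : ℝ) (y : Torus n) :
    dist (flow ℓ t y) y ≤ |t| * ∑ j, ℓ j := by
  refine (dist_pi_le_iff (mul_nonneg (abs_nonneg t)
    (Finset.sum_nonneg fun j _ => (hpos j).le))).2 fun j => ?_
  rw [flow, dist_eq_norm, add_sub_cancel_left]
  refine QuotientAddGroup.norm_mk_le_norm.trans ?_
  rw [Real.norm_eq_abs, abs_mul, abs_of_pos (hpos j)]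
  exact mul_le_mul_of_nonneg_left
    (Finset.single_le_sum (fun j _ => (hpos j).le) (Finset.mem_univ j)) (abs_nonneg t)

theorem volume_closedBall_torus_le (a : Torus n) {r : ℝ} (hr : 0 ≤ r) :
    volume (Metric.closedBall a r) ≤ ENNReal.ofReal (2 * r) ^ n := by
  rw [closedBall_pi a hr, volume_pi_pi]
  calc ∏ j, volume (Metric.closedBall (a j) r) ≤ ∏ _j : Fin n, ENNReal.ofReal (2 * r) := by
        refine Finset.prod_le_prod' fun j _ => ?_
        rw [AddCircle.volume_closedBall]
        exact ENNReal.ofReal_le_ofReal (min_le_right _ _)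
    _ = ENNReal.ofReal (2 * r) ^ n := by
        rw [Finset.prod_const, Finset.card_univ, Fintype.card_fin]

/-- A ball of radius `r` has cross-sectional measure `O(r^(n-1))`: the orbits that visit it during
a time interval of length `r` start in a ball of comparable radius. -/
theorem exists_crossMeasure_closedBall_le (hn : 1 ≤ n) (hpos : ∀ j, 0 < ℓ j)
    (hS : IsCrossSection ℓ S) :
    ∃ C : ENNReal, C ≠ 0 ∧ C ≠ ⊤ ∧ ∀ (a : Torus n) (r : ℝ), 0 < r → r ≤ 1 →
      crossMeasure ℓ S (Metric.closedBall a r) ≤ C * ENNReal.ofReal r ^ (n - 1) := by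
  obtain ⟨K, hK⟩ := exists_hitSum_le hS
  set L := 2 * (1 + ∑ j, ℓ j) with hL
  have hsum : 0 ≤ ∑ j, ℓ j := Finset.sum_nonneg fun j _ => (hpos j).le
  have hLpos : 0 < L := by positivity
  refine ⟨(K + 1) * ENNReal.ofReal L ^ n, mul_ne_zero (by simp)
    (pow_ne_zero _ (ENNReal.ofReal_pos.2 hLpos).ne'), ENNReal.mul_ne_top (by simp)
    (ENNReal.pow_ne_top ENNReal.ofReal_ne_top), fun a r hr hr1 => ?_⟩
  set A := Metric.closedBall a r
  set A' := Metric.closedBall a (L / 2 * r)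
  -- a visit to the ball during `(0, r]` forces `y` to lie in a ball of radius `L / 2 * r`
  have hpt : ∀ y, hitSum ℓ S (boxIndicator A (Set.Ioc 0 r)) y ≤
      A'.indicator (fun _ => (K : ENNReal)) y := by
    intro y
    by_cases hy : y ∈ A'
    · rw [Set.indicator_of_mem hy]
      refine le_trans (hitSum_mono fun t _ => ?_) (hK A y)
      refine Set.indicator_le_indicator_of_subset
        (Set.prod_mono le_rfl (Set.Ioc_subset_Ioc_right hr1)) (fun _ => zero_le) _
    · rw [Set.indicator_of_notMem hy, hitSum]
      refine (ENNReal.tsum_eq_zero.2 fun t => ?_).le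
      refine Set.indicator_apply_eq_zero.2 fun _ => Set.indicator_of_notMem (fun h => hy ?_) _
      have h1 : dist (flow ℓ t y) a ≤ r := h.1
      have ht : t ∈ Set.Ioc 0 r := h.2
      have h2 := dist_flow_le hpos t y
      rw [abs_of_pos ht.1] at h2
      have h3 : t * ∑ j, ℓ j ≤ r * ∑ j, ℓ j := mul_le_mul_of_nonneg_right ht.2 hsum
      rw [Metric.mem_closedBall]
      calc dist y a ≤ dist y (flow ℓ t y) + dist (flow ℓ t y) a := dist_triangle _ _ _
        _ ≤ r * ∑ j, ℓ j + r := by rw [dist_comm y]; linarith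
        _ = L / 2 * r := by rw [hL]; ring
  have h1 := lintegral_hitSum_Ioc hS (A := A) Metric.isClosed_closedBall.measurableSet hr.le
  have h2 := lintegral_mono (μ := (volume : Measure (Torus n))) hpt
  rw [h1, lintegral_indicator_const Metric.isClosed_closedBall.measurableSet, sub_zero] at h2
  have h3 : volume A' ≤ ENNReal.ofReal (L * r) ^ n := by
    refine (volume_closedBall_torus_le a (by positivity)).trans (le_of_eq ?_)
    congr 2; ring
  have hr0 : ENNReal.ofReal r ≠ 0 := (ENNReal.ofReal_pos.2 hr).ne'
  rw [← ENNReal.mul_le_mul_iff_right hr0 ENNReal.ofReal_ne_top]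
  calc ENNReal.ofReal r * crossMeasure ℓ S A ≤ K * volume A' := h2
    _ ≤ (K + 1) * ENNReal.ofReal (L * r) ^ n := mul_le_mul' le_self_add h3
    _ = ENNReal.ofReal r * ((K + 1) * ENNReal.ofReal L ^ n * ENNReal.ofReal r ^ (n - 1)) := by
        rw [ENNReal.ofReal_mul hLpos.le, mul_pow]
        have : ENNReal.ofReal r ^ n = ENNReal.ofReal r ^ (n - 1) * ENNReal.ofReal r := by
          rw [← pow_succ, Nat.sub_add_cancel hn]
        rw [this]; ring

/-- Sets of vanishing `(n-1)`-dimensional Hausdorff measure are null for the measure of the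
cross-section. -/
theorem crossMeasure_eq_zero_of_hausdorffMeasure (hn : 1 ≤ n) (hpos : ∀ j, 0 < ℓ j)
    (hS : IsCrossSection ℓ S) {E : Set (Torus n)}
    (hE : Measure.hausdorffMeasure ((n : ℝ) - 1) E = 0) : crossMeasure ℓ S E = 0 := by
  obtain ⟨C, hC0, hCt, hC⟩ := exists_crossMeasure_closedBall_le hn hpos hS
  have hcast : (n : ℝ) - 1 = ((n - 1 : ℕ) : ℝ) := by rw [Nat.cast_sub hn, Nat.cast_one]
  -- every set is contained in a ball with its diameter as radius
  have hle : C⁻¹ • crossMeasure ℓ S ≤ Measure.hausdorffMeasure ((n : ℝ) - 1) := by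
    refine Measure.le_hausdorffMeasure _ _ (1 / 2) (by simp) fun s hs => ?_
    rcases s.eq_empty_or_nonempty with rfl | ⟨a, ha⟩
    · simp
    rw [Measure.smul_apply, smul_eq_mul, hcast, ENNReal.rpow_natCast]
    have hst : Metric.ediam s ≠ ⊤ := ne_top_of_le_ne_top (by simp) hs
    set δ := (Metric.ediam s).toReal with hδ
    have hδs : Metric.ediam s = ENNReal.ofReal δ := (ENNReal.ofReal_toReal hst).symm
    have hδ2 : δ ≤ 1 / 2 := by
      have := ENNReal.toReal_mono (by simp) hs
      simpa using this
    have hδ0 : 0 ≤ δ := ENNReal.toReal_nonneg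
    have hlim : Tendsto (fun r : ℝ => C⁻¹ * (C * ENNReal.ofReal r ^ (n - 1))) (𝓝[>] δ)
        (𝓝 (Metric.ediam s ^ (n - 1))) := by
      have h1 : (fun r : ℝ => C⁻¹ * (C * ENNReal.ofReal r ^ (n - 1))) =
          fun r => ENNReal.ofReal r ^ (n - 1) := by
        funext r
        rw [← mul_assoc, ENNReal.inv_mul_cancel hC0 hCt, one_mul]
      rw [h1, hδs]
      exact (((ENNReal.continuous_pow _).comp ENNReal.continuous_ofReal).tendsto δ).mono_left
        nhdsWithin_le_nhds
    refine ge_of_tendsto hlim ?_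
    filter_upwards [self_mem_nhdsWithin, nhdsWithin_le_nhds (gt_mem_nhds (by linarith : δ < 1))]
      with r hr hr1
    have hr : δ < r := hr
    refine mul_le_mul' le_rfl (le_trans (measure_mono fun x hx => ?_)
      (hC a r (hδ0.trans_lt hr) hr1.le))
    have h2 := Metric.edist_le_ediam_of_mem hx ha
    rw [hδs, edist_dist] at h2
    exact ((ENNReal.ofReal_le_ofReal_iff hδ0).1 h2).trans hr.le
  have h0 := hle E
  rw [hE, Measure.smul_apply, smul_eq_mul, nonpos_iff_eq_zero, mul_eq_zero] at h0
  exact h0.resolve_left (ENNReal.inv_ne_zero.2 hCt)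

/-! ### The tangency set is null -/

/-- The quotient map from `ℝⁿ` to the torus. -/
def toTorus (u : Fin n → ℝ) : Torus n := fun j => (u j : AddCircle (2 * π))

theorem lipschitzWith_toTorus : LipschitzWith 1 (toTorus (n := n)) := by
  refine LipschitzWith.of_dist_le_mul fun u v => ?_
  rw [NNReal.coe_one, one_mul]
  refine (dist_pi_le_iff dist_nonneg).2 fun j => ?_
  refine le_trans ?_ (dist_le_pi_dist u v j)
  rw [toTorus, toTorus, dist_eq_norm, dist_eq_norm, ← AddCircle.coe_sub]
  exact QuotientAddGroup.norm_mk_le_norm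

theorem surjective_toTorus : Function.Surjective (toTorus (n := n)) := fun x =>
  ⟨fun j => (QuotientAddGroup.mk_surjective (x j)).choose, funext fun j =>
    (QuotientAddGroup.mk_surjective (x j)).choose_spec⟩

theorem flow_toTorus (t : ℝ) (u : Fin n → ℝ) : flow ℓ t (toTorus u) = toTorus (u + t • ℓ) := by
  funext j
  simp [flow, toTorus]

theorem expI_toTorus (u : Fin n → ℝ) : expI (toTorus u) = fun j => circleMap 0 1 (u j) := by
  funext j
  rw [expI, toTorus, toCircle_coe]
  simp [circleMap]

/-- The function `u ↦ h(exp(iu))` on `ℝⁿ`. -/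
def expPoly (h : MvPolynomial (Fin n) ℂ) (u : Fin n → ℝ) : ℂ :=
  MvPolynomial.eval (fun j => circleMap 0 1 (u j)) h

theorem contDiff_expPoly (h : MvPolynomial (Fin n) ℂ) : ContDiff ℝ 1 (expPoly h) := by
  have : expPoly h = fun u => ∑ k ∈ h.support, h.coeff k *
      ∏ j, Complex.exp (((u j : ℝ) : ℂ) * Complex.I) ^ k j := by
    funext u
    rw [expPoly, MvPolynomial.eval_eq']
    simp [circleMap]
  rw [this]
  refine ContDiff.sum fun k _ => contDiff_const.mul (contDiff_prod fun j _ => ContDiff.pow ?_ _)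
  exact ((Complex.ofRealCLM.contDiff.comp (contDiff_apply ℝ ℝ j)).mul contDiff_const).cexp

theorem expPoly_eq_zero_iff {h : MvPolynomial (Fin n) ℂ} {u : Fin n → ℝ} :
    expPoly h u = 0 ↔ toTorus u ∈ zeroSet h := by
  rw [expPoly, ← expI_toTorus]; rfl

theorem fderiv_expPoly_apply (h : MvPolynomial (Fin n) ℂ) (u : Fin n → ℝ) :
    fderiv ℝ (expPoly h) u ℓ = expPoly (lineDeriv ℓ h) u := by
  have h1 : HasDerivAt (fun t : ℝ => u + t • ℓ) ℓ 0 := by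
    simpa using ((hasDerivAt_id (0 : ℝ)).smul_const ℓ).const_add u
  have h2 : HasFDerivAt (expPoly h) (fderiv ℝ (expPoly h) u) (u + (0 : ℝ) • ℓ) := by
    rw [zero_smul, add_zero]
    exact ((contDiff_expPoly h).differentiable one_ne_zero u).hasFDerivAt
  have h3 := h2.comp_hasDerivAt 0 h1
  have h4 := hasDerivAt_lineFun (ℓ := ℓ) h (toTorus u) 0
  have h5 : expPoly h ∘ (fun t : ℝ => u + t • ℓ) = lineFun h ℓ (toTorus u) := by
    funext t
    rw [Function.comp, lineFun, flow_toTorus, expI_toTorus]; rfl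
  rw [h5] at h3
  rw [h3.unique h4, lineFun, flow_zero, expI_toTorus]; rfl

/-- Near a point where the partial derivative in the direction `e_j` does not vanish, the zeros of
a function form a Lipschitz graph over the remaining coordinates. -/
theorem exists_dist_le_of_fderiv_single_ne_zero {k : ℕ} {F : (Fin (k + 1) → ℝ) → ℂ}
    {F' : (Fin (k + 1) → ℝ) →L[ℝ] ℂ} {u₀ : Fin (k + 1) → ℝ} (hF : HasStrictFDerivAt F F' u₀)
    {j : Fin (k + 1)} (hj : F' (Pi.single j 1) ≠ 0) :
    ∃ V ∈ 𝓝 u₀, ∃ K : NNReal, ∀ u ∈ V, ∀ v ∈ V, F u = 0 → F v = 0 →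
      dist u v ≤ K * dist (fun i => u (j.succAbove i)) (fun i => v (j.succAbove i)) := by
  have hc : 0 < ‖F' (Pi.single j 1)‖ := norm_pos_iff.2 hj
  set c := ‖F' (Pi.single j 1)‖
  have hev := hF.isLittleO.bound (half_pos hc)
  rw [nhds_prod_eq] at hev
  -- strict differentiability, with half the size of the partial derivative as the error
  obtain ⟨V, hV, hVV⟩ := (eventually_prod_self_iff
    (r := fun u v => ‖F u - F v - F' (u - v)‖ ≤ c / 2 * ‖u - v‖)).1 hev
  refine ⟨V, hV, (1 + (1 + 2 * ‖F'‖ / c)).toNNReal, fun u hu v hv hu0 hv0 => ?_⟩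
  rw [Real.coe_toNNReal _ (by positivity), dist_eq_norm, dist_eq_norm]
  have h1 := hVV u hu v hv
  rw [hu0, hv0, sub_zero, zero_sub, norm_neg] at h1
  set w := u - v with hw
  set δ := ‖(fun i => u (j.succAbove i)) - fun i => v (j.succAbove i)‖ with hδ
  have hδ0 : 0 ≤ δ := norm_nonneg _
  have hcoord : ∀ i, |w (j.succAbove i)| ≤ δ := fun i =>
    norm_le_pi_norm ((fun i => u (j.succAbove i)) - fun i => v (j.succAbove i)) i
  have h2 : ‖w - w j • Pi.single j (1 : ℝ)‖ ≤ δ := by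
    refine (pi_norm_le_iff_of_nonneg hδ0).2 fun i => ?_
    rcases Fin.eq_self_or_eq_succAbove j i with rfl | ⟨i, rfl⟩
    · simpa using hδ0
    · simpa [Pi.single_eq_of_ne (Fin.succAbove_ne j i)] using hcoord i
  have h3 : ‖w‖ ≤ |w j| + δ := by
    refine (pi_norm_le_iff_of_nonneg (by positivity)).2 fun i => ?_
    rcases Fin.eq_self_or_eq_succAbove j i with rfl | ⟨i, rfl⟩
    · rw [Real.norm_eq_abs]; linarith
    · exact (hcoord i).trans (by linarith [abs_nonneg (w j)])
  have h4 : |w j| * c ≤ ‖F' w‖ + ‖F'‖ * δ := by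
    have e : w j • F' (Pi.single j 1) = F' w - F' (w - w j • Pi.single j (1 : ℝ)) := by
      rw [F'.map_sub w, F'.map_smul, sub_sub_cancel]
    rw [← Real.norm_eq_abs, ← norm_smul, e]
    refine (norm_sub_le _ _).trans (add_le_add le_rfl ?_)
    exact (F'.le_opNorm _).trans (mul_le_mul_of_nonneg_left h2 (norm_nonneg _))
  have h5 : |w j| ≤ (1 + 2 * ‖F'‖ / c) * δ := by
    have h6 : |w j| * c ≤ c / 2 * (|w j| + δ) + ‖F'‖ * δ :=
      h4.trans (add_le_add (h1.trans (mul_le_mul_of_nonneg_left h3 (by positivity))) le_rfl)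
    have h7 : |w j| * c ≤ (1 + 2 * ‖F'‖ / c) * δ * c := by
      have : (1 + 2 * ‖F'‖ / c) * δ * c = (c + 2 * ‖F'‖) * δ := by field_simp
      rw [this]; linarith
    exact le_of_mul_le_mul_right h7 hc
  calc ‖w‖ ≤ |w j| + δ := h3
    _ ≤ (1 + 2 * ‖F'‖ / c) * δ + δ := by linarith
    _ = _ := by ring

/-- A set of zeros of `expPoly h` at which the derivative along the flow does not vanish is
`k`-dimensionally null if its projections along all coordinates lie in zero sets of nonzero
polynomials. -/
theorem hausdorffMeasure_eq_zero_of_eliminants {k : ℕ} {ℓ : Fin (k + 1) → ℝ}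
    (h : MvPolynomial (Fin (k + 1)) ℂ) {r : Fin (k + 1) → MvPolynomial (Fin k) ℂ}
    (hr : ∀ j, r j ≠ 0) :
    Measure.hausdorffMeasure (k : ℝ) {u | expPoly h u = 0 ∧ expPoly (lineDeriv ℓ h) u ≠ 0 ∧
      ∀ j, expPoly (r j) (fun i => u (j.succAbove i)) = 0} = 0 := by
  refine measure_null_of_locally_null _ fun u₀ hu₀ => ?_
  set A := {u | expPoly h u = 0 ∧ expPoly (lineDeriv ℓ h) u ≠ 0 ∧
      ∀ j, expPoly (r j) (fun i => u (j.succAbove i)) = 0}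
  set F' := fderiv ℝ (expPoly h) u₀ with hF'
  -- some partial derivative does not vanish, as the one along `ℓ` does not
  have hex : ∃ j, F' (Pi.single j 1) ≠ 0 := by
    by_contra! hcon
    refine hu₀.2.1 ?_
    rw [← fderiv_expPoly_apply, ← hF', pi_eq_sum_univ' ℓ, map_sum]
    refine Finset.sum_eq_zero fun j _ => ?_
    rw [map_smul, hcon, smul_zero]
  obtain ⟨j, hj⟩ := hex
  obtain ⟨V, hV, K, hK⟩ := exists_dist_le_of_fderiv_single_ne_zero
    ((contDiff_expPoly h).contDiffAt.hasStrictFDerivAt one_ne_zero) hj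
  refine ⟨A ∩ V, inter_mem self_mem_nhdsWithin (mem_nhdsWithin_of_mem_nhds hV), ?_⟩
  set π' : ↥(A ∩ V) → Fin k → ℝ := fun u i => (u : Fin (k + 1) → ℝ) (j.succAbove i)
  have hanti : AntilipschitzWith K π' := AntilipschitzWith.of_le_mul_dist fun u v =>
    hK u u.2.2 v v.2.2 u.2.1.1 v.2.1.1
  have hle := hanti.le_hausdorffMeasure_image (Nat.cast_nonneg k) Set.univ
  have himg : Measure.hausdorffMeasure (k : ℝ) (π' '' Set.univ) = 0 := by
    have hmu : Measure.hausdorffMeasure (k : ℝ) = (volume : Measure (Fin k → ℝ)) := by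
      simpa using hausdorffMeasure_pi_real (ι := Fin k)
    rw [hmu]
    refine measure_mono_null ?_ (volume_eval_circleMap_eq_zero (hr j))
    rintro _ ⟨u, -, rfl⟩
    exact u.2.1.2.2 j
  rw [himg, mul_zero, nonpos_iff_eq_zero] at hle
  have hiso := (isometry_subtype_coe (s := A ∩ V)).hausdorffMeasure_image
    (d := (k : ℝ)) (Or.inl (Nat.cast_nonneg k)) Set.univ
  rwa [hle, Set.image_univ, Subtype.range_coe] at hiso

theorem exists_eliminant_of_forall_irreducible {k : ℕ} {q w : MvPolynomial (Fin (k + 1)) ℂ}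
    (hq : q ≠ 0) (hw : ∀ g, Irreducible g → g ∣ q → ¬ g ∣ w) (j : Fin (k + 1)) :
    ∃ r : MvPolynomial (Fin k) ℂ, r ≠ 0 ∧ ∀ z, MvPolynomial.eval z q = 0 →
      MvPolynomial.eval z w = 0 → MvPolynomial.eval (fun i => z (j.succAbove i)) r = 0 := by
  induction q using WfDvdMonoid.induction_on_irreducible with
  | zero => exact absurd rfl hq
  | unit u hu =>
    refine ⟨1, one_ne_zero, fun z hz => ?_⟩
    exact absurd hz (hu.map (MvPolynomial.eval z)).ne_zero
  | mul a g ha hg ih =>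
    obtain ⟨r₁, hr₁, h₁⟩ := ih ha fun f hf hfa => hw f hf (hfa.mul_left g)
    obtain ⟨r₂, hr₂, h₂⟩ := exists_eliminant hg (hw g hg (dvd_mul_right g a)) j
    refine ⟨r₁ * r₂, mul_ne_zero hr₁ hr₂, fun z hz hz' => ?_⟩
    rw [map_mul, mul_eq_zero] at hz
    rw [map_mul]
    rcases hz with hz | hz
    · rw [h₂ z hz hz', mul_zero]
    · rw [h₁ z hz hz', zero_mul]

/-- The points of the zero set at which the reduced polynomial `q` vanishes to higher order along
the flow form a null set. All coordinates can be eliminated from the two equations, and the set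
lies on countably many graphs, given by the zeros of the derivatives of `q`. -/
theorem hausdorffMeasure_tangency_eq_zero {q : MvPolynomial (Fin n) ℂ} (hn : 1 ≤ n)
    (hq : q ∈ LY d) (hsq : Squarefree q) (hpos : ∀ j, 0 < ℓ j) :
    Measure.hausdorffMeasure ((n : ℝ) - 1) (zeroSet q ∩ zeroSet (lineDeriv ℓ q)) = 0 := by
  obtain ⟨k, rfl⟩ := Nat.exists_eq_add_of_le' hn
  have hcast : ((k + 1 : ℕ) : ℝ) - 1 = k := by push_cast; ring
  rw [hcast]
  have hw : ∀ g, Irreducible g → g ∣ q → ¬ g ∣ lineDeriv ℓ q := fun g hg hgq =>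
    not_dvd_lineDeriv_of_squarefree hpos hsq hg
      ((mem_LY_of_dvd hq hgq).2.1 0 fun j => by simp) hgq
  choose r hr hrz using fun j => exists_eliminant_of_forall_irreducible (ne_zero_of_mem_LY hq) hw j
  -- points at which the `m`-th, but not the next derivative along the flow vanishes; a tangency of
  -- multiplicity `m + 1` is of this kind
  set A : ℕ → Set (Fin (k + 1) → ℝ) := fun m => {u | expPoly ((lineDeriv ℓ)^[m] q) u = 0 ∧
    expPoly (lineDeriv ℓ ((lineDeriv ℓ)^[m] q)) u ≠ 0 ∧
      ∀ j, expPoly (r j) (fun i => u (j.succAbove i)) = 0}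
  have hA : Measure.hausdorffMeasure (k : ℝ) (⋃ m, A m) = 0 :=
    measure_iUnion_null fun m => hausdorffMeasure_eq_zero_of_eliminants _ hr
  have himg := lipschitzWith_toTorus.hausdorffMeasure_image_le (Nat.cast_nonneg k) (⋃ m, A m)
  rw [hA, mul_zero, nonpos_iff_eq_zero] at himg
  refine measure_mono_null (fun x hx => ?_) himg
  obtain ⟨u, rfl⟩ := surjective_toTorus x
  refine ⟨u, Set.mem_iUnion.2 ⟨mult q (toTorus u) - 1, ?_, ?_, fun j => ?_⟩, rfl⟩
  · have h1 := (mult_pos_iff hq hpos).2 hx.1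
    rw [expPoly_eq_zero_iff]
    exact (le_mult_iff hq hpos).1 le_rfl _ (by omega)
  · have h1 := (mult_pos_iff hq hpos).2 hx.1
    rw [← Function.iterate_succ_apply' (lineDeriv ℓ) _ q,
      show (mult q (toTorus u) - 1).succ = mult q (toTorus u) from by omega, Ne,
        expPoly_eq_zero_iff]
    intro h2
    have h3 := (le_mult_iff hq hpos (x := toTorus u) (k := mult q (toTorus u) + 1)).2 fun i hi => by
      rcases Nat.lt_succ_iff_lt_or_eq.1 hi with hi | rfl
      · exact (le_mult_iff hq hpos).1 le_rfl i hi
      · exact h2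
    omega
  · have h1 : expPoly q u = 0 := expPoly_eq_zero_iff.2 hx.1
    have h2 : expPoly (lineDeriv ℓ q) u = 0 := expPoly_eq_zero_iff.2 hx.2
    have h3 := hrz j (fun i => circleMap 0 1 (u i))
    rw [expPoly] at h1 h2
    rw [expPoly]
    exact h3 h1 h2

end

section

/-! ### Transversality of the flow to the zero set -/

variable {n : ℕ} {ℓ : Fin n → ℝ} {p q : MvPolynomial (Fin n) ℂ} {d : Fin n → ℕ}

theorem mult_eq_zero (hp : p ∈ LY d) (hpos : ∀ j, 0 < ℓ j) {x : Torus n} (hx : x ∉ zeroSet p) :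
    mult p x = 0 := by
  rwa [← mult_pos_iff hp hpos, Nat.pos_iff_ne_zero, not_not] at hx

theorem mult_eq_one (hq : q ∈ LY d) (hpos : ∀ j, 0 < ℓ j) {x : Torus n} (hx : x ∈ zeroSet q)
    (hx' : x ∉ zeroSet (lineDeriv ℓ q)) : mult q x = 1 := by
  refine le_antisymm (not_lt.1 fun h => hx' ?_) ((mult_pos_iff hq hpos).2 hx)
  exact (le_mult_iff hq hpos).1 (Nat.succ_le_of_lt h) 1 (by norm_num)

theorem mult_mul (hpq : p * q ∈ LY d) (hpos : ∀ j, 0 < ℓ j) (x : Torus n) :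
    mult (p * q) x = mult p x + mult q x := by
  have h1 := analyticOrderAt_lineC_zero hpq hpos x
  have h2 := analyticOrderAt_lineC_zero (mem_LY_of_dvd hpq (dvd_mul_right p q)) hpos x
  have h3 := analyticOrderAt_lineC_zero (mem_LY_of_dvd hpq (dvd_mul_left q p)) hpos x
  have h4 : lineC (p * q) ℓ x = lineC p ℓ x * lineC q ℓ x := by
    funext w
    rw [Pi.mul_apply, lineC, lineC, lineC, map_mul]
  rw [h4, analyticOrderAt_mul (analyticAt_lineC p x 0) (analyticAt_lineC q x 0), h2, h3] at h1
  exact_mod_cast h1.symm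

/-- At a point of the zero set of `q` at which the flow is transverse, exactly one factor of `q`
vanishes, and it vanishes to first order, so its zero set agrees locally with that of `q`. -/
theorem eventually_mult_eq_of_dvd {g : MvPolynomial (Fin n) ℂ} (hq : q ∈ LY d)
    (hpos : ∀ j, 0 < ℓ j) (hg : g ∣ q) {x : Torus n} (hx' : x ∉ zeroSet (lineDeriv ℓ q)) :
    ∀ᶠ y in 𝓝[zeroSet q] x, mult g y = mult g x := by
  have hgLY := mem_LY_of_dvd hq hg
  by_cases hgx : x ∈ zeroSet g
  · obtain ⟨r, rfl⟩ := hg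
    have h0 : MvPolynomial.eval (expI x) g = 0 := hgx
    have h1 : MvPolynomial.eval (expI x) (lineDeriv ℓ (g * r)) ≠ 0 := hx'
    rw [Derivation.leibniz, smul_eq_mul, smul_eq_mul, map_add, map_mul, map_mul, h0, zero_mul,
      zero_add, mul_ne_zero_iff] at h1
    have hr : x ∉ zeroSet r := h1.1
    have hD : x ∉ zeroSet (lineDeriv ℓ g) := h1.2
    rw [mult_eq_one hgLY hpos hgx hD]
    filter_upwards [self_mem_nhdsWithin,
      nhdsWithin_le_nhds ((isClosed_zeroSet r).isOpen_compl.mem_nhds hr),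
      nhdsWithin_le_nhds ((isClosed_zeroSet (lineDeriv ℓ g)).isOpen_compl.mem_nhds hD)]
      with y hy hry hDy
    refine mult_eq_one hgLY hpos ?_ hDy
    have hy : MvPolynomial.eval (expI y) (g * r) = 0 := hy
    rw [map_mul, mul_eq_zero] at hy
    exact hy.resolve_right hry
  · rw [mult_eq_zero hgLY hpos hgx]
    filter_upwards [nhdsWithin_le_nhds ((isClosed_zeroSet g).isOpen_compl.mem_nhds hgx)] with y hy
    exact mult_eq_zero hgLY hpos hy

/-- The multiplicity of `p` is locally constant on the zero set of the reduced polynomial `q` at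
points at which the flow is transverse. -/
theorem eventually_mult_eq (hq : q ∈ LY d) (hpos : ∀ j, 0 < ℓ j)
    {x : Torus n} (hx' : x ∉ zeroSet (lineDeriv ℓ q)) (hp : p ∈ LY fun j => p.degreeOf j)
    (hpq : ∀ g, Irreducible g → g ∣ p → g ∣ q) :
    ∀ᶠ y in 𝓝[zeroSet q] x, mult p y = mult p x := by
  induction p using WfDvdMonoid.induction_on_irreducible with
  | zero => exact absurd rfl (ne_zero_of_mem_LY hp)
  | unit u hu =>
    have h0 : ∀ y, mult u y = 0 := fun y =>
      mult_eq_zero hp hpos (hu.map (MvPolynomial.eval (expI y))).ne_zero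
    exact Eventually.of_forall fun y => by rw [h0, h0]
  | mul a g ha hg ih =>
    have h1 := ih (mem_LY_of_dvd hp (dvd_mul_left a g)) fun f hf hfa => hpq f hf (hfa.mul_left g)
    have h2 := eventually_mult_eq_of_dvd hq hpos (hpq g hg (dvd_mul_right g a)) hx'
    filter_upwards [h1, h2] with y hy1 hy2
    rw [mult_mul hp hpos, mult_mul hp hpos, hy1, hy2]

/-- Near a transverse point the derivative along the flow is close to a nonzero constant, so an
orbit passing nearby has at most one zero there. It has one by Hurwitz's theorem. -/
theorem isRegularPoint_of_notMem (hq : q ∈ LY d) (hpos : ∀ j, 0 < ℓ j) {x : Torus n}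
    (hx : x ∈ zeroSet q) (hx' : x ∉ zeroSet (lineDeriv ℓ q)) :
    IsRegularPoint ℓ (zeroSet q) x := by
  obtain ⟨c, hc⟩ : ∃ c, c = MvPolynomial.eval (expI x) (lineDeriv ℓ q) := ⟨_, rfl⟩
  have hc0 : 0 < ‖c‖ := norm_pos_iff.2 (by rw [hc]; exact hx')
  have hcont : Continuous fun z : ℝ × Torus n => lineFun (lineDeriv ℓ q) ℓ z.2 z.1 :=
    (MvPolynomial.continuous_eval _).comp (continuous_expI.comp continuous_flow)
  have hev : ∀ᶠ z in 𝓝 (0 : ℝ) ×ˢ 𝓝 x, ‖lineFun (lineDeriv ℓ q) ℓ z.2 z.1 - c‖ < ‖c‖ / 2 := by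
    rw [← nhds_prod_eq]
    refine ((hcont.sub continuous_const).norm.tendsto (0, x)).eventually (gt_mem_nhds ?_)
    change ‖MvPolynomial.eval (expI (flow ℓ 0 x)) (lineDeriv ℓ q) - c‖ < ‖c‖ / 2
    rw [flow_zero, ← hc, sub_self, norm_zero]
    exact half_pos hc0
  obtain ⟨P, hP, Q, hQ, hPQ⟩ := eventually_prod_iff.1 hev
  obtain ⟨r₀, hr₀, hball⟩ := Metric.eventually_nhds_iff.1 hP
  refine ⟨r₀, hr₀, fun r hr hrr => ?_⟩
  filter_upwards [eventually_exists_hit hq hpos hx hr, hQ] with y ⟨t, ht, htS⟩ hy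
  refine ⟨t, ⟨ht, htS⟩, fun s ⟨hs, hsS⟩ => ?_⟩
  -- subtracting the linear function `u ↦ u c` leaves a function with Lipschitz constant `‖c‖ / 2`
  have hderiv : ∀ u ∈ Metric.ball (0 : ℝ) r₀, HasDerivWithinAt
      (fun u : ℝ => lineFun q ℓ y u - u • c) (lineFun (lineDeriv ℓ q) ℓ y u - (1 : ℝ) • c)
      (Metric.ball (0 : ℝ) r₀) u := fun u _ =>
    ((hasDerivAt_lineFun q y u).sub ((hasDerivAt_id u).smul_const c)).hasDerivWithinAt
  have hbound : ∀ u ∈ Metric.ball (0 : ℝ) r₀,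
      ‖lineFun (lineDeriv ℓ q) ℓ y u - (1 : ℝ) • c‖ ≤ ‖c‖ / 2 := fun u hu => by
    rw [one_smul]
    exact (hPQ (hball hu) hy).le
  have hmem : ∀ {u : ℝ}, |u| < r → u ∈ Metric.ball (0 : ℝ) r₀ := fun hu => by
    rw [mem_ball_zero_iff, Real.norm_eq_abs]; exact hu.trans_le hrr
  have h := (convex_ball (0 : ℝ) r₀).norm_image_sub_le_of_norm_hasDerivWithin_le hderiv hbound
    (hmem ht) (hmem hs)
  have e1 : lineFun q ℓ y t = 0 := htS
  have e2 : lineFun q ℓ y s = 0 := hsS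
  rw [e1, e2, zero_sub, zero_sub, neg_sub_neg, ← sub_smul, norm_smul, norm_sub_rev t s] at h
  have h3 : ‖s - t‖ ≤ 0 := by
    by_contra! h4
    have := mul_pos h4 hc0
    linarith
  exact sub_eq_zero.1 (norm_le_zero_iff.1 h3)

/-! ### The exceptional set and the total mass -/

/-- The points of the zero set of the reduced polynomial at which the flow is not transverse. -/
def tangencySet (p : MvPolynomial (Fin n) ℂ) (ℓ : Fin n → ℝ) : Set (Torus n) :=
  zeroSet (reduced p) ∩ zeroSet (lineDeriv ℓ (reduced p))

theorem isClosed_tangencySet : IsClosed (tangencySet p ℓ) :=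
  (isClosed_zeroSet _).inter (isClosed_zeroSet _)

theorem tangencySet_subset : tangencySet p ℓ ⊆ zeroSet p := fun _ hx =>
  zeroSet_subset_of_dvd (reduced_dvd p) hx.1

theorem crossMeasure_tangencySet (hn : 1 ≤ n) (hp : p ∈ LY d) (hpos : ∀ j, 0 < ℓ j)
    (hS : IsCrossSection ℓ (zeroSet p)) : crossMeasure ℓ (zeroSet p) (tangencySet p ℓ) = 0 :=
  crossMeasure_eq_zero_of_hausdorffMeasure hn hpos hS
    (hausdorffMeasure_tangency_eq_zero hn (reduced_mem_LY hp) (squarefree_reduced p) hpos)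

theorem notMem_zeroSet_lineDeriv (hp : p ∈ LY d) {x : Torus n} (hx : x ∈ zeroSet p)
    (hx' : x ∉ tangencySet p ℓ) : x ∉ zeroSet (lineDeriv ℓ (reduced p)) := fun h =>
  hx' ⟨by rwa [zeroSet_reduced (ne_zero_of_mem_LY hp)], h⟩

theorem isRegularPoint_zeroSet (hp : p ∈ LY d) (hpos : ∀ j, 0 < ℓ j) {x : Torus n}
    (hx : x ∈ zeroSet p) (hx' : x ∉ tangencySet p ℓ) : IsRegularPoint ℓ (zeroSet p) x := by
  have h := notMem_zeroSet_lineDeriv hp hx hx'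
  rw [← zeroSet_reduced (ne_zero_of_mem_LY hp)] at hx ⊢
  exact isRegularPoint_of_notMem (reduced_mem_LY hp) hpos hx h

theorem continuousWithinAt_mult (hp : p ∈ LY d) (hpos : ∀ j, 0 < ℓ j) {x : Torus n}
    (hx : x ∈ zeroSet p) (hx' : x ∉ tangencySet p ℓ) :
    ContinuousWithinAt (fun y => (mult p y : ℂ)) (zeroSet p) x := by
  have hp0 := ne_zero_of_mem_LY hp
  have h := eventually_mult_eq (reduced_mem_LY hp) hpos (notMem_zeroSet_lineDeriv hp hx hx')
    (mem_LY_of_dvd hp dvd_rfl) fun g hg hgp => (dvd_reduced_iff hg hp0).2 hgp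
  rw [zeroSet_reduced hp0] at h
  exact tendsto_const_nhds.congr' (h.mono fun y hy => by simp only [hy])

/-- The reduced polynomial has almost everywhere multiplicity one on its zero set, so the mass of
the cross-section is the integral of that multiplicity. -/
theorem crossMeasure_zeroSet (hn : 1 ≤ n) (hp : p ∈ LY d) (hpos : ∀ j, 0 < ℓ j)
    (hS : IsCrossSection ℓ (zeroSet p)) :
    crossMeasure ℓ (zeroSet p) (zeroSet p) =
      ENNReal.ofReal ((2 * π) ^ (n - 1) * pairing (redDegree p) ℓ) := by
  have hred := zeroSet_reduced (ne_zero_of_mem_LY hp)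
  have hq := reduced_mem_LY hp
  have h := lintegral_mult hn hq hpos (by rwa [hred])
  rw [hred] at h
  rw [← h, ← lintegral_indicator_one (isClosed_zeroSet p).measurableSet]
  refine lintegral_congr_ae ?_
  filter_upwards [measure_eq_zero_iff_ae_notMem.1 (crossMeasure_tangencySet hn hp hpos hS)]
    with x hx
  by_cases hxS : x ∈ zeroSet p
  · rw [Set.indicator_of_mem hxS, mult_eq_one hq hpos (by rwa [hred])
      (notMem_zeroSet_lineDeriv hp hxS hx)]
    simp
  · rw [Set.indicator_of_notMem hxS, mult_eq_zero hq hpos (by rwa [hred])]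
    simp

theorem pairing_pos (hpos : ∀ j, 0 < ℓ j) (hd : d ≠ 0) : 0 < pairing d ℓ := by
  obtain ⟨j, hj⟩ := Function.ne_iff.1 hd
  refine Finset.sum_pos' (fun j _ => mul_nonneg (Nat.cast_nonneg _) (hpos j).le)
    ⟨j, Finset.mem_univ j, mul_pos (Nat.cast_pos.2 (Nat.pos_of_ne_zero hj)) (hpos j)⟩

theorem zeroSet_nonempty_iff (hp : p ∈ LY d) : (zeroSet p).Nonempty ↔ d ≠ 0 := by
  refine ⟨?_, zeroSet_nonempty hp⟩
  rintro ⟨x, hx⟩ rfl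
  have hC : p = MvPolynomial.C (p.coeff 0) := by
    rw [← MvPolynomial.totalDegree_eq_zero_iff_eq_C, MvPolynomial.totalDegree_eq_zero_iff]
    intro m hm j
    exact Nat.le_zero.1 ((MvPolynomial.monomial_le_degreeOf j hm).trans (hp.1 j).le)
  have h : MvPolynomial.eval (expI x) p = 0 := hx
  refine ne_zero_of_mem_LY hp ?_
  rw [hC, MvPolynomial.eval_C] at h
  rw [hC, h, map_zero]

theorem redDegree_ne_zero_iff (hp : p ∈ LY d) : redDegree p ≠ 0 ↔ d ≠ 0 := by
  rw [← zeroSet_nonempty_iff (reduced_mem_LY hp), ← zeroSet_nonempty_iff hp,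
    zeroSet_reduced (ne_zero_of_mem_LY hp)]

/-! ### Zero sequences -/

theorem isZeroSequence_iff (hp : p ∈ LY d) (hpos : ∀ j, 0 < ℓ j) {x₀ : Torus n} {x : ℤ → ℝ} :
    IsZeroSequence p ℓ x₀ x ↔ IsVisitListing ℓ (zeroSet p) (mult p) x₀ x := by
  refine ⟨fun h => ⟨h.1, fun t _ => ?_, fun j => ?_⟩, fun h => ⟨h.monotone, fun t => ?_⟩⟩
  · rw [h.2, analyticOrderAt_lineFun hp hpos]
  · by_contra hj
    have h1 := h.2 (x j)
    rw [analyticOrderAt_lineFun hp hpos, mult_eq_zero hp hpos hj, Nat.cast_zero,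
      Set.encard_eq_zero] at h1
    exact Set.eq_empty_iff_forall_notMem.1 h1 j rfl
  · rw [analyticOrderAt_lineFun hp hpos]
    by_cases ht : flow ℓ t x₀ ∈ zeroSet p
    · exact h.encard_of_mem t ht
    · rw [mult_eq_zero hp hpos ht, Nat.cast_zero, Set.encard_eq_zero]
      refine Set.eq_empty_iff_forall_notMem.2 fun j hj => ht ?_
      rw [← (hj : x j = t)]
      exact h.mem j

/-! ### The degenerate case -/

theorem isFlowMeasure_zero (he : zeroSet p = ∅) : IsFlowMeasure p ℓ 0 := by
  refine ⟨rfl, fun A _ hA => ?_⟩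
  rw [he, Set.subset_empty_iff] at hA
  have h : ∀ ε, thicken ℓ ε A = ∅ := fun ε =>
    Set.eq_empty_iff_forall_notMem.2 fun y ⟨x, hx, _⟩ => by rw [hA] at hx; exact hx
  simp only [h, measure_empty, ENNReal.zero_div]
  exact tendsto_const_nhds

end

end LeeYangTorus

end

open LeeYangTorus

theorem mainTheorem9 {n : ℕ} (hn : 1 ≤ n) (d : Fin n → ℕ) (p : MvPolynomial (Fin n) ℂ)
    (hp : p ∈ LeeYangTorus.LY d) (ℓ : Fin n → ℝ) (hpos : ∀ j, 0 < ℓ j)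
    (hind : LinearIndependent ℚ ℓ) :
    -- the measure, the first return time and the zero sequences are well defined
    LeeYangTorus.IsFlowMeasure p ℓ (LeeYangTorus.flowMeasure p ℓ) ∧
    (∀ x ∈ LeeYangTorus.zeroSet p,
      IsLeast {t : ℝ | 0 < t ∧ LeeYangTorus.flow ℓ t x ∈ LeeYangTorus.zeroSet p}
        (LeeYangTorus.returnTime p ℓ x)) ∧
    (∀ x₀ ∈ LeeYangTorus.zeroSet p, ∃ x : ℤ → ℝ, LeeYangTorus.IsZeroSequence p ℓ x₀ x) ∧
    -- the total masses
    LeeYangTorus.flowMeasure p ℓ (LeeYangTorus.zeroSet p) =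
      ENNReal.ofReal
        ((2 * π) ^ (n - 1) * LeeYangTorus.pairing (LeeYangTorus.redDegree p) ℓ) ∧
    IntegrableOn (fun x => (LeeYangTorus.mult p x : ℝ)) (LeeYangTorus.zeroSet p)
      (LeeYangTorus.flowMeasure p ℓ) ∧
    (∫ x in LeeYangTorus.zeroSet p, (LeeYangTorus.mult p x : ℝ) ∂(LeeYangTorus.flowMeasure p ℓ)) =
      (2 * π) ^ (n - 1) * LeeYangTorus.pairing d ℓ ∧
    -- the two averages
    (∀ h : LeeYangTorus.Torus n → ℂ, LeeYangTorus.BoundedOnZeroSet p h →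
      LeeYangTorus.RiemannIntegrableOnZeroSet p h →
      IntegrableOn h (LeeYangTorus.zeroSet p) (LeeYangTorus.flowMeasure p ℓ) ∧
      IntegrableOn (fun x => (LeeYangTorus.mult p x : ℂ) * h x) (LeeYangTorus.zeroSet p)
        (LeeYangTorus.flowMeasure p ℓ) ∧
      ∀ x₀ ∈ LeeYangTorus.zeroSet p,
        Tendsto
          (fun N : ℕ => (1 / (N : ℂ)) *
            ∑ j ∈ Finset.Icc 1 N, h ((LeeYangTorus.returnMap p ℓ)^[j] x₀))
          atTop
          (𝓝 (1 / (((2 * π) ^ (n - 1) *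
              LeeYangTorus.pairing (LeeYangTorus.redDegree p) ℓ : ℝ) : ℂ) *
            ∫ x in LeeYangTorus.zeroSet p, h x ∂(LeeYangTorus.flowMeasure p ℓ))) ∧
        ∀ x : ℤ → ℝ, LeeYangTorus.IsZeroSequence p ℓ x₀ x →
          Tendsto
            (fun N : ℕ => (1 / (N : ℂ)) *
              ∑ j ∈ Finset.Icc 1 N, h (LeeYangTorus.flow ℓ (x (j : ℤ)) x₀))
            atTop
            (𝓝 (1 / (((2 * π) ^ (n - 1) * LeeYangTorus.pairing d ℓ : ℝ) : ℂ) *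
              ∫ x in LeeYangTorus.zeroSet p,
                (LeeYangTorus.mult p x : ℂ) * h x ∂(LeeYangTorus.flowMeasure p ℓ)))) := by
  have hmeas := (isClosed_zeroSet p).measurableSet
  rcases (zeroSet p).eq_empty_or_nonempty with he | hne
  -- a constant polynomial: the zero set is empty and both sides of every identity vanish
  · have hd : d = 0 := by
      by_contra hd
      exact ((zeroSet_nonempty_iff hp).2 hd).ne_empty he
    have hrd : redDegree p = 0 := by
      by_contra h
      exact (redDegree_ne_zero_iff hp).1 h hd
    have hm := flowMeasure_eq_of_isFlowMeasure (isFlowMeasure_zero (ℓ := ℓ) he)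
    have hpair : pairing (0 : Fin n → ℕ) ℓ = 0 := by simp [pairing]
    have hx : ∀ x, x ∉ zeroSet p := Set.eq_empty_iff_forall_notMem.1 he
    rw [hm, hd, hrd, hpair]
    refine ⟨isFlowMeasure_zero he, fun x h => absurd h (hx x), fun x h => absurd h (hx x), by simp,
      by rw [he]; exact integrableOn_empty, by simp, fun h _ _ =>
        ⟨by rw [he]; exact integrableOn_empty, by rw [he]; exact integrableOn_empty,
          fun x h => absurd h (hx x)⟩⟩
  have hS := isCrossSection_zeroSet hp hpos hind hne
  have hd := (zeroSet_nonempty_iff hp).1 hne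
  have hflow := isFlowMeasure_crossMeasure hS
  rw [flowMeasure_eq_of_isFlowMeasure hflow]
  have hfin := isFiniteMeasure_crossMeasure hS
  have hmass := crossMeasure_zeroSet hn hp hpos hS
  have hpair := pairing_pos hpos hd
  have hrpair := pairing_pos hpos ((redDegree_ne_zero_iff hp).2 hd)
  have hres : (crossMeasure ℓ (zeroSet p)).restrict (zeroSet p) = crossMeasure ℓ (zeroSet p) :=
    Measure.restrict_eq_self_of_ae_mem (mem_ae_iff.2 (crossMeasure_compl hS))
  obtain ⟨K, hK⟩ := exists_mult_le hp hpos
  have hKn : ∀ x ∈ zeroSet p, ‖(mult p x : ℂ)‖ ≤ K := fun x _ => by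
    rw [Complex.norm_natCast]; exact Nat.cast_le.2 (hK x)
  have hint : ∫ x in zeroSet p, (mult p x : ℝ) ∂(crossMeasure ℓ (zeroSet p)) =
      (2 * π) ^ (n - 1) * pairing d ℓ := by
    rw [hres, integral_eq_lintegral_of_nonneg_ae (Eventually.of_forall fun x => Nat.cast_nonneg _)
      (measurable_from_top.comp (measurable_mult hp hpos)).aestronglyMeasurable]
    simp only [ENNReal.ofReal_natCast]
    rw [lintegral_mult hn hp hpos hS, ENNReal.toReal_ofReal (by positivity)]
  have hintC : ∫ x in zeroSet p, (mult p x : ℂ) ∂(crossMeasure ℓ (zeroSet p)) =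
      (((2 * π) ^ (n - 1) * pairing d ℓ : ℝ) : ℂ) := by
    rw [← hint]
    exact integral_ofReal (𝕜 := ℂ) (f := fun x => (mult p x : ℝ))
  refine ⟨hflow, fun x _ => hS.isLeast_firstReturn x, fun x₀ _ => ?_, hmass, ?_, hint,
    fun h ⟨C, hC⟩ hR => ?_⟩
  · obtain ⟨x, hx⟩ := exists_isVisitListing hS (fun y hy => (mult_pos_iff hp hpos).2 hy) x₀
    exact ⟨x, (isZeroSequence_iff hp hpos).2 hx⟩
  · refine Integrable.of_bound
      (measurable_from_top.comp (measurable_mult hp hpos)).aestronglyMeasurable K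
      (Eventually.of_forall fun x => ?_)
    rw [Real.norm_natCast]
    exact Nat.cast_le.2 (hK x)
  -- the exceptional set: closure of the discontinuities, and the tangencies of the flow
  obtain ⟨E, hE⟩ : ∃ E, E = closure {x | x ∈ zeroSet p ∧ ¬ ContinuousWithinAt h (zeroSet p) x} ∪
    tangencySet p ℓ := ⟨_, rfl⟩
  have hEc : IsClosed E := by rw [hE]; exact isClosed_closure.union isClosed_tangencySet
  have hES : E ⊆ zeroSet p := by
    rw [hE]
    exact Set.union_subset (closure_minimal (fun x hx => hx.1) (isClosed_zeroSet p))
      tangencySet_subset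
  have hE0 : crossMeasure ℓ (zeroSet p) E = 0 := by
    rw [hE]
    exact measure_union_null (crossMeasure_eq_zero_of_hausdorffMeasure hn hpos hS hR)
      (crossMeasure_tangencySet hn hp hpos hS)
  have hET : ∀ {x}, x ∉ E → x ∉ tangencySet p ℓ := fun hx h => hx (by rw [hE]; exact Or.inr h)
  have hreg : ∀ x ∈ zeroSet p, x ∉ E → IsRegularPoint ℓ (zeroSet p) x := fun x hx hxE =>
    isRegularPoint_zeroSet hp hpos hx (hET hxE)
  have hcont : ∀ x ∈ zeroSet p, x ∉ E → ContinuousWithinAt h (zeroSet p) x := fun x hx hxE => by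
    by_contra hcon
    exact hxE (by rw [hE]; exact Or.inl (subset_closure ⟨hx, hcon⟩))
  have hmcont : ∀ x ∈ zeroSet p, x ∉ E →
      ContinuousWithinAt (fun y => (mult p y : ℂ)) (zeroSet p) x := fun x hx hxE =>
    continuousWithinAt_mult hp hpos hx (hET hxE)
  refine ⟨integrableOn_of_continuousWithinAt hmeas hEc hE0 hC hcont,
    integrableOn_of_continuousWithinAt hmeas hEc hE0 (C := K * C) (fun x hx => ?_)
      fun x hx hxE => (hmcont x hx hxE).mul (hcont x hx hxE), fun x₀ _ => ⟨?_, fun x hx => ?_⟩⟩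
  · rw [norm_mul]
    exact mul_le_mul (hKn x hx) (hC x hx) (norm_nonneg _) (Nat.cast_nonneg _)
  · have hM : (crossMeasure ℓ (zeroSet p)).real (zeroSet p) =
        (2 * π) ^ (n - 1) * pairing (redDegree p) ℓ := by
      rw [measureReal_def, hmass, ENNReal.toReal_ofReal (by positivity)]
    have hM0 : crossMeasure ℓ (zeroSet p) (zeroSet p) ≠ 0 := by
      rw [hmass]
      exact (ENNReal.ofReal_pos.2 (by positivity)).ne'
    rw [← hM]
    exact tendsto_average_iterate hind hS hM0 hEc hES hE0 hreg hC hcont x₀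
  · rw [← hintC]
    refine ((isZeroSequence_iff hp hpos).1 hx).tendsto_average hind hS hEc hES hE0 hreg
      (fun y _ => hK y) hmcont ?_ hC hcont
    rw [hintC, Complex.ofReal_ne_zero]
    positivity
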